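/- Let $M$ be a smooth manifold of dimension $n+1$ and let $\pi : M \to \mathbb{R}$ be a fibration (a surjective smooth submersion). All brackets below are $\{f,g\}=\Lambda(df,dg)$, and a Poisson structure is a smooth $2$-vector $\Lambda$ with $[\Lambda,\Lambda]=0$. Notation. Let $\eta = d\pi$ (the pull-back of $dt$), let $V\pi=\ker\eta$ be the vertical bundle, $V^*\pi$ its dual bundle with projection $\pi^*_{1,0}:V^*\pi\to M$, and $\mu : T^*M \to V^*\pi$ the restriction of covectors. Let $J^1\pi=\{v\in TM : \eta(v)=1\}$ be the space of $1$-jets of local sections of $\pi$, and let $\eta_1$ be the differential of the projection $J^1\pi\to\mathbb{R}$. Let $J^1\pi_1^* \subseteq T(V^*\pi)$ be the space of $1$-jets of local sections of $V^*\pi\to\mathbb{R}$, that is, the set of tangent vectors of $V^*\pi$ on which the differential of $V^*\pi\to\mathbb{R}$ equals $1$. Let $T^*(J^1\pi)/\langle\eta_1\rangle$ be the quotient of $T^*(J^1\pi)$ by the line subbundle generated by $\eta_1$, with canonical projection $\mathrm{pr}$. Let $A_M : T(T^*M)\to T^*(TM)$ be the canonical Tulczyjew diffeomorphism of $M$, given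 in local coordinates by $(q,p;\dot q,\dot p)\mapsto(q,\dot q;\dot p,p)$. Then the following hold. 1. There is a unique $2$-vector $\Lambda_{V^*\pi}$ on $V^*\pi$ with $$\{\widehat X,\widehat Y\}=-\widehat{[X,Y]},\qquad \{f\circ\pi^*_{1,0},\widehat Y\}=Y(f)\circ\pi^*_{1,0},\qquad \{f\circ\pi^*_{1,0},g\circ\pi^*_{1,0}\}=0$$ for all smooth functions $f,g$ and smooth $\pi$-vertical vector fields $X,Y$ on open subsets of $M$, where $\widehat X(\beta)=\beta(X)$. It is a Poisson structure (the canonical Poisson structure of $V^*\pi$). 2. There is a unique $2$-vector $\Lambda^c_{V^*\pi}$ on $T(V^*\pi)$, the complete lift of $\Lambda_{V^*\pi}$, such that $\{f^c,g^c\}=\{f,g\}^c$, $\{f^c,g^v\}=\{f,g\}^v$ and $\{f^v,g^v\}=0$ for all smooth functions $f,g$ on open subsets of $V^*\pi$, where $f^v=f\circ\tau_{V^*\pi}$ with $\tau_{V^*\pi}:T(V^*\pi)\to V^*\pi$ the projection, and $f^c(w)=df(w)$. It is a Poisson structure. 3. $\Lambda^c_{V^*\pi}$ is tangent to $J^1\pi_1^*$: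 there is a unique $2$-vector $\Lambda_{J^1\pi_1^*}$ on $J^1\pi_1^*$ that the inclusion $J^1\pi_1^*\hookrightarrow T(V^*\pi)$ pushes forward to $\Lambda^c_{V^*\pi}$ along $J^1\pi_1^*$. It is a Poisson structure of corank $1$. 4. The canonical symplectic form $\Omega_{J^1\pi}=-d\theta$ of $T^*(J^1\pi)$ (with $\theta$ the Liouville $1$-form) has a unique inverse $2$-vector $\Lambda_{J^1\pi}$, that is, $\Lambda_{J^1\pi}(\iota_v\Omega_{J^1\pi},\iota_w\Omega_{J^1\pi})=\Omega_{J^1\pi}(v,w)$ for all $v,w$. It is a Poisson structure. There is a unique $2$-vector $\widetilde\Lambda_{J^1\pi}$ on $T^*(J^1\pi)/\langle\eta_1\rangle$ to which $\mathrm{pr}$ pushes $\Lambda_{J^1\pi}$ forward. It is a Poisson structure of corank $1$. 5. There is a unique diffeomorphism $A_\pi : J^1\pi_1^*\to T^*(J^1\pi)/\langle\eta_1\rangle$ (the canonical Tulczyjew diffeomorphism of $\pi$) such that, for every $v\in J^1\pi$ and $\alpha_v\in T_v^*(J^1\pi)$, $$A_\pi^{-1}(\mathrm{pr}(\alpha_v))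 = T\mu\bigl(A_M^{-1}(\tilde\alpha_v)\bigr)$$ for every $\tilde\alpha_v\in T_v^*(TM)$ that restricts to $\alpha_v$ on $T_v(J^1\pi)$; such covectors $\tilde\alpha_v$ exist. 6. $A_\pi$ is a Poisson isomorphism from $(J^1\pi_1^*,\Lambda_{J^1\pi_1^*})$ onto $(T^*(J^1\pi)/\langle\eta_1\rangle,\widetilde\Lambda_{J^1\pi})$. -/

import Mathlib

open Set Manifold
open scoped Manifold ContDiff Topology

noncomputable section

namespace TulczyjewTriple

/-! ### Cotangent bundles, two-vectors and Poisson structures -/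

section Poisson

variable {E : Type*} [NormedAddCommGroup E] [NormedSpace ℝ E]
  {H : Type*} [TopologicalSpace H] (I : ModelWithCorners ℝ E H)
  (X : Type*) [TopologicalSpace X] [ChartedSpace H X]
  {E' : Type*} [NormedAddCommGroup E'] [NormedSpace ℝ E']
  {H' : Type*} [TopologicalSpace H'] (I' : ModelWithCorners ℝ E' H')
  {Y : Type*} [TopologicalSpace Y] [ChartedSpace H' Y]

variable {X} in
/-- The cotangent space of `X` at `x`. -/
abbrev CotangentSpace (x : X) : Type _ := TangentSpace I x →L[ℝ] ℝ

/-- The cotangent bundle `T*X`. -/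
abbrev CotangentBundle : Type _ := Bundle.TotalSpace (E →L[ℝ] ℝ) (fun x : X => TangentSpace I x →L[ℝ] ℝ)

/-- A smooth 2-vector `Λ` on `X`: an alternating bilinear form on each cotangent space, such that
`Λ(df, dg)` is smooth for all smooth functions `f, g` on open subsets of `X`. -/
@[ext]
structure BivectorField where
  toFun : ∀ x : X, CotangentSpace I x →ₗ[ℝ] CotangentSpace I x →ₗ[ℝ] ℝ
  self_eq_zero : ∀ x α, toFun x α α = 0
  smooth : ∀ (U : Set X) (f g : X → ℝ), IsOpen U →
    ContMDiffOn I 𝓘(ℝ, ℝ) ∞ f U → ContMDiffOn I 𝓘(ℝ, ℝ) ∞ g U →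
    ContMDiffOn I 𝓘(ℝ, ℝ) ∞ (fun x => toFun x (mvfderiv I f x) (mvfderiv I g x)) U

variable {I X I'}

/-- The bracket `{f, g} = Λ(df, dg)`. -/
def BivectorField.bracket (Λ : BivectorField I X) (f g : X → ℝ) (x : X) : ℝ :=
  Λ.toFun x (mvfderiv I f x) (mvfderiv I g x)

/-- `Λ` is a Poisson structure: `[Λ, Λ] = 0`. The Schouten bracket is expressed by its values
`½ [Λ, Λ](df, dg, dh) = {f, {g, h}} + {g, {h, f}} + {h, {f, g}}`
for smooth functions on open subsets. -/
def BivectorField.IsPoisson (Λ : BivectorField I X) : Prop :=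
  ∀ (U : Set X) (f g h : X → ℝ), IsOpen U →
    ContMDiffOn I 𝓘(ℝ, ℝ) ∞ f U → ContMDiffOn I 𝓘(ℝ, ℝ) ∞ g U → ContMDiffOn I 𝓘(ℝ, ℝ) ∞ h U →
    ∀ x ∈ U, Λ.bracket f (Λ.bracket g h) x + Λ.bracket g (Λ.bracket h f) x
      + Λ.bracket h (Λ.bracket f g) x = 0

/-- The rank of `Λ` at `x`: the dimension of the image of `Λ♯ : α ↦ Λ(α, -)`. -/
def BivectorField.rank (Λ : BivectorField I X) (x : X) : ℕ :=
  Module.finrank ℝ (LinearMap.range (Λ.toFun x))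

/-- `Λ` has constant corank `k`. -/
def BivectorField.HasCorank (Λ : BivectorField I X) (k : ℕ) : Prop :=
  ∀ x : X, Λ.rank x + k = Module.finrank ℝ (TangentSpace I x)

/-- `φ` is smooth and pushes `Λ` forward to `Λ'`:
`Λ'(φ x)(α, β) = Λ(x)((T_xφ)^* α, (T_xφ)^* β)`. For Poisson structures: `φ` is a Poisson map. -/
def IsPoissonMap (φ : X → Y) (Λ : BivectorField I X) (Λ' : BivectorField I' Y) : Prop :=
  ContMDiff I I' ∞ φ ∧ ∀ (x : X) (α β : CotangentSpace I' (φ x)),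
    Λ'.toFun (φ x) α β = Λ.toFun x (α ∘L mfderiv I I' φ x) (β ∘L mfderiv I I' φ x)

/-- The vertical lift of a function to the tangent bundle. -/
def verticalLift (I : ModelWithCorners ℝ E H) (f : X → ℝ) (v : TangentBundle I X) : ℝ := f v.proj

/-- The complete lift of a function to the tangent bundle: `f^c(v) = df(v)`. -/
def completeLift (I : ModelWithCorners ℝ E H) (f : X → ℝ) (v : TangentBundle I X) : ℝ :=
  mvfderiv I f v.proj v.snd

/-- `Λc` is the complete lift of `Λ` to the tangent bundle:
`{f^c, g^c} = {f, g}^c`, `{f^c, g^v} = {f, g}^v`, `{f^v, g^v} = 0`. -/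
def IsCompleteLift [IsManifold I 1 X] (Λ : BivectorField I X)
    (Λc : BivectorField I.tangent (TangentBundle I X)) : Prop :=
  ∀ (U : Set X) (f g : X → ℝ), IsOpen U →
    ContMDiffOn I 𝓘(ℝ, ℝ) ∞ f U → ContMDiffOn I 𝓘(ℝ, ℝ) ∞ g U →
    ∀ v : TangentBundle I X, v.proj ∈ U →
      Λc.bracket (completeLift I f) (completeLift I g) v = completeLift I (Λ.bracket f g) v ∧
      Λc.bracket (completeLift I f) (verticalLift I g) v = verticalLift I (Λ.bracket f g) v ∧
      Λc.bracket (verticalLift I f) (verticalLift I g) v = 0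

/-- The exterior derivative `(dθ)_x(v, w)` of a 1-form `θ` on a manifold without boundary:
in the chart `φ` at `x` it is `D_v θ(w) - D_w θ(v)`. -/
def oneFormD (θ : ∀ x : X, CotangentSpace I x) (x : X) (v w : TangentSpace I x) : ℝ :=
  let φ := extChartAt I x
  let θ' : E → E →L[ℝ] ℝ := fun u => (θ (φ.symm u)) ∘L (mfderiv 𝓘(ℝ, E) I φ.symm u)
  let v' : E := mfderiv I 𝓘(ℝ, E) φ x v
  let w' : E := mfderiv I 𝓘(ℝ, E) φ x w
  fderiv ℝ θ' (φ x) v' w' - fderiv ℝ θ' (φ x) w' v'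

/-- The 2-vector `Λ` is the inverse of the nondegenerate 2-form `Ω`:
`Λ(ι_v Ω, ι_w Ω) = Ω(v, w)`. -/
def IsInverseOfTwoForm (Ω : ∀ x : X, TangentSpace I x → TangentSpace I x → ℝ)
    (Λ : BivectorField I X) : Prop :=
  ∀ x : X, (∀ v, (∀ w, Ω x v w = 0) → v = 0) ∧
    ∀ (v w : TangentSpace I x) (α β : CotangentSpace I x),
      (∀ u, α u = Ω x v u) → (∀ u, β u = Ω x w u) → Λ.toFun x α β = Ω x v w

variable (I X)

/-- The Liouville 1-form on `T*X`: `θ_a(w) = a(Tτ w)` for `τ : T*X → X`. -/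
def liouville [IsManifold I 1 X] (a : CotangentBundle I X) :
    CotangentSpace (I.prod 𝓘(ℝ, E →L[ℝ] ℝ)) a :=
  a.snd ∘L mfderiv (I.prod 𝓘(ℝ, E →L[ℝ] ℝ)) I (Bundle.TotalSpace.proj : CotangentBundle I X → X) a

/-- The canonical symplectic form `Ω = -dθ` (that is, `dq ∧ dp`) on `T*X`. -/
def canonicalTwoForm [IsManifold I 1 X] (a : CotangentBundle I X)
    (v w : TangentSpace (I.prod 𝓘(ℝ, E →L[ℝ] ℝ)) a) : ℝ :=
  -oneFormD (liouville I X) a v w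

/-- The canonical Tulczyjew diffeomorphism `A_X : T(T*X) → T*(TX)`,
`(q, p; q̇, ṗ) ↦ (q, q̇; ṗ, p)`.

The point `a = (x, α)` of `T*X` has coordinates `(q, p)` in the chart of `T*X` induced by the
preferred chart of `X` at `x`; this is the preferred chart at `a`, so that an element of
`T_a(T*X) = E × (E →L[ℝ] ℝ)` is the pair `(q̇, ṗ)`. The same chart of `X` induces the preferred chart
of `TX` at `(x, q̇)`, so that `T_(x, q̇)(TX) = E × E`, and the value of the map at `(a; q̇, ṗ)` is
the covector `(δq, δq̇) ↦ ṗ(δq) + p(δq̇)`. -/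
def tulczyjew [IsManifold I 1 X] :
    TangentBundle (I.prod 𝓘(ℝ, E →L[ℝ] ℝ)) (CotangentBundle I X) ≃
      CotangentBundle I.tangent (TangentBundle I X) where
  toFun w :=
    let p : E →L[ℝ] ℝ := w.proj.snd
    let w' : E × (E →L[ℝ] ℝ) := w.snd
    let γ : E × E →L[ℝ] ℝ := w'.2 ∘L ContinuousLinearMap.fst ℝ E E + p ∘L ContinuousLinearMap.snd ℝ E E
    ⟨⟨w.proj.proj, w'.1⟩, γ⟩
  invFun b :=
    let q' : E := b.proj.snd
    let γ : E × E →L[ℝ] ℝ := b.snd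
    let w' : E × (E →L[ℝ] ℝ) := (q', γ ∘L ContinuousLinearMap.inl ℝ E E)
    ⟨⟨b.proj.proj, γ ∘L ContinuousLinearMap.inr ℝ E E⟩, w'⟩
  left_inv := by
    rintro ⟨⟨x, (p : E →L[ℝ] ℝ)⟩, ⟨(a : E), (b : E →L[ℝ] ℝ)⟩⟩
    have h1 : (b ∘L ContinuousLinearMap.fst ℝ E E + p ∘L ContinuousLinearMap.snd ℝ E E) ∘L
        ContinuousLinearMap.inr ℝ E E = p := by ext; simp
    have h2 : (b ∘L ContinuousLinearMap.fst ℝ E E + p ∘L ContinuousLinearMap.snd ℝ E E) ∘L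
        ContinuousLinearMap.inl ℝ E E = b := by ext; simp
    exact congrArg₂ (fun (p' b' : E →L[ℝ] ℝ) =>
      (⟨⟨x, p'⟩, ((a, b') : E × (E →L[ℝ] ℝ))⟩ :
        TangentBundle (I.prod 𝓘(ℝ, E →L[ℝ] ℝ)) (CotangentBundle I X))) h1 h2
  right_inv := by
    rintro ⟨⟨x, (a : E)⟩, (γ : E × E →L[ℝ] ℝ)⟩
    have h1 : (γ ∘L ContinuousLinearMap.inl ℝ E E) ∘L ContinuousLinearMap.fst ℝ E E +
        (γ ∘L ContinuousLinearMap.inr ℝ E E) ∘L ContinuousLinearMap.snd ℝ E E = γ := by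
      refine ContinuousLinearMap.ext fun w => ?_
      simp [← map_add]
    exact congrArg (fun γ' : E × E →L[ℝ] ℝ =>
      (⟨⟨x, a⟩, γ'⟩ : CotangentBundle I.tangent (TangentBundle I X))) h1

end Poisson

/-! ### Fibrations over the line and adapted coordinates -/

/-- A fibration `π : M → ℝ`: a surjective smooth submersion. -/
structure IsFibration (n : ℕ) {M : Type*} [TopologicalSpace M]
    [ChartedSpace (EuclideanSpace ℝ (Fin (n + 1))) M] (π : M → ℝ) : Prop where
  surjective : Function.Surjective π
  isSubmersion : IsSubmersion (𝓡 (n + 1)) 𝓘(ℝ, ℝ) ∞ π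

/-- The preferred charts of `N` are adapted to `p : N → ℝ`: they are of the form `(t, q)`, with
values in `ℝ × F` and with `t = p`. -/
class IsFibredAtlas (F : Type*) [NormedAddCommGroup F] [NormedSpace ℝ F]
    {N : Type*} [TopologicalSpace N] [ChartedSpace (ℝ × F) N] (p : N → ℝ) : Prop where
  fst_chartAt : ∀ x y : N, y ∈ (chartAt (ℝ × F) x).source → (chartAt (ℝ × F) x y).1 = p y

section AdaptedAtlas

variable {n : ℕ} {M : Type*} [TopologicalSpace M]
  [ChartedSpace (EuclideanSpace ℝ (Fin (n + 1))) M] {π : M → ℝ}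

lemma exists_adapted_chart_of_complement [IsManifold (𝓡 (n + 1)) ∞ M] {x : M}
    {C : Type*} [NormedAddCommGroup C] [NormedSpace ℝ C]
    (h : IsSubmersionAtOfComplement C (𝓡 (n + 1)) 𝓘(ℝ, ℝ) ∞ π x) :
    ∃ e : OpenPartialHomeomorph M (ℝ × EuclideanSpace ℝ (Fin n)), x ∈ e.source ∧
      (∀ y ∈ e.source, (e y).1 = π y) ∧
      ContMDiffOn (𝓡 (n + 1)) 𝓘(ℝ, ℝ × EuclideanSpace ℝ (Fin n)) ∞ e e.source ∧
      ContMDiffOn 𝓘(ℝ, ℝ × EuclideanSpace ℝ (Fin n)) (𝓡 (n + 1)) ∞ e.symm e.target := by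
  let L := h.equiv
  have fd : FiniteDimensional ℝ (ℝ × C) := L.toLinearEquiv.finiteDimensional
  have fd' : FiniteDimensional ℝ C :=
    FiniteDimensional.of_surjective (LinearMap.snd ℝ ℝ C) LinearMap.snd_surjective
  have hfr : Module.finrank ℝ C = Module.finrank ℝ (EuclideanSpace ℝ (Fin n)) := by
    have := L.toLinearEquiv.finrank_eq
    simp at this ⊢
    omega
  let κ : C ≃L[ℝ] EuclideanSpace ℝ (Fin n) := ContinuousLinearEquiv.ofFinrankEq hfr
  let φ := h.domChart
  let ψ := h.codChart
  let e₁ : OpenPartialHomeomorph M (ℝ × C) := φ ≫ₕ L.toHomeomorph.toOpenPartialHomeomorph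
  let e₂ : OpenPartialHomeomorph (ℝ × C) (ℝ × EuclideanSpace ℝ (Fin n)) :=
    ψ.symm.prod κ.toHomeomorph.toOpenPartialHomeomorph
  have hφ := h.domChart_mem_maximalAtlas
  have hψ := h.codChart_mem_maximalAtlas
  have key : ∀ y ∈ φ.source, (L (φ y)).1 = ψ (π y) := by
    intro y hy
    have hm : φ y ∈ (h.domChart.extend (𝓡 (n + 1))).target := by
      simpa [φ] using φ.map_source hy
    have := h.writtenInCharts hm
    simpa [φ, ψ, L, h.domChart.left_inv hy] using this.symm
  refine ⟨e₁ ≫ₕ e₂, ?_, ?_, ?_, ?_⟩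
  · have hx := h.mem_domChart_source
    have := key x hx
    simp [e₁, e₂, hx, φ, ψ, L] at this ⊢
    rw [this]
    exact h.codChart.map_source h.mem_codChart_source
  · intro y hy
    have hy' : y ∈ φ.source := by
      have := hy
      simp [e₁, e₂] at this
      exact this.1
    have : ((e₁ ≫ₕ e₂) y).1 = ψ.symm (L (φ y)).1 := by simp [e₁, e₂]
    rw [this, key y hy', ψ.left_inv (h.source_subset_preimage_source hy')]
  · have hL : ContMDiff (𝓡 (n + 1)) 𝓘(ℝ, ℝ × C) ∞ L := L.contDiff.contMDiff
    have h₁ : ContMDiffOn (𝓡 (n + 1)) 𝓘(ℝ, ℝ × C) ∞ (fun y => L (φ y)) φ.source :=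
      hL.comp_contMDiffOn (contMDiffOn_of_mem_maximalAtlas hφ)
    have h₂ : ContDiffOn ℝ ∞ (fun z : ℝ × C => (ψ.symm z.1, κ z.2)) (Prod.fst ⁻¹' ψ.target) := by
      have := contMDiffOn_symm_of_mem_maximalAtlas hψ
      rw [contMDiffOn_iff_contDiffOn] at this
      exact (this.comp contDiff_fst.contDiffOn (fun z hz => hz)).prodMk
        (κ.contDiff.comp contDiff_snd).contDiffOn
    refine (h₂.contMDiffOn.comp (h₁.mono ?_) ?_).congr ?_
    · intro y hy
      simp [e₁, e₂] at hy
      exact hy.1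
    · intro y hy
      simp [e₁, e₂] at hy
      exact hy.2
    · intro y hy
      simp [e₁, e₂]
  · have hL : ContMDiff 𝓘(ℝ, ℝ × C) (𝓡 (n + 1)) ∞ L.symm := L.symm.contDiff.contMDiff
    have h₁ : ContMDiffOn 𝓘(ℝ, ℝ × C) (𝓡 (n + 1)) ∞ (fun y => φ.symm (L.symm y))
        (L.symm ⁻¹' φ.target) :=
      (contMDiffOn_symm_of_mem_maximalAtlas hφ).comp hL.contMDiffOn (fun z hz => hz)
    have h₂ : ContDiffOn ℝ ∞ (fun z : ℝ × EuclideanSpace ℝ (Fin n) => (ψ z.1, κ.symm z.2))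
        (Prod.fst ⁻¹' ψ.source) := by
      have := contMDiffOn_of_mem_maximalAtlas hψ
      rw [contMDiffOn_iff_contDiffOn] at this
      exact (this.comp contDiff_fst.contDiffOn (fun z hz => hz)).prodMk
        (κ.symm.contDiff.comp contDiff_snd).contDiffOn
    refine (h₁.comp (h₂.contMDiffOn.mono ?_) ?_).congr ?_
    · intro y hy
      simp [e₁, e₂] at hy
      exact hy.1
    · intro y hy
      simp [e₁, e₂] at hy
      exact hy.2
    · intro y hy
      simp [e₁, e₂]

lemma IsFibration.exists_adapted_chart [IsManifold (𝓡 (n + 1)) ∞ M] (hπ : IsFibration n π) (x : M) :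
    ∃ e : OpenPartialHomeomorph M (ℝ × EuclideanSpace ℝ (Fin n)), x ∈ e.source ∧
      (∀ y ∈ e.source, (e y).1 = π y) ∧
      ContMDiffOn (𝓡 (n + 1)) 𝓘(ℝ, ℝ × EuclideanSpace ℝ (Fin n)) ∞ e e.source ∧
      ContMDiffOn 𝓘(ℝ, ℝ × EuclideanSpace ℝ (Fin n)) (𝓡 (n + 1)) ∞ e.symm e.target :=
  exists_adapted_chart_of_complement (hπ.isSubmersion.isSubmersionOfComplement_complement x)

/-- The manifold `M`, with an atlas of charts adapted to the fibration `π : M → ℝ`. The smooth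
structure is the given one, see `Adapted.toAdapted`. -/
def Adapted (_hπ : IsFibration n π) : Type _ := M

namespace Adapted

variable (hπ : IsFibration n π)

instance : TopologicalSpace (Adapted hπ) := inferInstanceAs (TopologicalSpace M)

/-- The fibration, on `Adapted hπ`. -/
def time : Adapted hπ → ℝ := π

variable [IsManifold (𝓡 (n + 1)) ∞ M]

/-- An adapted chart `(t, q)` at `x`. -/
def chart (x : Adapted hπ) : OpenPartialHomeomorph (Adapted hπ) (ℝ × EuclideanSpace ℝ (Fin n)) :=
  (hπ.exists_adapted_chart x).choose

lemma mem_chart (x : Adapted hπ) : x ∈ (chart hπ x).source :=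
  (hπ.exists_adapted_chart x).choose_spec.1

lemma fst_chart (x y : Adapted hπ) (hy : y ∈ (chart hπ x).source) :
    (chart hπ x y).1 = time hπ y :=
  (hπ.exists_adapted_chart x).choose_spec.2.1 y hy

lemma contMDiffOn_chart (x : Adapted hπ) :
    ContMDiffOn (M := M) (𝓡 (n + 1)) 𝓘(ℝ, ℝ × EuclideanSpace ℝ (Fin n)) ∞
      (chart hπ x) (chart hπ x).source :=
  (hπ.exists_adapted_chart x).choose_spec.2.2.1

lemma contMDiffOn_chart_symm (x : Adapted hπ) :
    ContMDiffOn (M' := M) 𝓘(ℝ, ℝ × EuclideanSpace ℝ (Fin n)) (𝓡 (n + 1)) ∞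
      (chart hπ x).symm (chart hπ x).target :=
  (hπ.exists_adapted_chart x).choose_spec.2.2.2

instance : ChartedSpace (ℝ × EuclideanSpace ℝ (Fin n)) (Adapted hπ) where
  atlas := Set.range (chart hπ)
  chartAt x := chart hπ x
  mem_chart_source x := mem_chart hπ x
  chart_mem_atlas x := ⟨x, rfl⟩

instance : IsFibredAtlas (EuclideanSpace ℝ (Fin n)) (time hπ) where
  fst_chartAt x y hy := fst_chart hπ x y hy

instance : IsManifold 𝓘(ℝ, ℝ × EuclideanSpace ℝ (Fin n)) ∞ (Adapted hπ) := by
  refine isManifold_of_contDiffOn _ _ _ ?_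
  intro e e' he he'
  obtain ⟨x, rfl⟩ : e ∈ Set.range (chart hπ) := he
  obtain ⟨y, rfl⟩ : e' ∈ Set.range (chart hπ) := he'
  have hx := contMDiffOn_chart_symm hπ x
  have hy := contMDiffOn_chart hπ y
  rw [← contMDiffOn_iff_contDiffOn]
  refine (hy.comp (hx.mono ?_) ?_).congr ?_
  · intro z hz
    simp at hz
    exact hz.1
  · intro z hz
    simp at hz
    exact hz.2
  · intro z hz
    simp
    rfl

/-- The identity is a diffeomorphism from `M` with its given atlas to `M` with the adapted atlas. -/
def toAdapted : M ≃ₘ^∞⟮𝓡 (n + 1), 𝓘(ℝ, ℝ × EuclideanSpace ℝ (Fin n))⟯ Adapted hπ where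
  toFun x := (x : M)
  invFun x := (x : M)
  left_inv _ := rfl
  right_inv _ := rfl
  contMDiff_toFun := by
    intro x
    refine contMDiffAt_iff_target.2 ⟨continuousAt_id (X := M), ?_⟩
    exact (contMDiffOn_chart hπ x).contMDiffAt ((chart hπ x).open_source.mem_nhds (mem_chart hπ x))
  contMDiff_invFun := by
    intro x
    refine contMDiffAt_iff_source.2 ?_
    have h := (contMDiffOn_chart_symm hπ x).contMDiffAt
      ((chart hπ x).open_target.mem_nhds ((chart hπ x).map_source (mem_chart hπ x)))
    exact h.contMDiffWithinAt

end Adapted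

end AdaptedAtlas

/-! ### Jet spaces, vertical dual bundles and quotients of cotangent bundles -/

section Fibred

variable (F : Type*) [NormedAddCommGroup F] [NormedSpace ℝ F]
  {N : Type*} [TopologicalSpace N] [ChartedSpace (ℝ × F) N] (p : N → ℝ)

/-- The space `J¹p` of 1-jets of local sections of `p : N → ℝ`, as a subset of `TN`: the tangent
vectors `v` of `N` with `η(v) = 1`, where `η = dp`. -/
structure JetSpace where
  /-- The inclusion `J¹p ⊆ TN`. -/
  incl : TangentBundle 𝓘(ℝ, ℝ × F) N
  eta_incl : mvfderiv 𝓘(ℝ, ℝ × F) p incl.proj incl.snd = 1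

/-- The dual bundle `V*p` of the vertical bundle `Vp = ker dp`. -/
structure VerticalDual where
  /-- The base point. -/
  proj : N
  /-- The linear form on the vertical space at the base point. -/
  form : (mvfderiv 𝓘(ℝ, ℝ × F) p proj).ker →L[ℝ] ℝ

/-- The quotient `T*N / ⟨η⟩` of the cotangent bundle by the line subbundle spanned by `η = dp`. -/
structure CotangentQuotient where
  /-- The base point. -/
  proj : N
  /-- The class of covectors at the base point. -/
  cls : CotangentSpace 𝓘(ℝ, ℝ × F) proj ⧸ Submodule.span ℝ {mvfderiv 𝓘(ℝ, ℝ × F) p proj}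

variable {F p} in
lemma JetSpace.incl_injective : Function.Injective (JetSpace.incl : JetSpace F p → _) := by
  rintro ⟨v, hv⟩ ⟨w, hw⟩ rfl
  rfl

/-- The projection of `J¹p` onto the line. -/
def JetSpace.time (v : JetSpace F p) : ℝ := p v.incl.proj

/-- The projection of `V*p` onto the line. -/
def VerticalDual.time (β : VerticalDual F p) : ℝ := p β.proj

/-- The canonical projection `μ : T*N → V*p`, the restriction of covectors to `Vp`. -/
def VerticalDual.mu (a : CotangentBundle 𝓘(ℝ, ℝ × F) N) : VerticalDual F p :=
  ⟨a.proj, a.snd ∘L (mvfderiv 𝓘(ℝ, ℝ × F) p a.proj).ker.subtypeL⟩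

/-- The canonical projection `T*N → T*N / ⟨η⟩`. -/
def CotangentQuotient.quot (a : CotangentBundle 𝓘(ℝ, ℝ × F) N) : CotangentQuotient F p :=
  ⟨a.proj, Submodule.Quotient.mk a.snd⟩

instance [IsManifold 𝓘(ℝ, ℝ × F) ∞ N] : TopologicalSpace (JetSpace F p) :=
  .induced JetSpace.incl inferInstance

instance [IsManifold 𝓘(ℝ, ℝ × F) ∞ N] : TopologicalSpace (VerticalDual F p) :=
  .coinduced (VerticalDual.mu F p) inferInstance

instance [IsManifold 𝓘(ℝ, ℝ × F) ∞ N] : TopologicalSpace (CotangentQuotient F p) :=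
  .coinduced (CotangentQuotient.quot F p) inferInstance

section Charts

variable {F p}

lemma mvfderiv_apply_of_mem [IsManifold 𝓘(ℝ, ℝ × F) ∞ N] [IsFibredAtlas F p] {x y : N}
    (hy : y ∈ (chartAt (ℝ × F) x).source) (w : TangentSpace 𝓘(ℝ, ℝ × F) y) :
    mvfderiv 𝓘(ℝ, ℝ × F) p y w =
      ((trivializationAt (ℝ × F) (TangentSpace 𝓘(ℝ, ℝ × F)) x).continuousLinearMapAt ℝ y w).1 := by
  have h1 := (hasMFDerivAt_extChartAt (I := 𝓘(ℝ, ℝ × F)) hy)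
  have h2 : HasMFDerivAt 𝓘(ℝ, ℝ × F) 𝓘(ℝ, ℝ) (Prod.fst : ℝ × F → ℝ)
      (extChartAt 𝓘(ℝ, ℝ × F) x y) (ContinuousLinearMap.fst ℝ ℝ F) :=
    (hasFDerivAt_fst).hasMFDerivAt
  have h3 := h2.comp y h1
  have h4 : HasMFDerivAt 𝓘(ℝ, ℝ × F) 𝓘(ℝ, ℝ) p y _ := h3.congr_of_eventuallyEq (by
    filter_upwards [(chartAt (ℝ × F) x).open_source.mem_nhds hy] with z hz
    simpa using (IsFibredAtlas.fst_chartAt (F := F) (p := p) x z hz).symm)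
  have h5 : mvfderiv 𝓘(ℝ, ℝ × F) p y w =
      (mfderiv 𝓘(ℝ, ℝ × F) 𝓘(ℝ, ℝ × F) (extChartAt 𝓘(ℝ, ℝ × F) x) y w : ℝ × F).1 := by
    rw [mvfderiv, ContinuousLinearMap.comp_apply, h4.mfderiv, h1.mfderiv]
    rfl
  rw [h5]
  exact congrArg (fun A : TangentSpace 𝓘(ℝ, ℝ × F) y →L[ℝ] ℝ × F => (A w).1)
    (TangentBundle.continuousLinearMapAt_trivializationAt hy).symm

/-- In the charts of `TN` induced by the adapted charts of `N` one has `dp(t, q, ṫ, q̇) = ṫ`. -/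
lemma tangentChart_snd_fst [IsManifold 𝓘(ℝ, ℝ × F) ∞ N] [IsFibredAtlas F p]
    {v₀ v : TangentBundle 𝓘(ℝ, ℝ × F) N}
    (hv : v ∈ (chartAt (ModelProd (ℝ × F) (ℝ × F)) v₀).source) :
    (chartAt (ModelProd (ℝ × F) (ℝ × F)) v₀ v).2.1 = mvfderiv 𝓘(ℝ, ℝ × F) p v.proj v.snd := by
  have hv' : v.proj ∈ (chartAt (ℝ × F) v₀.proj).source := by simpa using hv
  rw [mvfderiv_apply_of_mem hv']
  exact congrArg Prod.fst ((trivializationAt (ℝ × F) (TangentSpace 𝓘(ℝ, ℝ × F))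
    v₀.proj).continuousLinearMapAt_apply_of_mem (R := ℝ) (by simpa using hv') v.snd).symm

/-- The preferred chart `(t, q, p_t, p_q)` of `T*N` at `a₀`. -/
abbrev covChart [IsManifold 𝓘(ℝ, ℝ × F) ∞ N] (a₀ : CotangentBundle 𝓘(ℝ, ℝ × F) N) :
    OpenPartialHomeomorph (CotangentBundle 𝓘(ℝ, ℝ × F) N)
      (ModelProd (ℝ × F) ((ℝ × F) →L[ℝ] ℝ)) :=
  chartAt (ModelProd (ℝ × F) ((ℝ × F) →L[ℝ] ℝ)) a₀

lemma covChart_apply [IsManifold 𝓘(ℝ, ℝ × F) ∞ N]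
    (a₀ : CotangentBundle 𝓘(ℝ, ℝ × F) N) (x : N) (α : CotangentSpace 𝓘(ℝ, ℝ × F) x) :
    covChart a₀ ⟨x, α⟩ = (chartAt (ℝ × F) a₀.proj x,
      α ∘L (trivializationAt (ℝ × F) (TangentSpace 𝓘(ℝ, ℝ × F)) a₀.proj).symmL ℝ x) := by
  rw [hom_chart]
  congr 1
  ext w <;>
  simp [ContinuousLinearMap.inCoordinates]

lemma mem_covChart_source [IsManifold 𝓘(ℝ, ℝ × F) ∞ N]
    {a₀ a : CotangentBundle 𝓘(ℝ, ℝ × F) N} :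
    a ∈ (covChart a₀).source ↔
      a.proj ∈ (chartAt (ℝ × F) a₀.proj).source := by
  rw [covChart, FiberBundle.chartedSpace_chartAt]
  simp only [mfld_simps]
  constructor
  · exact fun h => h.1.1
  · intro h
    refine ⟨⟨h, Set.mem_univ _⟩, ?_⟩
    rwa [Bundle.Trivialization.coe_fst]
    simpa using h

lemma mvfderiv_comp_symmL [IsManifold 𝓘(ℝ, ℝ × F) ∞ N] [IsFibredAtlas F p] {x y : N}
    (hy : y ∈ (chartAt (ℝ × F) x).source) :
    mvfderiv 𝓘(ℝ, ℝ × F) p y ∘L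
      (trivializationAt (ℝ × F) (TangentSpace 𝓘(ℝ, ℝ × F)) x).symmL ℝ y =
      ContinuousLinearMap.fst ℝ ℝ F := by
  refine ContinuousLinearMap.ext fun w => ?_
  rw [ContinuousLinearMap.comp_apply, mvfderiv_apply_of_mem hy,
    Bundle.Trivialization.continuousLinearMapAt_symmL _ (by simpa using hy)]
  rfl

lemma exists_mvfderiv_eq_one [IsManifold 𝓘(ℝ, ℝ × F) ∞ N] [IsFibredAtlas F p] (x : N) :
    ∃ e : TangentSpace 𝓘(ℝ, ℝ × F) x, mvfderiv 𝓘(ℝ, ℝ × F) p x e = 1 :=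
  ⟨(trivializationAt (ℝ × F) (TangentSpace 𝓘(ℝ, ℝ × F)) x).symmL ℝ x (1, 0), by
    have := DFunLike.congr_fun (mvfderiv_comp_symmL (F := F) (p := p) (mem_chart_source _ x)) (1, 0)
    simpa using this⟩

/-- A space with an atlas whose transition maps are obtained from those of a manifold by inserting
and dropping coordinates is a manifold. -/
lemma isManifold_of_lift {E K H X Y : Type*} [NormedAddCommGroup E] [NormedSpace ℝ E]
    [NormedAddCommGroup K] [NormedSpace ℝ K] [TopologicalSpace H] (I : ModelWithCorners ℝ E H)
    [TopologicalSpace X] [ChartedSpace H X] [IsManifold I ∞ X]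
    [TopologicalSpace Y] [ChartedSpace K Y] (lift : K → E) (drop : E → K)
    (hlift : ContDiff ℝ ∞ lift) (hdrop : ContDiff ℝ ∞ drop)
    (h : ∀ e ∈ atlas K Y, ∀ e' ∈ atlas K Y, ∃ x x' : X, ∀ z ∈ (e.symm ≫ₕ e').source,
      lift z ∈ I.symm ⁻¹' ((chartAt H x).symm ≫ₕ chartAt H x').source ∩ range I ∧
      (e.symm ≫ₕ e') z = drop (I (((chartAt H x).symm ≫ₕ chartAt H x') (I.symm (lift z))))) :
    IsManifold 𝓘(ℝ, K) ∞ Y := by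
  refine isManifold_of_contDiffOn _ _ _ ?_
  intro e e' he he'
  obtain ⟨x, x', hx⟩ := h e he e' he'
  have hc := (HasGroupoid.compatible (G := contDiffGroupoid ∞ I)
    (chart_mem_atlas H x) (chart_mem_atlas H x')).1
  refine (hdrop.comp_contDiffOn (hc.comp hlift.contDiffOn (s := (e.symm ≫ₕ e').source)
    (fun z hz => (hx z hz).1))).congr_mono ?_ ?_
  · intro z hz
    exact (hx z hz.1).2
  · intro z hz
    exact hz.1

end Charts

section JetCharts

/-- `(t, q, q̇) ↦ (t, q, 1, q̇)`. -/
def jetLift (z : ℝ × (F × F)) : (ℝ × F) × (ℝ × F) := ((z.1, z.2.1), ((1 : ℝ), z.2.2))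

/-- `(t, q, ṫ, q̇) ↦ (t, q, q̇)`. -/
def jetDrop (z : (ℝ × F) × (ℝ × F)) : ℝ × (F × F) := (z.1.1, (z.1.2, z.2.2))

variable [IsManifold 𝓘(ℝ, ℝ × F) ∞ N]

variable {F p} in
lemma JetSpace.mvfderiv_symm [IsFibredAtlas F p] (v₀ : TangentBundle 𝓘(ℝ, ℝ × F) N)
    {z : ℝ × (F × F)}
    (hz : jetLift F z ∈ (chartAt (ModelProd (ℝ × F) (ℝ × F)) v₀).target) :
    mvfderiv 𝓘(ℝ, ℝ × F) p
      ((chartAt (ModelProd (ℝ × F) (ℝ × F)) v₀).symm (jetLift F z)).proj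
      ((chartAt (ModelProd (ℝ × F) (ℝ × F)) v₀).symm (jetLift F z)).snd = 1 := by
  rw [← tangentChart_snd_fst (p := p) ((chartAt (ModelProd (ℝ × F) (ℝ × F)) v₀).map_target hz),
    (chartAt (ModelProd (ℝ × F) (ℝ × F)) v₀).right_inv hz]
  rfl

variable {F p} in
lemma JetSpace.lift_drop [IsFibredAtlas F p] (v₀ : TangentBundle 𝓘(ℝ, ℝ × F) N)
    (v : JetSpace F p) (hv : v.incl ∈ (chartAt (ModelProd (ℝ × F) (ℝ × F)) v₀).source) :
    jetLift F (jetDrop F (chartAt (ModelProd (ℝ × F) (ℝ × F)) v₀ v.incl)) =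
      chartAt (ModelProd (ℝ × F) (ℝ × F)) v₀ v.incl := by
  have h := tangentChart_snd_fst (p := p) hv
  rw [v.eta_incl] at h
  refine Prod.ext rfl (Prod.ext h.symm rfl)

open Classical in
/-- The inverse of the chart of `J¹p` at `v₀`. -/
def JetSpace.ofCoord [IsFibredAtlas F p] (v₀ : JetSpace F p) (z : ℝ × (F × F)) : JetSpace F p :=
  if h : jetLift F z ∈ (chartAt (ModelProd (ℝ × F) (ℝ × F)) v₀.incl).target then
    ⟨(chartAt (ModelProd (ℝ × F) (ℝ × F)) v₀.incl).symm (jetLift F z),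
      JetSpace.mvfderiv_symm v₀.incl h⟩
  else v₀

variable {F p} in
lemma JetSpace.incl_ofCoord [IsFibredAtlas F p] (v₀ : JetSpace F p) {z : ℝ × (F × F)}
    (h : jetLift F z ∈ (chartAt (ModelProd (ℝ × F) (ℝ × F)) v₀.incl).target) :
    (JetSpace.ofCoord F p v₀ z).incl =
      (chartAt (ModelProd (ℝ × F) (ℝ × F)) v₀.incl).symm (jetLift F z) := by
  rw [JetSpace.ofCoord, dif_pos h]

/-- The chart `(t, q, q̇)` of `J¹p` induced by the adapted chart of `N` at the base point of `v₀`: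
the restriction of the induced chart `(t, q, ṫ, q̇)` of `TN`. -/
def JetSpace.chart [IsFibredAtlas F p] (v₀ : JetSpace F p) :
    OpenPartialHomeomorph (JetSpace F p) (ℝ × (F × F)) where
  toFun v := jetDrop F (chartAt (ModelProd (ℝ × F) (ℝ × F)) v₀.incl v.incl)
  invFun := JetSpace.ofCoord F p v₀
  source := JetSpace.incl ⁻¹' (chartAt (ModelProd (ℝ × F) (ℝ × F)) v₀.incl).source
  target := jetLift F ⁻¹' (chartAt (ModelProd (ℝ × F) (ℝ × F)) v₀.incl).target
  map_source' v hv := by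
    rw [mem_preimage, JetSpace.lift_drop _ _ hv]
    exact (chartAt (ModelProd (ℝ × F) (ℝ × F)) v₀.incl).map_source hv
  map_target' z hz := by
    rw [mem_preimage, JetSpace.incl_ofCoord v₀ hz]
    exact (chartAt (ModelProd (ℝ × F) (ℝ × F)) v₀.incl).map_target hz
  left_inv' v hv := by
    have hv' := (chartAt (ModelProd (ℝ × F) (ℝ × F)) v₀.incl).map_source hv
    refine JetSpace.incl_injective ?_
    rw [JetSpace.incl_ofCoord, JetSpace.lift_drop _ _ hv]
    · exact (chartAt (ModelProd (ℝ × F) (ℝ × F)) v₀.incl).left_inv hv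
    · rw [JetSpace.lift_drop _ _ hv]
      exact hv'
  right_inv' z hz := by
    rw [JetSpace.incl_ofCoord v₀ hz, (chartAt (ModelProd (ℝ × F) (ℝ × F)) v₀.incl).right_inv hz]
    rfl
  open_source :=
    (chartAt (ModelProd (ℝ × F) (ℝ × F)) v₀.incl).open_source.preimage continuous_induced_dom
  open_target := (chartAt (ModelProd (ℝ × F) (ℝ × F)) v₀.incl).open_target.preimage
    (by unfold jetLift; fun_prop)
  continuousOn_toFun := by
    have h : Continuous (jetDrop F) := by unfold jetDrop; fun_prop
    exact h.comp_continuousOn ((chartAt (ModelProd (ℝ × F) (ℝ × F)) v₀.incl).continuousOn.comp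
      continuous_induced_dom.continuousOn (fun v hv => hv))
  continuousOn_invFun := by
    have hi : Topology.IsInducing (JetSpace.incl : JetSpace F p → _) := ⟨rfl⟩
    rw [hi.continuousOn_iff]
    have h : Continuous (jetLift F) := by unfold jetLift; fun_prop
    exact ((chartAt (ModelProd (ℝ × F) (ℝ × F)) v₀.incl).continuousOn_symm.comp h.continuousOn
      (fun z hz => hz)).congr (fun z hz => JetSpace.incl_ofCoord v₀ hz)

instance [IsFibredAtlas F p] : ChartedSpace (ℝ × (F × F)) (JetSpace F p) where
  atlas := Set.range (JetSpace.chart F p)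
  chartAt := JetSpace.chart F p
  mem_chart_source v := mem_chart_source (ModelProd (ℝ × F) (ℝ × F)) v.incl
  chart_mem_atlas v := ⟨v, rfl⟩

instance [IsFibredAtlas F p] : IsFibredAtlas (F × F) (JetSpace.time F p) where
  fst_chartAt v w hw := IsFibredAtlas.fst_chartAt (F := F) (p := p) v.incl.proj w.incl.proj
    (by simpa using
      (show w.incl ∈ (chartAt (ModelProd (ℝ × F) (ℝ × F)) v.incl).source from hw))

instance [IsFibredAtlas F p] : IsManifold 𝓘(ℝ, ℝ × (F × F)) ∞ (JetSpace F p) := by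
  refine isManifold_of_lift 𝓘(ℝ, ℝ × F).tangent (X := TangentBundle 𝓘(ℝ, ℝ × F) N)
    (jetLift F) (jetDrop F) (by unfold jetLift; fun_prop) (by unfold jetDrop; fun_prop) ?_
  intro e he e' he'
  obtain ⟨x, rfl⟩ : e ∈ Set.range (JetSpace.chart F p) := he
  obtain ⟨y, rfl⟩ : e' ∈ Set.range (JetSpace.chart F p) := he'
  refine ⟨x.incl, y.incl, fun z hz => ?_⟩
  have hz1 : jetLift F z ∈ (chartAt (ModelProd (ℝ × F) (ℝ × F)) x.incl).target := hz.1
  have hz2 : (JetSpace.ofCoord F p x z).incl ∈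
    (chartAt (ModelProd (ℝ × F) (ℝ × F)) y.incl).source := hz.2
  have hs := JetSpace.incl_ofCoord x hz1
  refine ⟨⟨⟨hz1, ?_⟩, ?_⟩, ?_⟩
  · rw [hs] at hz2
    exact hz2
  · simp
  · change jetDrop F (chartAt (ModelProd (ℝ × F) (ℝ × F)) y.incl (JetSpace.ofCoord F p x z).incl) = _
    rw [hs]
    rfl

end JetCharts

section QuotientCharts

/-- `(t, q, p) ↦ (t, q, p_t = 0, p_q = p)`. -/
def covLift (z : ℝ × (F × (F →L[ℝ] ℝ))) : (ℝ × F) × ((ℝ × F) →L[ℝ] ℝ) :=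
  ((z.1, z.2.1), z.2.2 ∘L ContinuousLinearMap.snd ℝ ℝ F)

/-- `(t, q, p_t, p_q) ↦ (t, q, p_q)`. -/
def covDrop (z : (ℝ × F) × ((ℝ × F) →L[ℝ] ℝ)) : ℝ × (F × (F →L[ℝ] ℝ)) :=
  (z.1.1, (z.1.2, z.2 ∘L ContinuousLinearMap.inr ℝ ℝ F))

lemma contDiff_covLift : ContDiff ℝ ∞ (covLift F) := by
  unfold covLift
  exact (contDiff_fst.prodMk (contDiff_fst.comp contDiff_snd)).prodMk
    ((contDiff_snd.comp contDiff_snd).clm_comp contDiff_const)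

lemma contDiff_covDrop : ContDiff ℝ ∞ (covDrop F) := by
  unfold covDrop
  exact (contDiff_fst.comp contDiff_fst).prodMk ((contDiff_snd.comp contDiff_fst).prodMk
    (contDiff_snd.clm_comp contDiff_const))

lemma covDrop_covLift (z : ℝ × (F × (F →L[ℝ] ℝ))) : covDrop F (covLift F z) = z := by
  refine Prod.ext rfl (Prod.ext rfl ?_)
  ext w
  simp [covDrop, covLift]

variable [IsManifold 𝓘(ℝ, ℝ × F) ∞ N]

/-- A quotient map of `T*N` whose fibres are the classes of covectors modulo `η = dp`. -/
structure IsEtaQuotient {Y : Type*} [TopologicalSpace Y]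
    (f : CotangentBundle 𝓘(ℝ, ℝ × F) N → Y) : Prop where
  isQuotientMap : Topology.IsQuotientMap f
  eq_iff : ∀ a b, f a = f b ↔
    ∃ c : ℝ, b = ⟨a.proj, a.snd + c • mvfderiv 𝓘(ℝ, ℝ × F) p a.proj⟩

namespace IsEtaQuotient

variable {F p} {Y : Type*} [TopologicalSpace Y] {f : CotangentBundle 𝓘(ℝ, ℝ × F) N → Y}
  (hf : IsEtaQuotient F p f)

/-- A representative. -/
def rep (y : Y) : CotangentBundle 𝓘(ℝ, ℝ × F) N := (hf.isQuotientMap.surjective y).choose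

lemma apply_rep (y : Y) : f (hf.rep y) = y := (hf.isQuotientMap.surjective y).choose_spec

lemma proj_eq (hf : IsEtaQuotient F p f) {a b : CotangentBundle 𝓘(ℝ, ℝ × F) N} (h : f a = f b) : a.proj = b.proj := by
  obtain ⟨c, rfl⟩ := (hf.eq_iff a b).1 h
  rfl

lemma chart_add [IsFibredAtlas F p] (a₀ a : CotangentBundle 𝓘(ℝ, ℝ × F) N) (c : ℝ)
    (ha : a.proj ∈ (chartAt (ℝ × F) a₀.proj).source) :
    covChart a₀
        ⟨a.proj, a.snd + c • mvfderiv 𝓘(ℝ, ℝ × F) p a.proj⟩ =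
      ((covChart a₀ a).1,
        (covChart a₀ a).2 +
          c • ContinuousLinearMap.fst ℝ ℝ F) := by
  obtain ⟨x, α⟩ := a
  rw [covChart_apply, covChart_apply, ← mvfderiv_comp_symmL (p := p) ha]
  refine Prod.ext rfl ?_
  ext w <;> simp

lemma drop_eq (hf : IsEtaQuotient F p f) [IsFibredAtlas F p] (a₀ : CotangentBundle 𝓘(ℝ, ℝ × F) N)
    {a b : CotangentBundle 𝓘(ℝ, ℝ × F) N} (h : f a = f b)
    (ha : a ∈ (covChart a₀).source) :
    covDrop F (covChart a₀ b) =
      covDrop F (covChart a₀ a) := by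
  obtain ⟨c, rfl⟩ := (hf.eq_iff a b).1 h
  rw [chart_add _ _ _ (mem_covChart_source.1 ha)]
  refine Prod.ext rfl (Prod.ext rfl ?_)
  ext w
  simp [covDrop]

lemma lift_drop [IsFibredAtlas F p] (a₀ : CotangentBundle 𝓘(ℝ, ℝ × F) N)
    {a : CotangentBundle 𝓘(ℝ, ℝ × F) N}
    (ha : a ∈ (covChart a₀).source) :
    ∃ c : ℝ, covLift F (covDrop F (covChart a₀ a)) =
      covChart a₀
        ⟨a.proj, a.snd + c • mvfderiv 𝓘(ℝ, ℝ × F) p a.proj⟩ := by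
  refine ⟨-(covChart a₀ a).2 (1, 0), ?_⟩
  rw [chart_add _ _ _ (mem_covChart_source.1 ha)]
  refine Prod.ext rfl (ContinuousLinearMap.ext fun w => ?_)
  have hw : w = w.1 • ((1 : ℝ), (0 : F)) + (0, w.2) := by ext <;> simp
  have h2 : (covChart a₀ a).2 w = w.1 * (covChart a₀ a).2 (1, 0) + (covChart a₀ a).2 (0, w.2) := by
    conv_lhs => rw [hw]
    rw [map_add, map_smul, smul_eq_mul]
  change (covChart a₀ a).2 (0, w.2) = (covChart a₀ a).2 w + -(covChart a₀ a).2 (1, 0) * w.1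
  rw [h2]
  ring

lemma mem_source_add {a₀ a : CotangentBundle 𝓘(ℝ, ℝ × F) N} (c : ℝ)
    (ha : a ∈ (covChart a₀).source) :
    (⟨a.proj, a.snd + c • mvfderiv 𝓘(ℝ, ℝ × F) p a.proj⟩ : CotangentBundle 𝓘(ℝ, ℝ × F) N) ∈
      (covChart a₀).source :=
  mem_covChart_source.2 (mem_covChart_source.1 ha)

lemma mem_source_iff (hf : IsEtaQuotient F p f) {a₀ a b : CotangentBundle 𝓘(ℝ, ℝ × F) N} (h : f a = f b) :
    a ∈ (covChart a₀).source ↔ b ∈ (covChart a₀).source := by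
  rw [mem_covChart_source, mem_covChart_source, hf.proj_eq h]

lemma preimage_source (a₀ : CotangentBundle 𝓘(ℝ, ℝ × F) N) :
    f ⁻¹' (hf.rep ⁻¹' (covChart a₀).source) = (covChart a₀).source := by
  ext a
  exact hf.mem_source_iff (hf.apply_rep (f a))

/-- The chart `(t, q, p)` of `Y` induced by the chart `(t, q, p_t, p)` of `T*N` at `a₀`. -/
def chart [IsFibredAtlas F p] (a₀ : CotangentBundle 𝓘(ℝ, ℝ × F) N) :
    OpenPartialHomeomorph Y (ℝ × (F × (F →L[ℝ] ℝ))) where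
  toFun y := covDrop F (covChart a₀ (hf.rep y))
  invFun z := f ((covChart a₀).symm (covLift F z))
  source := hf.rep ⁻¹' (covChart a₀).source
  target := covLift F ⁻¹' (covChart a₀).target
  map_source' y hy := by
    obtain ⟨c, hc⟩ := lift_drop (p := p) a₀ hy
    rw [mem_preimage, hc]
    exact (covChart a₀).map_source (mem_source_add c hy)
  map_target' z hz :=
    (hf.mem_source_iff (hf.apply_rep _)).2 ((covChart a₀).map_target hz)
  left_inv' y hy := by
    obtain ⟨c, hc⟩ := lift_drop (p := p) a₀ hy
    rw [hc, (covChart a₀).left_inv (mem_source_add c hy), ← (hf.eq_iff (hf.rep y) _).2 ⟨c, rfl⟩]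
    exact hf.apply_rep y
  right_inv' z hz := by
    rw [hf.drop_eq a₀ (hf.apply_rep _).symm ((covChart a₀).map_target hz),
      (covChart a₀).right_inv hz]
    exact covDrop_covLift F z
  open_source := by
    rw [← hf.isQuotientMap.isOpen_preimage, hf.preimage_source]
    exact (covChart a₀).open_source
  open_target := (covChart a₀).open_target.preimage (contDiff_covLift F).continuous
  continuousOn_toFun := by
    have hopen : IsOpen (hf.rep ⁻¹' (covChart a₀).source) := by
      rw [← hf.isQuotientMap.isOpen_preimage, hf.preimage_source]
      exact (covChart a₀).open_source
    rw [continuousOn_open_iff hopen]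
    intro O hO
    rw [← hf.isQuotientMap.isOpen_preimage]
    have h := ((contDiff_covDrop F).continuous.comp_continuousOn
      (covChart a₀).continuousOn).isOpen_inter_preimage (covChart a₀).open_source hO
    convert h using 1
    rw [preimage_inter, hf.preimage_source]
    ext a
    refine and_congr_right fun ha => ?_
    exact Iff.of_eq (congrArg (· ∈ O) (hf.drop_eq a₀ (hf.apply_rep (f a)).symm ha))
  continuousOn_invFun :=
    hf.isQuotientMap.continuous.comp_continuousOn
      ((covChart a₀).continuousOn_symm.comp
        (contDiff_covLift F).continuous.continuousOn (fun z hz => hz))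

lemma chart_apply [IsFibredAtlas F p] (a₀ : CotangentBundle 𝓘(ℝ, ℝ × F) N)
    {a : CotangentBundle 𝓘(ℝ, ℝ × F) N}
    (ha : a ∈ (covChart a₀).source) :
    hf.chart a₀ (f a) = covDrop F (covChart a₀ a) :=
  hf.drop_eq a₀ (hf.apply_rep (f a)).symm ha

/-- The charted space structure on `Y` given by these charts. -/
abbrev chartedSpace (hf : IsEtaQuotient F p f) [IsFibredAtlas F p] : ChartedSpace (ℝ × (F × (F →L[ℝ] ℝ))) Y where
  atlas := Set.range fun y => hf.chart (hf.rep y)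
  chartAt y := hf.chart (hf.rep y)
  mem_chart_source y := mem_chart_source (ModelProd (ℝ × F) ((ℝ × F) →L[ℝ] ℝ)) (hf.rep y)
  chart_mem_atlas y := ⟨y, rfl⟩

lemma isManifold (hf : IsEtaQuotient F p f) [IsFibredAtlas F p] :
    @IsManifold ℝ _ _ _ _ _ _ 𝓘(ℝ, ℝ × (F × (F →L[ℝ] ℝ))) ∞ Y _ hf.chartedSpace := by
  let _ := hf.chartedSpace
  refine isManifold_of_lift (𝓘(ℝ, ℝ × F).prod 𝓘(ℝ, (ℝ × F) →L[ℝ] ℝ))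
    (X := CotangentBundle 𝓘(ℝ, ℝ × F) N)
    (covLift F) (covDrop F) (contDiff_covLift F) (contDiff_covDrop F) ?_
  intro e he e' he'
  obtain ⟨x, rfl⟩ : e ∈ Set.range fun y => hf.chart (hf.rep y) := he
  obtain ⟨y, rfl⟩ : e' ∈ Set.range fun y => hf.chart (hf.rep y) := he'
  refine ⟨hf.rep x, hf.rep y, fun z hz => ?_⟩
  have hz1 : covLift F z ∈ (covChart (hf.rep x)).target :=
    hz.1
  have hz2 : hf.rep (f ((covChart (hf.rep x)).symm
      (covLift F z))) ∈ (covChart (hf.rep y)).source := hz.2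
  replace hz2 := (hf.mem_source_iff (hf.apply_rep _)).1 hz2
  refine ⟨⟨⟨hz1, hz2⟩, ?_⟩, ?_⟩
  · simp
  · exact hf.chart_apply (hf.rep y) hz2

end IsEtaQuotient

lemma VerticalDual.isEtaQuotient [IsFibredAtlas F p] :
    IsEtaQuotient F p (VerticalDual.mu F p) where
  isQuotientMap := by
    refine ⟨⟨rfl⟩, ?_⟩
    rintro ⟨x, β⟩
    obtain ⟨e, he⟩ := exists_mvfderiv_eq_one (F := F) (p := p) x
    let η := mvfderiv 𝓘(ℝ, ℝ × F) p x
    let P : TangentSpace 𝓘(ℝ, ℝ × F) x →L[ℝ] η.ker :=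
      (ContinuousLinearMap.id ℝ _ - η.smulRight e).codRestrict η.ker (fun w => by
        have he' : η e = 1 := he
        simp [he'])
    refine ⟨⟨x, β ∘L P⟩, ?_⟩
    have h : (β ∘L P) ∘L η.ker.subtypeL = β := by
      refine ContinuousLinearMap.ext fun w => congrArg β (Subtype.ext ?_)
      have hw : η (w : TangentSpace 𝓘(ℝ, ℝ × F) x) = 0 := w.2
      change (w : TangentSpace 𝓘(ℝ, ℝ × F) x) - η w • e = w
      rw [hw, zero_smul, sub_zero]
    exact congrArg (VerticalDual.mk x) h
  eq_iff a b := by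
    obtain ⟨x, α⟩ := a
    obtain ⟨y, β⟩ := b
    constructor
    · intro h
      obtain rfl : x = y := congrArg VerticalDual.proj h
      obtain ⟨e, he⟩ := exists_mvfderiv_eq_one (F := F) (p := p) x
      have h' : α ∘L (mvfderiv 𝓘(ℝ, ℝ × F) p x).ker.subtypeL =
          β ∘L (mvfderiv 𝓘(ℝ, ℝ × F) p x).ker.subtypeL := by
        simpa [VerticalDual.mu] using h
      refine ⟨(β - α) e, congrArg (Bundle.TotalSpace.mk x) (ContinuousLinearMap.ext fun w => ?_)⟩
      have hw : w - mvfderiv 𝓘(ℝ, ℝ × F) p x w • e ∈ (mvfderiv 𝓘(ℝ, ℝ × F) p x).ker := by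
        change mvfderiv 𝓘(ℝ, ℝ × F) p x (w - mvfderiv 𝓘(ℝ, ℝ × F) p x w • e) = 0
        rw [map_sub, map_smul, he, smul_eq_mul, mul_one, sub_self]
      have h2 : α (w - mvfderiv 𝓘(ℝ, ℝ × F) p x w • e) =
          β (w - mvfderiv 𝓘(ℝ, ℝ × F) p x w • e) := DFunLike.congr_fun h' ⟨_, hw⟩
      rw [map_sub, map_sub, map_smul, map_smul, smul_eq_mul, smul_eq_mul] at h2
      change β w = α w + (β e - α e) * mvfderiv 𝓘(ℝ, ℝ × F) p x w
      linarith
    · rintro ⟨c, h⟩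
      obtain rfl : y = x := congrArg Bundle.TotalSpace.proj h
      obtain rfl : β = α + c • mvfderiv 𝓘(ℝ, ℝ × F) p y := by simpa using h
      refine congrArg (VerticalDual.mk y) (ContinuousLinearMap.ext fun w => ?_)
      have hw : mvfderiv 𝓘(ℝ, ℝ × F) p y (w : TangentSpace 𝓘(ℝ, ℝ × F) y) = 0 := w.2
      change α w = α w + c * mvfderiv 𝓘(ℝ, ℝ × F) p y w
      rw [hw, mul_zero, add_zero]

lemma CotangentQuotient.isEtaQuotient :
    IsEtaQuotient F p (CotangentQuotient.quot F p) where
  isQuotientMap := by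
    refine ⟨⟨rfl⟩, ?_⟩
    rintro ⟨x, c⟩
    obtain ⟨α, rfl⟩ := Submodule.Quotient.mk_surjective _ c
    exact ⟨⟨x, α⟩, rfl⟩
  eq_iff a b := by
    obtain ⟨x, α⟩ := a
    obtain ⟨y, β⟩ := b
    constructor
    · intro h
      obtain rfl : x = y := congrArg CotangentQuotient.proj h
      have h' : (Submodule.Quotient.mk α : CotangentSpace 𝓘(ℝ, ℝ × F) x ⧸
          Submodule.span ℝ {mvfderiv 𝓘(ℝ, ℝ × F) p x}) = Submodule.Quotient.mk β := by
        simpa [CotangentQuotient.quot] using h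
      obtain ⟨c, hc⟩ := Submodule.mem_span_singleton.1 ((Submodule.Quotient.eq _).1 h'.symm)
      exact ⟨c, congrArg (Bundle.TotalSpace.mk x) (by rw [hc]; abel)⟩
    · rintro ⟨c, h⟩
      obtain rfl : y = x := congrArg Bundle.TotalSpace.proj h
      obtain rfl : β = α + c • mvfderiv 𝓘(ℝ, ℝ × F) p y := by simpa using h
      refine congrArg (CotangentQuotient.mk y) ((Submodule.Quotient.eq _).2 ?_)
      exact Submodule.mem_span_singleton.2 ⟨-c, by simp⟩

instance [IsFibredAtlas F p] : ChartedSpace (ℝ × (F × (F →L[ℝ] ℝ))) (VerticalDual F p) :=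
  (VerticalDual.isEtaQuotient F p).chartedSpace

instance [IsFibredAtlas F p] : IsManifold 𝓘(ℝ, ℝ × (F × (F →L[ℝ] ℝ))) ∞ (VerticalDual F p) :=
  (VerticalDual.isEtaQuotient F p).isManifold

instance [IsFibredAtlas F p] : ChartedSpace (ℝ × (F × (F →L[ℝ] ℝ))) (CotangentQuotient F p) :=
  (CotangentQuotient.isEtaQuotient F p).chartedSpace

instance [IsFibredAtlas F p] : IsManifold 𝓘(ℝ, ℝ × (F × (F →L[ℝ] ℝ))) ∞ (CotangentQuotient F p) :=
  (CotangentQuotient.isEtaQuotient F p).isManifold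

instance [IsFibredAtlas F p] : IsFibredAtlas (F × (F →L[ℝ] ℝ)) (VerticalDual.time F p) where
  fst_chartAt x y hy := by
    let hf := VerticalDual.isEtaQuotient F p
    have hy' : (hf.rep y).proj ∈ (chartAt (ℝ × F) (hf.rep x).proj).source :=
      mem_covChart_source.1 hy
    have h := IsFibredAtlas.fst_chartAt (F := F) (p := p) _ _ hy'
    have hp : (hf.rep y).proj = y.proj := congrArg VerticalDual.proj (hf.apply_rep y)
    rw [VerticalDual.time, ← hp, ← h]
    exact congrArg (fun z : (ℝ × F) × ((ℝ × F) →L[ℝ] ℝ) => z.1.1)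
      (covChart_apply (hf.rep x) (hf.rep y).proj (hf.rep y).snd)

end QuotientCharts

/-! ### The canonical Poisson structure of `V*p` and the Tulczyjew diffeomorphism -/

section Tulczyjew

variable [IsManifold 𝓘(ℝ, ℝ × F) ∞ N] [IsFibredAtlas F p]

variable {F p} in
/-- The linear function `X̂(β) = β(X)` on `V*p` induced by a vertical vector field `X` on `N`. -/
def VerticalDual.linearFun (X : ∀ x : N, (mvfderiv 𝓘(ℝ, ℝ × F) p x).ker) (β : VerticalDual F p) : ℝ :=
  β.form (X β.proj)

/-- `Λ` is the canonical Poisson structure of `V*p`, characterized by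
`{X̂, Ŷ}(β) = -β([X, Y])`, `{f ∘ proj, Ŷ} = Y(f) ∘ proj`, `{f ∘ proj, g ∘ proj} = 0`
for smooth functions `f, g` and smooth vertical vector fields `X, Y` on open subsets of `N`.
A point of `V*p` is written as `μ(a)` with `a` in `T*N`, so that `β([X, Y]) = a([X, Y])` for `β = μ(a)`. -/
def IsCanonicalVerticalDual
    (Λ : BivectorField 𝓘(ℝ, ℝ × (F × (F →L[ℝ] ℝ))) (VerticalDual F p)) : Prop :=
  ∀ (U : Set N) (f g : N → ℝ) (X Y : ∀ x : N, (mvfderiv 𝓘(ℝ, ℝ × F) p x).ker), IsOpen U →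
    ContMDiffOn 𝓘(ℝ, ℝ × F) 𝓘(ℝ, ℝ) ∞ f U → ContMDiffOn 𝓘(ℝ, ℝ × F) 𝓘(ℝ, ℝ) ∞ g U →
    ContMDiffOn 𝓘(ℝ, ℝ × F) 𝓘(ℝ, ℝ × F).tangent ∞
      (fun x => (⟨x, (X x : TangentSpace 𝓘(ℝ, ℝ × F) x)⟩ : TangentBundle 𝓘(ℝ, ℝ × F) N)) U →
    ContMDiffOn 𝓘(ℝ, ℝ × F) 𝓘(ℝ, ℝ × F).tangent ∞
      (fun x => (⟨x, (Y x : TangentSpace 𝓘(ℝ, ℝ × F) x)⟩ : TangentBundle 𝓘(ℝ, ℝ × F) N)) U →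
    ∀ a : CotangentBundle 𝓘(ℝ, ℝ × F) N, a.proj ∈ U →
      Λ.bracket (VerticalDual.linearFun X) (VerticalDual.linearFun Y) (VerticalDual.mu F p a) =
        -a.snd (VectorField.mlieBracket 𝓘(ℝ, ℝ × F)
          (fun x => (X x : TangentSpace 𝓘(ℝ, ℝ × F) x))
          (fun x => (Y x : TangentSpace 𝓘(ℝ, ℝ × F) x)) a.proj) ∧
      Λ.bracket (fun β => f β.proj) (VerticalDual.linearFun Y) (VerticalDual.mu F p a) =
        mvfderiv 𝓘(ℝ, ℝ × F) f a.proj (Y a.proj) ∧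
      Λ.bracket (fun β => f β.proj) (fun β => g β.proj) (VerticalDual.mu F p a) = 0

/-- The charts `(t, q, p, q̇, ṗ)` of `J¹p₁*` have values in `ℝ × JetDualModel F`. -/
abbrev JetDualModel : Type _ := (F × (F →L[ℝ] ℝ)) × (F × (F →L[ℝ] ℝ))

/-- The space `J¹p₁*` of 1-jets of local sections of `V*p → ℝ`. -/
abbrev JetDual : Type _ := JetSpace (F × (F →L[ℝ] ℝ)) (VerticalDual.time F p)

/-- The charts `(t, q, q̇, p_q, p_q̇)` of `T*(J¹p)/⟨η₁⟩` have values in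
`ℝ × JetCotangentQuotientModel F`. -/
abbrev JetCotangentQuotientModel : Type _ := (F × F) × ((F × F) →L[ℝ] ℝ)

/-- The quotient `T*(J¹p)/⟨η₁⟩`, where `η₁` is the differential of `J¹p → ℝ`. -/
abbrev JetCotangentQuotient : Type _ := CotangentQuotient (F × F) (JetSpace.time F p)

/-- `A : J¹p₁* → T*(J¹p)/⟨η₁⟩` is the canonical Tulczyjew diffeomorphism of `p`: its inverse `ψ̃`
satisfies `ψ̃ ∘ pr = ψ` for the projection `pr : T*(J¹p) → T*(J¹p)/⟨η₁⟩` and for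
`ψ(α_v) = Tμ(A_N⁻¹(α'_v))`, where `α'_v` is any covector on `TN` at `v ∈ J¹p ⊆ TN` that restricts
to `α_v` on `T_v(J¹p)`. -/
def IsTulczyjewDiffeo
    (A : JetDual F p ≃ₘ^∞⟮𝓘(ℝ, ℝ × JetDualModel F),
      𝓘(ℝ, ℝ × JetCotangentQuotientModel F)⟯ JetCotangentQuotient F p) : Prop :=
  ∀ (v : JetSpace F p) (α : CotangentSpace 𝓘(ℝ, ℝ × (F × F)) v),
    (∃ α' : CotangentSpace 𝓘(ℝ, ℝ × F).tangent v.incl,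
      α' ∘L mfderiv 𝓘(ℝ, ℝ × (F × F)) 𝓘(ℝ, ℝ × F).tangent JetSpace.incl v = α) ∧
    ∀ α' : CotangentSpace 𝓘(ℝ, ℝ × F).tangent v.incl,
      α' ∘L mfderiv 𝓘(ℝ, ℝ × (F × F)) 𝓘(ℝ, ℝ × F).tangent JetSpace.incl v = α →
      (A.symm (CotangentQuotient.quot (F × F) (JetSpace.time F p) ⟨v, α⟩)).incl =
        tangentMap (𝓘(ℝ, ℝ × F).prod 𝓘(ℝ, (ℝ × F) →L[ℝ] ℝ)) 𝓘(ℝ, ℝ × (F × (F →L[ℝ] ℝ)))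
          (VerticalDual.mu F p) ((tulczyjew 𝓘(ℝ, ℝ × F) N).symm ⟨v.incl, α'⟩)

variable {F p} in
/-- `Λ` is the restriction to `J¹p₁* ⊆ T(V*p)` of a 2-vector `Λc` on `T(V*p)` which is tangent to
`J¹p₁*`: the inclusion pushes `Λ` forward to `Λc`. -/
def IsRestriction
    (Λc : BivectorField 𝓘(ℝ, ℝ × (F × (F →L[ℝ] ℝ))).tangent
      (TangentBundle 𝓘(ℝ, ℝ × (F × (F →L[ℝ] ℝ))) (VerticalDual F p)))
    (Λ : BivectorField 𝓘(ℝ, ℝ × JetDualModel F) (JetDual F p)) : Prop :=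
  IsPoissonMap JetSpace.incl Λ Λc

variable {F p} in
/-- `Λ'` is the projection to `T*(J¹p)/⟨η₁⟩` of a 2-vector `Λ` on `T*(J¹p)` which is projectable:
the canonical projection pushes `Λ` forward to `Λ'`. -/
def IsProjection
    (Λ : BivectorField (𝓘(ℝ, ℝ × (F × F)).prod 𝓘(ℝ, (ℝ × (F × F)) →L[ℝ] ℝ))
      (CotangentBundle 𝓘(ℝ, ℝ × (F × F)) (JetSpace F p)))
    (Λ' : BivectorField 𝓘(ℝ, ℝ × JetCotangentQuotientModel F) (JetCotangentQuotient F p)) : Prop :=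
  IsPoissonMap (CotangentQuotient.quot (F × F) (JetSpace.time F p)) Λ Λ'

end Tulczyjew

end Fibred

end TulczyjewTriple
end

open TulczyjewTriple

/-!
The construction rests on the observation that all the Poisson structures involved have constant
coefficients in the preferred charts, so that the theorem can be reduced to linear algebra in the
model spaces and to the symmetry of second derivatives.

A constant 2-vector on the model space `E` of a manifold is encoded by its sharp map `P : E* → E`.
It defines a 2-vector on the manifold if the derivatives `T` of all changes of preferred charts
satisfy `T P T* = P` (`IsChartInvariant`, `constBivector`). Such a 2-vector is automatically a
Poisson structure (`constBivector_isPoisson`), its corank is read off from the kernel of `P`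
(`constBivector_hasCorank_one`), and a smooth map pushes it forward to another one if its
derivatives do so in the preferred charts (`constBivector_isPoissonMap`). It remains to establish
invariance and the characterizations for the following sharp maps.

* On `T*X` the sharp map of `{q, p} = 1` is invariant since the second derivative of a change of
  charts is symmetric (`isChartInvariant_canonicalSharp`), and it is the unique inverse of `-dθ`
  (`isInverseOfTwoForm_canonicalTwoForm_iff`).
* On a quotient of `T*N` by `dp`, the quotient map is `(t, q, p_t, p_q) ↦ (t, q, p_q)` in all
  charts, so that the structure of `T*N` descends (`IsEtaQuotient.isPoissonMap_iff`). This gives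
  both the structure of `V*p` and that of `T*(J¹p)/⟨η₁⟩`. On `V*p` the brackets of basic and of
  linear functions are computed after pulling them back to `T*N`, and the differentials of these
  functions span the cotangent spaces (`isCanonicalVerticalDual_iff`).
* The complete lift of a constant `P` is again constant, namely `(α_q, α_u) ↦ (P α_u, P α_q)`. It is
  invariant because differentiating `Dτ P Dτ* = P` gives the required identity between first and
  second derivatives of a change of charts `τ` (`IsChartInvariant.completeSharp`,
  `isCompleteLift_iff`).
* If `P` annihilates `dt`, the complete lift is tangent to the affine subbundle `ṫ = 1`, which gives
  the structure of `J¹p₁*` (`JetSpace.isPoissonMap_incl_iff`).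

The Tulczyjew diffeomorphism of `N` has the expression `(q, p; q̇, ṗ) ↦ (q, q̇; ṗ, p)` in all charts
induced by charts of `N`, and not only in the preferred chart at the base point
(`pairCov_chartDeriv`). Therefore the map `Tμ(w) ↦ [A_N(w)|J¹p]` has the expression `(t, q, p, q̇,
ṗ) ↦ (t, q, q̇, ṗ, p)` in all corresponding charts (`extChartAt_tulczyjewEquiv`). This shows at once
that it is well defined, bijective and smooth with smooth inverse, and reduces the last claim to the
linear statement `sharpRel_tulczyjewCoord`.
-/

noncomputable section

namespace TulczyjewTriple

/-! ### Two-vectors with constant coefficients in the preferred charts -/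

section Constant

variable {E : Type*} [NormedAddCommGroup E] [NormedSpace ℝ E]
  {H : Type*} [TopologicalSpace H] (I : ModelWithCorners ℝ E H)
  {X : Type*} [TopologicalSpace X] [ChartedSpace H X]
  {E' : Type*} [NormedAddCommGroup E'] [NormedSpace ℝ E']
  {H' : Type*} [TopologicalSpace H'] {I' : ModelWithCorners ℝ E' H'}
  {Y : Type*} [TopologicalSpace Y] [ChartedSpace H' Y]
  {E'' : Type*} [NormedAddCommGroup E''] [NormedSpace ℝ E'']

variable (I') in
/-- The derivative of `φ : X → Y` as a map of the model spaces. The tangent spaces are identified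
with the model spaces through the preferred charts at `x` and `φ x`, so that this is the derivative
of the expression of `φ` in these charts. -/
def coordDeriv (φ : X → Y) (x : X) : E →L[ℝ] E' := mfderiv I I' φ x

/-- The derivative at `x` of the preferred chart at `x₀`. Since the tangent space at `x` is
identified with `E` through the preferred chart at `x`, this is the derivative of a change of
charts. -/
def chartDeriv (x₀ x : X) : E →L[ℝ] E := coordDeriv I 𝓘(ℝ, E) (extChartAt I x₀) x

/-- A constant 2-vector on `E` is encoded by its sharp map `P : E* → E`, so that its value on
covectors is `Λ(α, β) = β(P α)`. The linear map `T : E → E'` pushes `P` forward to `P'`. -/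
def SharpRel (T : E →L[ℝ] E') (P : (E →L[ℝ] ℝ) →L[ℝ] E) (P' : (E' →L[ℝ] ℝ) →L[ℝ] E') : Prop :=
  ∀ α : E' →L[ℝ] ℝ, T (P (α ∘L T)) = P' α

lemma SharpRel.comp {S : E' →L[ℝ] E''} {T : E →L[ℝ] E'} {P : (E →L[ℝ] ℝ) →L[ℝ] E}
    {P' : (E' →L[ℝ] ℝ) →L[ℝ] E'} {P'' : (E'' →L[ℝ] ℝ) →L[ℝ] E''}
    (hS : SharpRel S P' P'') (hT : SharpRel T P P') : SharpRel (S ∘L T) P P'' := by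
  intro α
  have h := hT (α ∘L S)
  rw [← hS α, ← h]
  rfl

/-- If `T` and `S ∘ T` push `P` forward to `P'` and `P''`, then `S` pushes `P'` forward to `P''`. -/
lemma SharpRel.of_comp {S : E' →L[ℝ] E''} {T : E →L[ℝ] E'} {P : (E →L[ℝ] ℝ) →L[ℝ] E}
    {P' : (E' →L[ℝ] ℝ) →L[ℝ] E'} {P'' : (E'' →L[ℝ] ℝ) →L[ℝ] E''}
    (hST : SharpRel (S ∘L T) P P'') (hT : SharpRel T P P') : SharpRel S P' P'' := by
  intro α
  rw [← hST α, ← hT (α ∘L S)]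
  rfl

/-- The push-forward of a sharp map under a linear map. -/
def pushSharp (T : E →L[ℝ] E') (P : (E →L[ℝ] ℝ) →L[ℝ] E) : (E' →L[ℝ] ℝ) →L[ℝ] E' :=
  T ∘L P ∘L (ContinuousLinearMap.compL ℝ E E' ℝ).flip T

lemma pushSharp_apply (T : E →L[ℝ] E') (P : (E →L[ℝ] ℝ) →L[ℝ] E) (α : E' →L[ℝ] ℝ) :
    pushSharp T P α = T (P (α ∘L T)) := rfl

lemma sharpRel_pushSharp (T : E →L[ℝ] E') (P : (E →L[ℝ] ℝ) →L[ℝ] E) :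
    SharpRel T P (pushSharp T P) := fun _ => rfl

/-- The 2-vector with sharp map `P` is alternating. -/
def IsAltSharp (P : (E →L[ℝ] ℝ) →L[ℝ] E) : Prop := ∀ α : E →L[ℝ] ℝ, α (P α) = 0

lemma IsAltSharp.swap {P : (E →L[ℝ] ℝ) →L[ℝ] E} (hP : IsAltSharp P) (α β : E →L[ℝ] ℝ) :
    α (P β) = -β (P α) := by
  have h := hP (α + β)
  simp only [map_add, add_apply, hP α, hP β] at h
  linarith

lemma IsAltSharp.push {P : (E →L[ℝ] ℝ) →L[ℝ] E} (hP : IsAltSharp P) (T : E →L[ℝ] E') :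
    IsAltSharp (pushSharp T P) := fun α => hP (α ∘L T)

variable (X) in
/-- The constant 2-vector with sharp map `P` is preserved by all changes of preferred charts of `X`.
-/
def IsChartInvariant (P : (E →L[ℝ] ℝ) →L[ℝ] E) : Prop :=
  ∀ x₀ x : X, x ∈ (chartAt H x₀).source → SharpRel (chartDeriv I x₀ x) P P

variable {I}

lemma chartDeriv_self [IsManifold I 1 X] (x : X) :
    chartDeriv I x x = ContinuousLinearMap.id ℝ E := mfderiv_extChartAt_self

lemma coordDeriv_comp {Z : Type*} [TopologicalSpace Z] {H'' : Type*} [TopologicalSpace H'']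
    [ChartedSpace H'' Z] {I'' : ModelWithCorners ℝ E'' H''} {ψ : Y → Z} {φ : X → Y} {x : X}
    (hψ : MDifferentiableAt I' I'' ψ (φ x)) (hφ : MDifferentiableAt I I' φ x) :
    coordDeriv I I'' (ψ ∘ φ) x = coordDeriv I' I'' ψ (φ x) ∘L coordDeriv I I' φ x :=
  mfderiv_comp x hψ hφ

section Boundaryless

variable [I.Boundaryless] [IsManifold I ∞ X] {x₀ x : X} {f : X → ℝ}

lemma mdifferentiableAt_extChartAt_symm {u : E} (hu : u ∈ (extChartAt I x₀).target) :
    MDifferentiableAt 𝓘(ℝ, E) I (extChartAt I x₀).symm u := by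
  have : IsManifold I 1 X := IsManifold.of_le (n := ∞) (by simp)
  have h := mdifferentiableWithinAt_extChartAt_symm (I := I) hu
  rwa [I.range_eq_univ, mdifferentiableWithinAt_univ] at h

/-- The derivative of a function in terms of its local expression in a preferred chart. -/
lemma coordDeriv_eq_fderiv_comp {f : X → E'} (hx : x ∈ (chartAt H x₀).source)
    (hf : MDifferentiableAt I 𝓘(ℝ, E') f x) :
    coordDeriv I 𝓘(ℝ, E') f x =
      fderiv ℝ (f ∘ (extChartAt I x₀).symm) (extChartAt I x₀ x) ∘L chartDeriv I x₀ x := by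
  have : IsManifold I 1 X := IsManifold.of_le (n := ∞) (by simp)
  have hx' : x ∈ (extChartAt I x₀).source := by rwa [extChartAt_source]
  have h1 : f =ᶠ[𝓝 x] (f ∘ (extChartAt I x₀).symm) ∘ extChartAt I x₀ := by
    filter_upwards [extChartAt_source_mem_nhds' hx'] with z hz
    rw [Function.comp_apply, Function.comp_apply, (extChartAt I x₀).left_inv hz]
  have h2 : MDifferentiableAt 𝓘(ℝ, E) 𝓘(ℝ, E') (f ∘ (extChartAt I x₀).symm)
      (extChartAt I x₀ x) := by
    refine MDifferentiableAt.comp _ ?_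
      (mdifferentiableAt_extChartAt_symm ((extChartAt I x₀).map_source hx'))
    rwa [(extChartAt I x₀).left_inv hx']
  have h3 := mfderiv_comp x h2 (mdifferentiableAt_extChartAt hx)
  rw [mfderiv_eq_fderiv] at h3
  exact h1.mfderiv_eq.trans h3

lemma contDiffAt_comp_extChartAt_symm {U : Set X} (hU : IsOpen U) (hxU : x ∈ U)
    (hx : x ∈ (chartAt H x₀).source) (hf : ContMDiffOn I 𝓘(ℝ, ℝ) ∞ f U) :
    ContDiffAt ℝ ∞ (f ∘ (extChartAt I x₀).symm) (extChartAt I x₀ x) := by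
  rw [← contMDiffAt_iff_contDiffAt]
  have hx' : x ∈ (extChartAt I x₀).source := by rwa [extChartAt_source]
  have h := (contMDiffOn_extChartAt_symm (I := I) (n := ∞) x₀).contMDiffAt
    ((isOpen_extChartAt_target x₀).mem_nhds ((extChartAt I x₀).map_source hx'))
  refine ContMDiffAt.comp _ ?_ h
  rw [(extChartAt I x₀).left_inv hx']
  exact hf.contMDiffAt (hU.mem_nhds hxU)

/-- The local expression `{f, g} = Dg(P(Df))` of the bracket of a constant 2-vector. -/
lemma IsChartInvariant.bracket_eq {P : (E →L[ℝ] ℝ) →L[ℝ] E} (hP : IsChartInvariant I X P)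
    {g : X → ℝ} (hx : x ∈ (chartAt H x₀).source)
    (hf : MDifferentiableAt I 𝓘(ℝ, ℝ) f x) (hg : MDifferentiableAt I 𝓘(ℝ, ℝ) g x) :
    coordDeriv I 𝓘(ℝ, ℝ) g x (P (coordDeriv I 𝓘(ℝ, ℝ) f x)) =
      fderiv ℝ (g ∘ (extChartAt I x₀).symm) (extChartAt I x₀ x)
        (P (fderiv ℝ (f ∘ (extChartAt I x₀).symm) (extChartAt I x₀ x))) := by
  rw [coordDeriv_eq_fderiv_comp hx hf, coordDeriv_eq_fderiv_comp hx hg,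
    ContinuousLinearMap.comp_apply, hP x₀ x hx]

/-- Near `x`, the bracket of a constant 2-vector is the function `Dg(P(Df))` of the coordinates. -/
lemma IsChartInvariant.bracket_eventuallyEq {P : (E →L[ℝ] ℝ) →L[ℝ] E} (hP : IsChartInvariant I X P)
    {g : X → ℝ} {U : Set X} (hU : IsOpen U) (hxU : x ∈ U)
    (hf : ContMDiffOn I 𝓘(ℝ, ℝ) ∞ f U) (hg : ContMDiffOn I 𝓘(ℝ, ℝ) ∞ g U) :
    (fun y => coordDeriv I 𝓘(ℝ, ℝ) g y (P (coordDeriv I 𝓘(ℝ, ℝ) f y))) =ᶠ[𝓝 x]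
      (fun u => fderiv ℝ (g ∘ (extChartAt I x).symm) u
        (P (fderiv ℝ (f ∘ (extChartAt I x).symm) u))) ∘ extChartAt I x := by
  filter_upwards [(chartAt H x).open_source.mem_nhds (mem_chart_source H x), hU.mem_nhds hxU]
    with y hy hyU
  exact hP.bracket_eq hy ((hf.contMDiffAt (hU.mem_nhds hyU)).mdifferentiableAt (by simp))
    ((hg.contMDiffAt (hU.mem_nhds hyU)).mdifferentiableAt (by simp))

lemma contDiffAt_fderiv_apply_sharp {F G : E → ℝ} {u : E} (P : (E →L[ℝ] ℝ) →L[ℝ] E)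
    (hF : ContDiffAt ℝ ∞ F u) (hG : ContDiffAt ℝ ∞ G u) :
    ContDiffAt ℝ ∞ (fun u => fderiv ℝ G u (P (fderiv ℝ F u))) u :=
  (hG.fderiv_right (m := ∞) (by simp)).clm_apply
    (P.contDiff.contDiffAt.comp u (hF.fderiv_right (m := ∞) (by simp)))

/-- The bilinear form on covectors with sharp map `P`. -/
def sharpForm (P : (E →L[ℝ] ℝ) →L[ℝ] E) : (E →L[ℝ] ℝ) →ₗ[ℝ] (E →L[ℝ] ℝ) →ₗ[ℝ] ℝ :=
  LinearMap.mk₂ ℝ (fun α β => β (P α)) (fun α α' β => by simp) (fun c α β => by simp)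
    (fun α β β' => by simp) (fun c α β => by simp)

variable (I X) in
/-- The 2-vector on `X` which in all preferred charts is the constant 2-vector with sharp map `P`.
-/
def constBivector (P : (E →L[ℝ] ℝ) →L[ℝ] E) (halt : IsAltSharp P) (hP : IsChartInvariant I X P) :
    BivectorField I X where
  toFun _ := sharpForm (E := E) P
  self_eq_zero x α := halt α
  smooth U f g hU hf hg := by
    intro x hx
    refine ContMDiffAt.contMDiffWithinAt ?_
    refine ContMDiffAt.congr_of_eventuallyEq ?_ (hP.bracket_eventuallyEq hU hx hf hg)
    have hk := contDiffAt_fderiv_apply_sharp P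
      (contDiffAt_comp_extChartAt_symm hU hx (mem_chart_source H x) hf)
      (contDiffAt_comp_extChartAt_symm hU hx (mem_chart_source H x) hg)
    exact hk.contMDiffAt.comp x contMDiffAt_extChartAt

variable {P : (E →L[ℝ] ℝ) →L[ℝ] E} {halt : IsAltSharp P} {hP : IsChartInvariant I X P}

lemma constBivector_bracket (f g : X → ℝ) (x : X) :
    (constBivector I X P halt hP).bracket f g x =
      coordDeriv I 𝓘(ℝ, ℝ) g x (P (coordDeriv I 𝓘(ℝ, ℝ) f x)) := rfl

/-- For functions `F, G, H` on a vector space, `{F, {G, H}} = D²H(♯DF, ♯DG) - D²G(♯DF, ♯DH)`. -/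
lemma fderiv_bracket_apply_sharp (halt : IsAltSharp P) {F G K : E → ℝ} {u : E}
    (hG : ContDiffAt ℝ ∞ G u) (hK : ContDiffAt ℝ ∞ K u) :
    fderiv ℝ (fun u => fderiv ℝ K u (P (fderiv ℝ G u))) u (P (fderiv ℝ F u)) =
      fderiv ℝ (fderiv ℝ K) u (P (fderiv ℝ F u)) (P (fderiv ℝ G u)) -
      fderiv ℝ (fderiv ℝ G) u (P (fderiv ℝ F u)) (P (fderiv ℝ K u)) := by
  have hG' : HasFDerivAt (fderiv ℝ G) (fderiv ℝ (fderiv ℝ G) u) u :=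
    ((hG.fderiv_right (m := ∞) (by simp)).differentiableAt (by simp)).hasFDerivAt
  have hK' : HasFDerivAt (fderiv ℝ K) (fderiv ℝ (fderiv ℝ K) u) u :=
    ((hK.fderiv_right (m := ∞) (by simp)).differentiableAt (by simp)).hasFDerivAt
  have h := hK'.clm_apply (P.hasFDerivAt.comp u hG')
  have h' : fderiv ℝ (fun u => fderiv ℝ K u (P (fderiv ℝ G u))) u = _ := h.fderiv
  rw [h']
  simp only [add_apply, ContinuousLinearMap.comp_apply,
    ContinuousLinearMap.flip_apply, Function.comp_apply]
  rw [halt.swap (fderiv ℝ K u)]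
  ring

/-- A constant 2-vector is a Poisson structure: the three terms of the Jacobi identity cancel by the
symmetry of second derivatives. -/
lemma constBivector_isPoisson : (constBivector I X P halt hP).IsPoisson := by
  intro U f g h hU hf hg hh x hx
  have hs := mem_chart_source H x
  have key : ∀ f g h : X → ℝ, ContMDiffOn I 𝓘(ℝ, ℝ) ∞ f U → ContMDiffOn I 𝓘(ℝ, ℝ) ∞ g U →
      ContMDiffOn I 𝓘(ℝ, ℝ) ∞ h U → (constBivector I X P halt hP).bracket f
        ((constBivector I X P halt hP).bracket g h) x =
      fderiv ℝ (fderiv ℝ (h ∘ (extChartAt I x).symm)) (extChartAt I x x)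
        (P (fderiv ℝ (f ∘ (extChartAt I x).symm) (extChartAt I x x)))
        (P (fderiv ℝ (g ∘ (extChartAt I x).symm) (extChartAt I x x))) -
      fderiv ℝ (fderiv ℝ (g ∘ (extChartAt I x).symm)) (extChartAt I x x)
        (P (fderiv ℝ (f ∘ (extChartAt I x).symm) (extChartAt I x x)))
        (P (fderiv ℝ (h ∘ (extChartAt I x).symm) (extChartAt I x x))) := by
    intro f g h hf hg hh
    have hgh := (constBivector I X P halt hP).smooth U g h hU hg hh
    refine (hP.bracket_eq hs ((hf.contMDiffAt (hU.mem_nhds hx)).mdifferentiableAt (by simp))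
      ((hgh.contMDiffAt (hU.mem_nhds hx)).mdifferentiableAt (by simp))).trans ?_
    rw [← fderiv_bracket_apply_sharp halt
      (contDiffAt_comp_extChartAt_symm hU hx hs hg) (contDiffAt_comp_extChartAt_symm hU hx hs hh)]
    refine congrArg (fun A : E →L[ℝ] ℝ => A _) (Filter.EventuallyEq.fderiv_eq ?_)
    have h1 := hP.bracket_eventuallyEq hU hx hg hh
    have h2 : Filter.Tendsto (extChartAt I x).symm (𝓝 (extChartAt I x x)) (𝓝 x) := by
      have := continuousAt_extChartAt_symm (I := I) x
      rwa [ContinuousAt, extChartAt_to_inv] at this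
    filter_upwards [h2.eventually h1, extChartAt_target_mem_nhds (I := I) x] with u hu hu'
    refine hu.trans ?_
    simp only [Function.comp_apply, (extChartAt I x).right_inv hu']
  have hsymm : ∀ f : X → ℝ, ContMDiffOn I 𝓘(ℝ, ℝ) ∞ f U → ∀ v w,
      fderiv ℝ (fderiv ℝ (f ∘ (extChartAt I x).symm)) (extChartAt I x x) v w =
      fderiv ℝ (fderiv ℝ (f ∘ (extChartAt I x).symm)) (extChartAt I x x) w v := fun f hf v w =>
    ((contDiffAt_comp_extChartAt_symm hU hx hs hf).isSymmSndFDerivAt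
      (by simpa using by norm_cast)).eq v w
  rw [key f g h hf hg hh, key g h f hg hh hf, key h f g hh hf hg, hsymm f hf, hsymm g hg,
    hsymm h hh]
  ring

lemma finrank_strongDual [FiniteDimensional ℝ E] :
    Module.finrank ℝ (E →L[ℝ] ℝ) = Module.finrank ℝ E := by
  rw [← (LinearMap.toContinuousLinearMap (𝕜 := ℝ) (E := E) (F' := ℝ)).finrank_eq]
  exact Subspace.dual_finrank_eq

/-- A constant 2-vector has corank `1` if the kernel of its sharp map is a line. -/
lemma constBivector_hasCorank_one [FiniteDimensional ℝ E] (ℓ : E →L[ℝ] ℝ) (hℓ : ℓ ≠ 0)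
    (hker : ∀ α, P α = 0 ↔ ∃ c : ℝ, α = c • ℓ) :
    (constBivector I X P halt hP).HasCorank 1 := by
  intro x
  let A : (E →L[ℝ] ℝ) →ₗ[ℝ] (E →L[ℝ] ℝ) →ₗ[ℝ] ℝ := (constBivector I X P halt hP).toFun x
  have hA : LinearMap.ker A = Submodule.span ℝ {ℓ} := by
    ext α
    rw [Submodule.mem_span_singleton, LinearMap.mem_ker]
    have h : A α = 0 ↔ P α = 0 := by
      constructor
      · intro h
        by_contra hne
        obtain ⟨β, hβ⟩ := SeparatingDual.exists_ne_zero (R := ℝ) hne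
        exact hβ (DFunLike.congr_fun h β)
      · intro h
        refine LinearMap.ext fun β => ?_
        change β (P α) = 0
        rw [h, map_zero]
    rw [h, hker]
    exact exists_congr fun c => eq_comm
  have h1 := LinearMap.finrank_range_add_finrank_ker A
  rw [hA, finrank_span_singleton hℓ] at h1
  rw [finrank_strongDual] at h1
  exact h1

/-- A smooth map pushes one constant 2-vector forward to another if its derivatives do. -/
lemma constBivector_isPoissonMap [I'.Boundaryless] [IsManifold I' ∞ Y]
    {P' : (E' →L[ℝ] ℝ) →L[ℝ] E'} {halt' : IsAltSharp P'} {hP' : IsChartInvariant I' Y P'}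
    {φ : X → Y} (hφ : ContMDiff I I' ∞ φ)
    (h : ∀ x, SharpRel (coordDeriv I I' φ x) P P') :
    IsPoissonMap φ (constBivector I X P halt hP) (constBivector I' Y P' halt' hP') :=
  ⟨hφ, fun x α β => congrArg (β : E' →L[ℝ] ℝ) (h x α).symm⟩

end Boundaryless

end Constant

/-! ### Changes of charts of tangent and cotangent bundles -/

section Bundles

variable {E : Type*} [NormedAddCommGroup E] [NormedSpace ℝ E]
  {X : Type*} [TopologicalSpace X] [ChartedSpace E X]

/-- The change of coordinates from the preferred chart at `x` to the preferred chart at `x₀`. -/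
def transition (x₀ x : X) : E → E :=
  extChartAt 𝓘(ℝ, E) x₀ ∘ (extChartAt 𝓘(ℝ, E) x).symm

variable [IsManifold 𝓘(ℝ, E) ∞ X]

omit [IsManifold 𝓘(ℝ, E) ∞ X] in
lemma transition_apply {x₀ x y : X} (hy : y ∈ (chartAt E x).source) :
    transition x₀ x (extChartAt 𝓘(ℝ, E) x y) = extChartAt 𝓘(ℝ, E) x₀ y := by
  rw [transition, Function.comp_apply, (extChartAt 𝓘(ℝ, E) x).left_inv (by rwa [extChartAt_source])]

lemma contDiffAt_transition {x₀ x y : X} (hy : y ∈ (chartAt E x).source)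
    (hy₀ : y ∈ (chartAt E x₀).source) :
    ContDiffAt ℝ ∞ (transition x₀ x) (extChartAt 𝓘(ℝ, E) x y) := by
  rw [← contMDiffAt_iff_contDiffAt]
  have hy' : y ∈ (extChartAt 𝓘(ℝ, E) x).source := by rwa [extChartAt_source]
  have h := (contMDiffOn_extChartAt_symm (I := 𝓘(ℝ, E)) (n := ∞) x).contMDiffAt
    ((isOpen_extChartAt_target x).mem_nhds ((extChartAt 𝓘(ℝ, E) x).map_source hy'))
  refine ContMDiffAt.comp _ ?_ h
  rw [(extChartAt 𝓘(ℝ, E) x).left_inv hy']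
  exact contMDiffAt_extChartAt' hy₀

lemma mdifferentiableAt_extChartAt' {x₀ x : X} (hx : x ∈ (chartAt E x₀).source) :
    MDifferentiableAt 𝓘(ℝ, E) 𝓘(ℝ, E) (extChartAt 𝓘(ℝ, E) x₀) x :=
  have : IsManifold 𝓘(ℝ, E) 1 X := IsManifold.of_le (n := ∞) (by simp)
  mdifferentiableAt_extChartAt hx

lemma chartDeriv_eq_comp {x₀ x y : X} (hy : y ∈ (chartAt E x).source)
    (hy₀ : y ∈ (chartAt E x₀).source) :
    chartDeriv 𝓘(ℝ, E) x₀ y =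
      fderiv ℝ (transition x₀ x) (extChartAt 𝓘(ℝ, E) x y) ∘L chartDeriv 𝓘(ℝ, E) x y :=
  coordDeriv_eq_fderiv_comp hy (mdifferentiableAt_extChartAt' hy₀)

lemma chartDeriv_eq_fderiv {x₀ x : X} (hx : x ∈ (chartAt E x₀).source) :
    chartDeriv 𝓘(ℝ, E) x₀ x = fderiv ℝ (transition x₀ x) (extChartAt 𝓘(ℝ, E) x x) := by
  have : IsManifold 𝓘(ℝ, E) 1 X := IsManifold.of_le (n := ∞) (by simp)
  rw [chartDeriv_eq_comp (mem_chart_source E x) hx, chartDeriv_self]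
  rfl

/-- The tangent vector `v` in the preferred chart at its base point. -/
def vecCoord (v : TangentBundle 𝓘(ℝ, E) X) : E := v.snd

/-- The covector `a` in the preferred chart at its base point. -/
def covCoord (a : CotangentBundle 𝓘(ℝ, E) X) : E →L[ℝ] ℝ := a.snd

/-- The inverse of `chartDeriv`. -/
def chartDerivSymm (x₀ x : X) : E →L[ℝ] E :=
  (trivializationAt E (TangentSpace 𝓘(ℝ, E)) x₀).symmL ℝ x

lemma chartDeriv_eq_trivializationAt {x₀ x : X} (hx : x ∈ (chartAt E x₀).source) :
    chartDeriv 𝓘(ℝ, E) x₀ x =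
      ((trivializationAt E (TangentSpace 𝓘(ℝ, E)) x₀).continuousLinearMapAt ℝ x : E →L[ℝ] E) :=
  (TangentBundle.continuousLinearMapAt_trivializationAt hx).symm

lemma chartDeriv_chartDerivSymm {x₀ x : X} (hx : x ∈ (chartAt E x₀).source) (w : E) :
    chartDeriv 𝓘(ℝ, E) x₀ x (chartDerivSymm x₀ x w) = w := by
  rw [chartDeriv_eq_trivializationAt hx]
  exact Bundle.Trivialization.continuousLinearMapAt_symmL _
    (hx : x ∈ (trivializationAt E (TangentSpace 𝓘(ℝ, E)) x₀).baseSet) w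

lemma chartDerivSymm_chartDeriv {x₀ x : X} (hx : x ∈ (chartAt E x₀).source) (w : E) :
    chartDerivSymm x₀ x (chartDeriv 𝓘(ℝ, E) x₀ x w) = w := by
  rw [chartDeriv_eq_trivializationAt hx]
  exact Bundle.Trivialization.symmL_continuousLinearMapAt
    (trivializationAt E (TangentSpace 𝓘(ℝ, E)) x₀)
    (hx : x ∈ (trivializationAt E (TangentSpace 𝓘(ℝ, E)) x₀).baseSet) _

lemma chartDerivSymm_eq_fderiv {x₀ x : X} (hx : x ∈ (chartAt E x₀).source) :
    chartDerivSymm x₀ x = fderiv ℝ (transition x x₀) (extChartAt 𝓘(ℝ, E) x₀ x) := by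
  have : IsManifold 𝓘(ℝ, E) 1 X := IsManifold.of_le (n := ∞) (by simp)
  have h := chartDeriv_eq_comp (x₀ := x) hx (mem_chart_source E x)
  rw [chartDeriv_self] at h
  refine ContinuousLinearMap.ext fun w => ?_
  have h2 := DFunLike.congr_fun h (chartDerivSymm x₀ x w)
  rw [ContinuousLinearMap.comp_apply, chartDeriv_chartDerivSymm hx] at h2
  exact h2

/-! #### Tangent bundles -/

lemma extChartAt_tangent_apply (v₀ v : TangentBundle 𝓘(ℝ, E) X)
    (hv : v.proj ∈ (chartAt E v₀.proj).source) :
    extChartAt 𝓘(ℝ, E).tangent v₀ v =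
      (extChartAt 𝓘(ℝ, E) v₀.proj v.proj, chartDeriv 𝓘(ℝ, E) v₀.proj v.proj (vecCoord v)) := by
  rw [chartDeriv_eq_trivializationAt hv]
  refine Prod.ext rfl ?_
  exact ((trivializationAt E (TangentSpace 𝓘(ℝ, E)) v₀.proj).continuousLinearMapAt_apply_of_mem
    (R := ℝ) (by simpa using hv) v.snd).symm

lemma extChartAt_tangent_source (v₀ : TangentBundle 𝓘(ℝ, E) X) :
    (extChartAt 𝓘(ℝ, E).tangent v₀).source = {v | v.proj ∈ (chartAt E v₀.proj).source} := by
  ext v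
  rw [extChartAt_source]
  exact TangentBundle.mem_chart_source_iff v v₀

lemma extChartAt_tangent_self (v : TangentBundle 𝓘(ℝ, E) X) :
    extChartAt 𝓘(ℝ, E).tangent v v = (extChartAt 𝓘(ℝ, E) v.proj v.proj, vecCoord v) := by
  have : IsManifold 𝓘(ℝ, E) 1 X := IsManifold.of_le (n := ∞) (by simp)
  rw [extChartAt_tangent_apply v v (mem_chart_source E _), chartDeriv_self]
  rfl

/-- The change of charts of the tangent bundle is `(q, u) ↦ (τ q, Dτ(q) u)`. -/
lemma tangent_transition_eventuallyEq {v₀ v : TangentBundle 𝓘(ℝ, E) X}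
    (hv : v.proj ∈ (chartAt E v₀.proj).source) :
    extChartAt 𝓘(ℝ, E).tangent v₀ ∘ (extChartAt 𝓘(ℝ, E).tangent v).symm =ᶠ[
      𝓝 (extChartAt 𝓘(ℝ, E).tangent v v)]
      fun z => (transition v₀.proj v.proj z.1, fderiv ℝ (transition v₀.proj v.proj) z.1 z.2) := by
  have h0 : (extChartAt 𝓘(ℝ, E).tangent v₀).source ∈ 𝓝 v :=
    (isOpen_extChartAt_source v₀).mem_nhds (by rw [extChartAt_tangent_source]; exact hv)
  have h1 := continuousAt_extChartAt_symm (I := 𝓘(ℝ, E).tangent) v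
  rw [ContinuousAt, extChartAt_to_inv] at h1
  filter_upwards [h1 h0, extChartAt_target_mem_nhds (I := 𝓘(ℝ, E).tangent) v] with z hz hz'
  have hb := (extChartAt 𝓘(ℝ, E).tangent v).map_target hz'
  have hz2 := (extChartAt 𝓘(ℝ, E).tangent v).right_inv hz'
  rw [Function.comp_apply]
  rw [mem_preimage] at hz
  generalize (extChartAt 𝓘(ℝ, E).tangent v).symm z = b at *
  rw [extChartAt_tangent_source] at hb hz
  rw [← hz2, extChartAt_tangent_apply v b hb, extChartAt_tangent_apply v₀ b hz,
    transition_apply hb, chartDeriv_eq_comp hb hz]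
  rfl

/-- The derivative of a chart of the tangent bundle. -/
lemma chartDeriv_tangent_apply {v₀ v : TangentBundle 𝓘(ℝ, E) X}
    (hv : v.proj ∈ (chartAt E v₀.proj).source) (δ : E × E) :
    chartDeriv 𝓘(ℝ, E).tangent v₀ v δ =
      (chartDeriv 𝓘(ℝ, E) v₀.proj v.proj δ.1,
        fderiv ℝ (fderiv ℝ (transition v₀.proj v.proj)) (extChartAt 𝓘(ℝ, E) v.proj v.proj)
            δ.1 (vecCoord v) +
          chartDeriv 𝓘(ℝ, E) v₀.proj v.proj δ.2) := by
  have hm : v ∈ (chartAt (ModelProd E E) v₀).source := by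
    rw [← extChartAt_source 𝓘(ℝ, E).tangent, extChartAt_tangent_source]; exact hv
  have hI : IsManifold 𝓘(ℝ, E).tangent 1 (TangentBundle 𝓘(ℝ, E) X) :=
    IsManifold.of_le (n := ∞) (by simp)
  have h1 : chartDeriv 𝓘(ℝ, E).tangent v₀ v = fderiv ℝ (extChartAt 𝓘(ℝ, E).tangent v₀ ∘
      (extChartAt 𝓘(ℝ, E).tangent v).symm) (extChartAt 𝓘(ℝ, E).tangent v v) := by
    rw [chartDeriv, coordDeriv_eq_fderiv_comp (mem_chart_source _ v)
      (mdifferentiableAt_extChartAt hm), chartDeriv_self]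
    rfl
  have hc := contDiffAt_transition (mem_chart_source E v.proj) hv
  have h2 : HasFDerivAt (transition v₀.proj v.proj) _ _ :=
    (hc.differentiableAt (by simp)).hasFDerivAt
  have h3 : HasFDerivAt (fderiv ℝ (transition v₀.proj v.proj)) _ _ :=
    ((hc.fderiv_right (m := ∞) (by simp)).differentiableAt (by simp)).hasFDerivAt
  let z : E × E := (extChartAt 𝓘(ℝ, E) v.proj v.proj, vecCoord v)
  have h3' : HasFDerivAt (fderiv ℝ (transition v₀.proj v.proj)) _ z.1 := h3
  have h4 := (h2.comp z hasFDerivAt_fst).prodMk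
    ((h3'.comp z hasFDerivAt_fst).clm_apply (hasFDerivAt_snd (E := E) (F := E) (p := z)))
  have h5 : fderiv ℝ (fun z : E × E => (transition v₀.proj v.proj z.1,
    fderiv ℝ (transition v₀.proj v.proj) z.1 z.2)) z = _ := h4.fderiv
  rw [h1, (tangent_transition_eventuallyEq hv).fderiv_eq, extChartAt_tangent_self, h5,
    chartDeriv_eq_fderiv hv]
  exact Prod.ext rfl (add_comm _ _)

/-! #### Cotangent bundles -/

variable (E) in
/-- The model of the cotangent bundle of a manifold modelled on `E`. -/
abbrev cotModel : ModelWithCorners ℝ (E × (E →L[ℝ] ℝ)) (ModelProd E (E →L[ℝ] ℝ)) :=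
  𝓘(ℝ, E).prod 𝓘(ℝ, E →L[ℝ] ℝ)

lemma extChartAt_cotangent_apply (a₀ a : CotangentBundle 𝓘(ℝ, E) X) :
    extChartAt (cotModel E) a₀ a =
      (extChartAt 𝓘(ℝ, E) a₀.proj a.proj,
        covCoord a ∘L chartDerivSymm a₀.proj a.proj) := by
  have h : extChartAt (cotModel E) a₀ a = chartAt (ModelProd E (E →L[ℝ] ℝ)) a₀ a := rfl
  rw [h, hom_chart]
  refine Prod.ext rfl (ContinuousLinearMap.ext fun w => ?_)
  simp only [ContinuousLinearMap.inCoordinates, ContinuousLinearMap.comp_apply]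
  exact DFunLike.congr_fun (Bundle.Trivial.continuousLinearMapAt_trivialization ℝ X ℝ a.proj) _

lemma extChartAt_cotangent_source (a₀ : CotangentBundle 𝓘(ℝ, E) X) :
    (extChartAt (cotModel E) a₀).source = {a | a.proj ∈ (chartAt E a₀.proj).source} := by
  ext a
  rw [extChartAt_source, FiberBundle.chartedSpace_chartAt]
  simp only [mfld_simps]
  constructor
  · exact fun h => h.1.1
  · intro h
    refine ⟨⟨h, Set.mem_univ _⟩, ?_⟩
    rwa [Bundle.Trivialization.coe_fst]
    simpa using h

lemma chartDerivSymm_self (x : X) : chartDerivSymm x x = ContinuousLinearMap.id ℝ E := by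
  have : IsManifold 𝓘(ℝ, E) 1 X := IsManifold.of_le (n := ∞) (by simp)
  refine ContinuousLinearMap.ext fun w => ?_
  have h := chartDeriv_chartDerivSymm (mem_chart_source E x) w
  rwa [chartDeriv_self] at h

lemma extChartAt_cotangent_self (a : CotangentBundle 𝓘(ℝ, E) X) :
    extChartAt (cotModel E) a a = (extChartAt 𝓘(ℝ, E) a.proj a.proj, covCoord a) := by
  rw [extChartAt_cotangent_apply, chartDerivSymm_self]
  rfl

/-- The change of charts of the cotangent bundle is `(q, p) ↦ (τ q, p ∘ Dσ(τ q))`, where `σ` is the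
inverse of `τ`. -/
lemma cotangent_transition_eventuallyEq {a₀ a : CotangentBundle 𝓘(ℝ, E) X}
    (ha : a.proj ∈ (chartAt E a₀.proj).source) :
    extChartAt (cotModel E) a₀ ∘ (extChartAt (cotModel E) a).symm =ᶠ[
      𝓝 (extChartAt (cotModel E) a a)]
      fun z => (transition a₀.proj a.proj z.1,
        z.2 ∘L fderiv ℝ (transition a.proj a₀.proj) (transition a₀.proj a.proj z.1)) := by
  have h0 : (extChartAt (cotModel E) a₀).source ∈ 𝓝 a :=
    (isOpen_extChartAt_source a₀).mem_nhds (by rw [extChartAt_cotangent_source]; exact ha)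
  have h1 := continuousAt_extChartAt_symm (I := (cotModel E)) a
  rw [ContinuousAt, extChartAt_to_inv] at h1
  filter_upwards [h1 h0, extChartAt_target_mem_nhds (I := (cotModel E)) a] with z hz hz'
  have hb := (extChartAt (cotModel E) a).map_target hz'
  have hz2 := (extChartAt (cotModel E) a).right_inv hz'
  rw [Function.comp_apply]
  rw [mem_preimage] at hz
  generalize (extChartAt (cotModel E) a).symm z = b at *
  rw [extChartAt_cotangent_source] at hb hz
  rw [← hz2, extChartAt_cotangent_apply a b, extChartAt_cotangent_apply a₀ b,
    transition_apply hb]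
  refine Prod.ext rfl (ContinuousLinearMap.ext fun w => ?_)
  change covCoord b (chartDerivSymm a₀.proj b.proj w) =
    covCoord b (chartDerivSymm a.proj b.proj
      (fderiv ℝ (transition a.proj a₀.proj) (extChartAt 𝓘(ℝ, E) a₀.proj b.proj) w))
  have h := chartDeriv_eq_comp hz hb
  have h2 := DFunLike.congr_fun h (chartDerivSymm a₀.proj b.proj w)
  rw [ContinuousLinearMap.comp_apply, chartDeriv_chartDerivSymm hz] at h2
  rw [← h2, chartDerivSymm_chartDeriv hb]

/-- The derivative of a chart of the cotangent bundle. -/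
lemma chartDeriv_cotangent_apply {a₀ a : CotangentBundle 𝓘(ℝ, E) X}
    (ha : a.proj ∈ (chartAt E a₀.proj).source) (δ : E × (E →L[ℝ] ℝ)) :
    chartDeriv (cotModel E) a₀ a δ =
      (chartDeriv 𝓘(ℝ, E) a₀.proj a.proj δ.1,
        δ.2 ∘L chartDerivSymm a₀.proj a.proj +
        covCoord a ∘L fderiv ℝ (fderiv ℝ (transition a.proj a₀.proj))
            (extChartAt 𝓘(ℝ, E) a₀.proj a.proj) (chartDeriv 𝓘(ℝ, E) a₀.proj a.proj δ.1)) := by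
  have hm : a ∈ (chartAt (ModelProd E (E →L[ℝ] ℝ)) a₀).source := by
    rw [← extChartAt_source (cotModel E), extChartAt_cotangent_source]; exact ha
  have hI : IsManifold (cotModel E) 1 (CotangentBundle 𝓘(ℝ, E) X) :=
    IsManifold.of_le (n := ∞) (by simp)
  have h1 : chartDeriv (cotModel E) a₀ a = fderiv ℝ (extChartAt (cotModel E) a₀ ∘
      (extChartAt (cotModel E) a).symm) (extChartAt (cotModel E) a a) := by
    rw [chartDeriv, coordDeriv_eq_fderiv_comp (mem_chart_source _ a)
      (mdifferentiableAt_extChartAt hm), chartDeriv_self]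
    rfl
  have hc := contDiffAt_transition (mem_chart_source E a.proj) ha
  let z : E × (E →L[ℝ] ℝ) := (extChartAt 𝓘(ℝ, E) a.proj a.proj, covCoord a)
  have h2 : HasFDerivAt (transition a₀.proj a.proj) _ z.1 :=
    (hc.differentiableAt (by simp)).hasFDerivAt
  have hc' := contDiffAt_transition ha (mem_chart_source E a.proj)
  have h3 : HasFDerivAt (fderiv ℝ (transition a.proj a₀.proj)) _
      (extChartAt 𝓘(ℝ, E) a₀.proj a.proj) :=
    ((hc'.fderiv_right (m := ∞) (by simp)).differentiableAt (by simp)).hasFDerivAt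
  rw [← transition_apply (mem_chart_source E a.proj)] at h3
  have h23 : HasFDerivAt (fun q => fderiv ℝ (transition a.proj a₀.proj)
      (transition a₀.proj a.proj q)) _ z.1 := h3.comp z.1 h2
  have h4 := (h2.comp z hasFDerivAt_fst).prodMk
    (hasFDerivAt_snd.clm_comp (h23.comp z hasFDerivAt_fst))
  have h5 : fderiv ℝ (fun z : E × (E →L[ℝ] ℝ) => (transition a₀.proj a.proj z.1,
        z.2 ∘L fderiv ℝ (transition a.proj a₀.proj) (transition a₀.proj a.proj z.1))) z = _ :=
    h4.fderiv
  rw [h1, (cotangent_transition_eventuallyEq ha).fderiv_eq, extChartAt_cotangent_self, h5,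
    chartDeriv_eq_fderiv ha, chartDerivSymm_eq_fderiv ha]
  refine Prod.ext rfl ?_
  refine (add_comm _ _).trans ?_
  rw [← transition_apply (x₀ := a₀.proj) (mem_chart_source E a.proj)]
  rfl

lemma fderiv_fderiv_transition_symm {x₀ x y : X} (hy : y ∈ (chartAt E x).source)
    (hy₀ : y ∈ (chartAt E x₀).source) (v w : E) :
    fderiv ℝ (fderiv ℝ (transition x₀ x)) (extChartAt 𝓘(ℝ, E) x y) v w =
      fderiv ℝ (fderiv ℝ (transition x₀ x)) (extChartAt 𝓘(ℝ, E) x y) w v :=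
  ((contDiffAt_transition hy hy₀).isSymmSndFDerivAt (by simpa using by norm_cast)).eq v w

end Bundles

/-! ### The canonical Poisson structure of a cotangent bundle -/

section Cotangent

variable (E : Type*) [NormedAddCommGroup E] [NormedSpace ℝ E] [FiniteDimensional ℝ E]

/-- The canonical isomorphism of a finite-dimensional space with its bidual. -/
def bidualEquiv : E ≃L[ℝ] ((E →L[ℝ] ℝ) →L[ℝ] ℝ) :=
  LinearEquiv.toContinuousLinearEquiv (LinearEquiv.ofInjectiveOfFinrankEq
    (NormedSpace.inclusionInDoubleDual ℝ E : E →L[ℝ] (E →L[ℝ] ℝ) →L[ℝ] ℝ).toLinearMap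
    (fun x y h => by
      by_contra hne
      obtain ⟨f, hf⟩ := SeparatingDual.exists_ne_zero (R := ℝ) (sub_ne_zero.2 hne)
      refine hf ?_
      rw [map_sub, sub_eq_zero]
      exact DFunLike.congr_fun h f)
    (by rw [finrank_strongDual, finrank_strongDual]))

/-- The inverse of `bidualEquiv`. -/
def bidualInv : ((E →L[ℝ] ℝ) →L[ℝ] ℝ) →L[ℝ] E := (bidualEquiv E).symm

variable {E}

lemma apply_bidualInv (ζ : (E →L[ℝ] ℝ) →L[ℝ] ℝ) (p : E →L[ℝ] ℝ) : p (bidualInv E ζ) = ζ p :=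
  DFunLike.congr_fun ((bidualEquiv E).apply_symm_apply ζ) p

lemma bidualInv_eq {ζ : (E →L[ℝ] ℝ) →L[ℝ] ℝ} {e : E} (h : ∀ p : E →L[ℝ] ℝ, ζ p = p e) :
    bidualInv E ζ = e := by
  by_contra hne
  obtain ⟨f, hf⟩ := SeparatingDual.exists_ne_zero (R := ℝ) (sub_ne_zero.2 hne)
  refine hf ?_
  rw [map_sub, apply_bidualInv, h, sub_self]

variable (E) in
/-- The sharp map of the canonical Poisson structure `{q, p} = 1` on `E × E*`. -/
def canonicalSharp : ((E × (E →L[ℝ] ℝ)) →L[ℝ] ℝ) →L[ℝ] E × (E →L[ℝ] ℝ) :=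
  (-(bidualInv E ∘L (ContinuousLinearMap.compL ℝ (E →L[ℝ] ℝ) (E × (E →L[ℝ] ℝ)) ℝ).flip
      (ContinuousLinearMap.inr ℝ E (E →L[ℝ] ℝ)))).prod
    ((ContinuousLinearMap.compL ℝ E (E × (E →L[ℝ] ℝ)) ℝ).flip
      (ContinuousLinearMap.inl ℝ E (E →L[ℝ] ℝ)))

lemma canonicalSharp_apply (α : (E × (E →L[ℝ] ℝ)) →L[ℝ] ℝ) :
    canonicalSharp E α = (-bidualInv E (α ∘L ContinuousLinearMap.inr ℝ E (E →L[ℝ] ℝ)),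
      α ∘L ContinuousLinearMap.inl ℝ E (E →L[ℝ] ℝ)) := rfl

omit [FiniteDimensional ℝ E] in
lemma clm_apply_prod {G : Type*} [NormedAddCommGroup G] [NormedSpace ℝ G] (α : (E × G) →L[ℝ] ℝ)
    (z : E × G) : α z = (α ∘L ContinuousLinearMap.inl ℝ E G) z.1 +
      (α ∘L ContinuousLinearMap.inr ℝ E G) z.2 := by
  simp [← map_add]

lemma isAltSharp_canonicalSharp : IsAltSharp (canonicalSharp E) := by
  intro α
  rw [clm_apply_prod, canonicalSharp_apply, map_neg, apply_bidualInv]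
  ring

variable (X : Type*) [TopologicalSpace X] [ChartedSpace E X] [IsManifold 𝓘(ℝ, E) ∞ X]

/-- Changes of charts `(q, p) ↦ (τ q, p ∘ Dσ(τ q))` of a cotangent bundle are symplectic, by the
symmetry of the second derivative of `σ`. -/
lemma isChartInvariant_canonicalSharp :
    IsChartInvariant (cotModel E) (CotangentBundle 𝓘(ℝ, E) X) (canonicalSharp E) := by
  intro a₀ a ha α
  have ha' : a.proj ∈ (chartAt E a₀.proj).source := by
    rw [← extChartAt_source (cotModel E), extChartAt_cotangent_source] at ha
    exact ha
  set b := bidualInv E (α ∘L ContinuousLinearMap.inr ℝ E (E →L[ℝ] ℝ)) with hb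
  have hbp : ∀ p : E →L[ℝ] ℝ, α (0, p) = p b := fun p => by
    rw [hb, apply_bidualInv]; rfl
  have h1 : bidualInv E ((α ∘L chartDeriv (cotModel E) a₀ a) ∘L
      ContinuousLinearMap.inr ℝ E (E →L[ℝ] ℝ)) = chartDerivSymm a₀.proj a.proj b := by
    refine bidualInv_eq fun p => ?_
    simp only [ContinuousLinearMap.comp_apply, ContinuousLinearMap.inr_apply]
    rw [chartDeriv_cotangent_apply ha']
    simp only [map_zero, ContinuousLinearMap.comp_zero, add_zero]
    rw [hbp]
    rfl
  rw [canonicalSharp_apply, h1, chartDeriv_cotangent_apply ha', canonicalSharp_apply, ← hb]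
  simp only [map_neg, chartDeriv_chartDerivSymm ha']
  refine Prod.ext rfl (ContinuousLinearMap.ext fun w => ?_)
  simp only [add_apply, ContinuousLinearMap.comp_apply, ContinuousLinearMap.inl_apply]
  rw [chartDeriv_cotangent_apply ha', clm_apply_prod]
  simp only [chartDeriv_chartDerivSymm ha', ContinuousLinearMap.comp_apply,
    ContinuousLinearMap.inl_apply, ContinuousLinearMap.inr_apply, hbp,
    ContinuousLinearMap.zero_comp, zero_add, neg_apply, map_neg]
  rw [fderiv_fderiv_transition_symm ha' (mem_chart_source E a.proj) b w]
  ring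

/-- The canonical Poisson structure of the cotangent bundle. -/
def canonicalPoisson : BivectorField (cotModel E) (CotangentBundle 𝓘(ℝ, E) X) :=
  constBivector _ _ (canonicalSharp E) isAltSharp_canonicalSharp (isChartInvariant_canonicalSharp X)

lemma canonicalPoisson_isPoisson : (canonicalPoisson (E := E) X).IsPoisson := by
  unfold canonicalPoisson
  exact constBivector_isPoisson

variable {X}

omit [FiniteDimensional ℝ E] in
lemma mdifferentiableAt_cotangent_proj (a : CotangentBundle 𝓘(ℝ, E) X) :
    MDifferentiableAt (cotModel E) 𝓘(ℝ, E)
      (Bundle.TotalSpace.proj : CotangentBundle 𝓘(ℝ, E) X → X) a :=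
  (Bundle.contMDiffAt_proj _ (n := 1)).mdifferentiableAt (by simp)

omit [FiniteDimensional ℝ E] in
/-- In the preferred charts the Liouville form is `p dq`. -/
lemma liouville_coord_eventuallyEq (a : CotangentBundle 𝓘(ℝ, E) X) :
    (fun u => (liouville 𝓘(ℝ, E) X ((extChartAt (cotModel E) a).symm u) :
        E × (E →L[ℝ] ℝ) →L[ℝ] ℝ) ∘L
      coordDeriv 𝓘(ℝ, E × (E →L[ℝ] ℝ)) (cotModel E) (extChartAt (cotModel E) a).symm u)
    =ᶠ[𝓝 (extChartAt (cotModel E) a a)]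
    fun u : E × (E →L[ℝ] ℝ) => u.2 ∘L ContinuousLinearMap.fst ℝ E (E →L[ℝ] ℝ) := by
  filter_upwards [extChartAt_target_mem_nhds (I := cotModel E) a] with u hu
  have hb := (extChartAt (cotModel E) a).map_target hu
  have hub := (extChartAt (cotModel E) a).right_inv hu
  have hd := mdifferentiableAt_extChartAt_symm (I := cotModel E) hu
  have hφ : extChartAt 𝓘(ℝ, E) a.proj ∘ Bundle.TotalSpace.proj ∘ (extChartAt (cotModel E) a).symm
      =ᶠ[𝓝 u] Prod.fst := by
    filter_upwards [(isOpen_extChartAt_target a).mem_nhds hu] with z hz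
    have h := congrArg Prod.fst ((extChartAt (cotModel E) a).right_inv hz)
    rwa [extChartAt_cotangent_apply] at h
  generalize hbe : (extChartAt (cotModel E) a).symm u = b at *
  rw [extChartAt_cotangent_source] at hb
  rw [extChartAt_cotangent_apply] at hub
  have h1 : coordDeriv 𝓘(ℝ, E × (E →L[ℝ] ℝ)) 𝓘(ℝ, E) (extChartAt 𝓘(ℝ, E) a.proj ∘
      Bundle.TotalSpace.proj ∘ (extChartAt (cotModel E) a).symm) u =
      ContinuousLinearMap.fst ℝ E (E →L[ℝ] ℝ) := by
    refine hφ.mfderiv_eq.trans ?_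
    rw [mfderiv_eq_fderiv]
    exact fderiv_fst
  have hpr := mdifferentiableAt_cotangent_proj ((extChartAt (cotModel E) a).symm u)
  rw [coordDeriv_comp (I' := 𝓘(ℝ, E)) (by
      rw [Function.comp_apply, hbe]
      exact mdifferentiableAt_extChartAt' hb) (hpr.comp u hd),
    coordDeriv_comp hpr hd, Function.comp_apply, hbe] at h1
  refine ContinuousLinearMap.ext fun w => ?_
  have h2 := DFunLike.congr_fun h1 w
  change covCoord b (coordDeriv (cotModel E) 𝓘(ℝ, E) Bundle.TotalSpace.proj b
    (coordDeriv 𝓘(ℝ, E × (E →L[ℝ] ℝ)) (cotModel E) (extChartAt (cotModel E) a).symm u w)) = u.2 w.1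
  change chartDeriv 𝓘(ℝ, E) a.proj b.proj (coordDeriv (cotModel E) 𝓘(ℝ, E) Bundle.TotalSpace.proj b
    (coordDeriv 𝓘(ℝ, E × (E →L[ℝ] ℝ)) (cotModel E) (extChartAt (cotModel E) a).symm u w)) =
      w.1 at h2
  rw [← h2, ← hub]
  change _ = covCoord b (chartDerivSymm a.proj b.proj (chartDeriv 𝓘(ℝ, E) a.proj b.proj _))
  rw [chartDerivSymm_chartDeriv hb]

omit [FiniteDimensional ℝ E] in
/-- The canonical symplectic form in the preferred chart: `Ω = dq ∧ dp`. -/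
lemma canonicalTwoForm_apply (a : CotangentBundle 𝓘(ℝ, E) X) (v w : E × (E →L[ℝ] ℝ)) :
    canonicalTwoForm 𝓘(ℝ, E) X a v w = w.2 v.1 - v.2 w.1 := by
  let θ' : E × (E →L[ℝ] ℝ) → E × (E →L[ℝ] ℝ) →L[ℝ] ℝ := fun u =>
    (liouville 𝓘(ℝ, E) X ((extChartAt (cotModel E) a).symm u) : E × (E →L[ℝ] ℝ) →L[ℝ] ℝ) ∘L
      coordDeriv 𝓘(ℝ, E × (E →L[ℝ] ℝ)) (cotModel E) (extChartAt (cotModel E) a).symm u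
  have hI : IsManifold (cotModel E) 1 (CotangentBundle 𝓘(ℝ, E) X) :=
    IsManifold.of_le (n := ∞) (by simp)
  let L : E × (E →L[ℝ] ℝ) →L[ℝ] E × (E →L[ℝ] ℝ) →L[ℝ] ℝ :=
    (ContinuousLinearMap.compL ℝ (E × (E →L[ℝ] ℝ)) E ℝ).flip (ContinuousLinearMap.fst ℝ E _) ∘L
      ContinuousLinearMap.snd ℝ E (E →L[ℝ] ℝ)
  have hL : (fun u : E × (E →L[ℝ] ℝ) => u.2 ∘L ContinuousLinearMap.fst ℝ E (E →L[ℝ] ℝ)) = L := rfl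
  have h1 : fderiv ℝ θ' (extChartAt (cotModel E) a a) = L := by
    refine (liouville_coord_eventuallyEq a).fderiv_eq.trans ?_
    rw [hL]
    exact ContinuousLinearMap.fderiv (E := E × (E →L[ℝ] ℝ)) (F := E × (E →L[ℝ] ℝ) →L[ℝ] ℝ) L
  change -(fderiv ℝ θ' (extChartAt (cotModel E) a a) (chartDeriv (cotModel E) a a v)
    (chartDeriv (cotModel E) a a w) - fderiv ℝ θ' (extChartAt (cotModel E) a a)
    (chartDeriv (cotModel E) a a w) (chartDeriv (cotModel E) a a v)) = _
  rw [chartDeriv_self, h1]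
  change -(v.2 w.1 - w.2 v.1) = _
  ring

/-- The inverse of the canonical symplectic form is the canonical Poisson structure. -/
lemma isInverseOfTwoForm_canonicalTwoForm_iff
    (Λ : BivectorField (cotModel E) (CotangentBundle 𝓘(ℝ, E) X)) :
    IsInverseOfTwoForm (canonicalTwoForm 𝓘(ℝ, E) X) Λ ↔ Λ = canonicalPoisson X := by
  -- The sharp map inverts `v ↦ ι_v Ω` up to sign.
  have key : ∀ (a : CotangentBundle 𝓘(ℝ, E) X) (v : E × (E →L[ℝ] ℝ))
      (α : E × (E →L[ℝ] ℝ) →L[ℝ] ℝ), (∀ u, α u = canonicalTwoForm 𝓘(ℝ, E) X a v u) →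
      canonicalSharp E α = -v := by
    intro a v α hα
    rw [canonicalSharp_apply]
    refine Prod.ext ?_ (ContinuousLinearMap.ext fun w => ?_)
    · refine congrArg Neg.neg (bidualInv_eq fun p => ?_)
      refine (hα (0, p)).trans ?_
      rw [canonicalTwoForm_apply]
      simp
    · refine (hα (w, 0)).trans ?_
      rw [canonicalTwoForm_apply]
      simp
  have hinv : IsInverseOfTwoForm (canonicalTwoForm 𝓘(ℝ, E) X) (canonicalPoisson X) := by
    intro a
    refine ⟨fun (v : E × (E →L[ℝ] ℝ)) hv => ?_, fun (v w : E × (E →L[ℝ] ℝ))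
      (α β : E × (E →L[ℝ] ℝ) →L[ℝ] ℝ) hα hβ => ?_⟩
    · have h := key a v 0 (fun u => (hv u).symm)
      rw [map_zero] at h
      exact neg_eq_zero.1 h.symm
    · change β (canonicalSharp E α) = _
      rw [key a v α hα]
      refine (hβ _).trans ?_
      rw [canonicalTwoForm_apply]
      refine Eq.trans ?_ (canonicalTwoForm_apply a v w).symm
      simp only [Prod.snd_neg, Prod.fst_neg, map_neg, neg_apply]
      ring
  refine ⟨fun h => ?_, fun h => h ▸ hinv⟩
  refine BivectorField.ext (funext fun a => LinearMap.ext fun α => LinearMap.ext fun β => ?_)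
  have hex : ∀ α : E × (E →L[ℝ] ℝ) →L[ℝ] ℝ, ∀ u : E × (E →L[ℝ] ℝ),
      α u = canonicalTwoForm 𝓘(ℝ, E) X a (-canonicalSharp E α : E × (E →L[ℝ] ℝ)) u := by
    intro α u
    rw [canonicalTwoForm_apply, canonicalSharp_apply, clm_apply_prod]
    simp [apply_bidualInv]
    ring
  rw [(h a).2 _ _ α β (hex α) (hex β), (hinv a).2 _ _ α β (hex α) (hex β)]

end Cotangent

/-! ### The Poisson structure of a quotient of a cotangent bundle by `dp` -/

section EtaQuotient

variable (F : Type*) [NormedAddCommGroup F] [NormedSpace ℝ F]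

/-- The model space of the coordinates `(t, q, p)`. -/
abbrev EtaModel : Type _ := ℝ × (F × (F →L[ℝ] ℝ))

/-- `(t, q, p_t, p_q) ↦ (t, q, p_q)` as a linear map, see `covDrop`. -/
def covDropL : (ℝ × F) × ((ℝ × F) →L[ℝ] ℝ) →L[ℝ] ℝ × (F × (F →L[ℝ] ℝ)) :=
  (ContinuousLinearMap.fst ℝ ℝ F ∘L ContinuousLinearMap.fst ℝ (ℝ × F) ((ℝ × F) →L[ℝ] ℝ)).prod
    ((ContinuousLinearMap.snd ℝ ℝ F ∘L ContinuousLinearMap.fst ℝ (ℝ × F) ((ℝ × F) →L[ℝ] ℝ)).prod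
      ((ContinuousLinearMap.compL ℝ F (ℝ × F) ℝ).flip (ContinuousLinearMap.inr ℝ ℝ F) ∘L
        ContinuousLinearMap.snd ℝ (ℝ × F) ((ℝ × F) →L[ℝ] ℝ)))

variable [FiniteDimensional ℝ F]

/-- The sharp map of the Poisson structure `{q, p} = 1` on the space `ℝ × (F × F*)` of the `(t, q,
p)`. -/
def etaSharp : (ℝ × (F × (F →L[ℝ] ℝ)) →L[ℝ] ℝ) →L[ℝ] ℝ × (F × (F →L[ℝ] ℝ)) :=
  pushSharp (covDropL F) (canonicalSharp (ℝ × F))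

lemma isAltSharp_etaSharp : IsAltSharp (etaSharp F) := isAltSharp_canonicalSharp.push _

variable {F}

lemma etaSharp_apply (α : ℝ × (F × (F →L[ℝ] ℝ)) →L[ℝ] ℝ) :
    etaSharp F α = (0, canonicalSharp F (α ∘L ContinuousLinearMap.inr ℝ ℝ (F × (F →L[ℝ] ℝ)))) := by
  let b := bidualInv F ((α ∘L ContinuousLinearMap.inr ℝ ℝ (F × (F →L[ℝ] ℝ))) ∘L
    ContinuousLinearMap.inr ℝ F (F →L[ℝ] ℝ))
  have h : bidualInv (ℝ × F) ((α ∘L covDropL F) ∘L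
      ContinuousLinearMap.inr ℝ (ℝ × F) ((ℝ × F) →L[ℝ] ℝ)) = (0, b) := by
    refine bidualInv_eq fun r => ?_
    have h2 := apply_bidualInv ((α ∘L ContinuousLinearMap.inr ℝ ℝ (F × (F →L[ℝ] ℝ))) ∘L
      ContinuousLinearMap.inr ℝ F (F →L[ℝ] ℝ)) (r ∘L ContinuousLinearMap.inr ℝ ℝ F)
    exact h2.symm
  rw [etaSharp, pushSharp_apply, canonicalSharp_apply, h, canonicalSharp_apply]
  refine Prod.ext ?_ (Prod.ext rfl rfl)
  change -(0 : ℝ) = 0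
  exact neg_zero

/-- The kernel of the sharp map is spanned by `dt`. -/
lemma etaSharp_eq_zero_iff (α : ℝ × (F × (F →L[ℝ] ℝ)) →L[ℝ] ℝ) :
    etaSharp F α = 0 ↔ ∃ c : ℝ, α = c • ContinuousLinearMap.fst ℝ ℝ (F × (F →L[ℝ] ℝ)) := by
  rw [etaSharp_apply, canonicalSharp_apply]
  set γ := α ∘L ContinuousLinearMap.inr ℝ ℝ (F × (F →L[ℝ] ℝ)) with hγ
  constructor
  · intro h
    have h1 : bidualInv F (γ ∘L ContinuousLinearMap.inr ℝ F (F →L[ℝ] ℝ)) = 0 :=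
      neg_eq_zero.1 (congrArg (fun z => z.2.1) h)
    have h2 : γ ∘L ContinuousLinearMap.inl ℝ F (F →L[ℝ] ℝ) = 0 := congrArg (fun z => z.2.2) h
    have h3 : γ = 0 := by
      refine ContinuousLinearMap.ext fun z => ?_
      rw [clm_apply_prod, h2, ← apply_bidualInv, h1]
      simp
    refine ⟨α (1, 0), ContinuousLinearMap.ext fun z => ?_⟩
    rw [clm_apply_prod, ← hγ, h3]
    have h4 : ((z.1, 0) : ℝ × (F × (F →L[ℝ] ℝ))) = z.1 • ((1 : ℝ), 0) := by simp
    simp only [ContinuousLinearMap.comp_apply, ContinuousLinearMap.inl_apply, h4, map_smul]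
    simp [mul_comm]
  · rintro ⟨c, rfl⟩
    have h3 : γ = 0 := by
      refine ContinuousLinearMap.ext fun z => ?_
      simp [hγ]
    rw [h3]
    simp

variable {N : Type*} [TopologicalSpace N] [ChartedSpace (ℝ × F) N] {p : N → ℝ}
  [IsManifold 𝓘(ℝ, ℝ × F) ∞ N] [IsFibredAtlas F p]
  {Y : Type*} [TopologicalSpace Y] [ChartedSpace (ℝ × (F × (F →L[ℝ] ℝ))) Y]
  [IsManifold 𝓘(ℝ, ℝ × (F × (F →L[ℝ] ℝ))) ∞ Y]
  {f : CotangentBundle 𝓘(ℝ, ℝ × F) N → Y} (hf : IsEtaQuotient F p f)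

namespace IsEtaQuotient

omit [FiniteDimensional ℝ F] [IsFibredAtlas F p] [ChartedSpace (ℝ × (F × (F →L[ℝ] ℝ))) Y]
  [IsManifold 𝓘(ℝ, ℝ × (F × (F →L[ℝ] ℝ))) ∞ Y] in
lemma rep_proj (a : CotangentBundle 𝓘(ℝ, ℝ × F) N) : (hf.rep (f a)).proj = a.proj :=
  hf.proj_eq (hf.apply_rep (f a))

omit [FiniteDimensional ℝ F] in
lemma extChartAt_congr {a b : CotangentBundle 𝓘(ℝ, ℝ × F) N} (h : a.proj = b.proj) :
    (extChartAt (cotModel (ℝ × F)) a : _ → _) = extChartAt (cotModel (ℝ × F)) b := by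
  funext c
  rw [extChartAt_cotangent_apply, extChartAt_cotangent_apply, h]

omit [FiniteDimensional ℝ F] in
lemma chartDeriv_of_proj_eq {a b : CotangentBundle 𝓘(ℝ, ℝ × F) N} (h : a.proj = b.proj) :
    chartDeriv (cotModel (ℝ × F)) a b = ContinuousLinearMap.id ℝ _ := by
  have hI : IsManifold (cotModel (ℝ × F)) 1 (CotangentBundle 𝓘(ℝ, ℝ × F) N) :=
    IsManifold.of_le (n := ∞) (by simp)
  rw [← chartDeriv_self (I := cotModel (ℝ × F)) b, chartDeriv, chartDeriv, extChartAt_congr h]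

-- The preferred charts of `Y` are those induced by the charts of `T*N`.
variable (hY : ∀ y : Y, chartAt (EtaModel F) y = hf.chart (hf.rep y))

omit [FiniteDimensional ℝ F] [IsManifold 𝓘(ℝ, ℝ × (F × (F →L[ℝ] ℝ))) ∞ Y] in
include hY in
lemma extChartAt_apply {y₀ : Y} {a : CotangentBundle 𝓘(ℝ, ℝ × F) N}
    (ha : a.proj ∈ (chartAt (ℝ × F) (hf.rep y₀).proj).source) :
    extChartAt 𝓘(ℝ, EtaModel F) y₀ (f a) =
      covDropL F (extChartAt (cotModel (ℝ × F)) (hf.rep y₀) a) := by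
  have h := hf.chart_apply (hf.rep y₀) (mem_covChart_source.2 ha)
  rw [← hY] at h
  exact h

omit [FiniteDimensional ℝ F] [IsManifold 𝓘(ℝ, ℝ × (F × (F →L[ℝ] ℝ))) ∞ Y] in
include hY in
lemma mem_chartAt_source_iff {y₀ : Y} {a : CotangentBundle 𝓘(ℝ, ℝ × F) N} :
    f a ∈ (chartAt (EtaModel F) y₀).source ↔
      a.proj ∈ (chartAt (ℝ × F) (hf.rep y₀).proj).source := by
  rw [hY]
  exact mem_covChart_source.trans (by rw [hf.rep_proj])

omit [FiniteDimensional ℝ F] [IsManifold 𝓘(ℝ, ℝ × (F × (F →L[ℝ] ℝ))) ∞ Y] in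
include hY in
lemma extChartAt_comp_eventuallyEq {y₀ : Y} {a : CotangentBundle 𝓘(ℝ, ℝ × F) N}
    (ha : f a ∈ (chartAt (EtaModel F) y₀).source) :
    extChartAt 𝓘(ℝ, EtaModel F) y₀ ∘ f =ᶠ[𝓝 a]
      covDropL F ∘ extChartAt (cotModel (ℝ × F)) (hf.rep y₀) := by
  have h : f ⁻¹' (chartAt (EtaModel F) y₀).source ∈ 𝓝 a :=
    hf.isQuotientMap.continuous.continuousAt.preimage_mem_nhds
      ((chartAt (EtaModel F) y₀).open_source.mem_nhds ha)
  filter_upwards [h] with b hb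
  exact hf.extChartAt_apply hY ((hf.mem_chartAt_source_iff hY).1 hb)

omit [FiniteDimensional ℝ F] [IsManifold 𝓘(ℝ, ℝ × (F × (F →L[ℝ] ℝ))) ∞ Y] in
include hY in
lemma contMDiff : ContMDiff (cotModel (ℝ × F)) 𝓘(ℝ, EtaModel F) ∞ f := by
  intro a
  rw [contMDiffAt_iff_target]
  refine ⟨hf.isQuotientMap.continuous.continuousAt, ?_⟩
  refine ContMDiffAt.congr_of_eventuallyEq ?_
    (hf.extChartAt_comp_eventuallyEq hY (mem_chart_source _ (f a)))
  refine (covDropL F).contDiff.contMDiff.contMDiffAt.comp a (contMDiffAt_extChartAt' ?_)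
  rw [← extChartAt_source (cotModel (ℝ × F)), extChartAt_cotangent_source, mem_ofPred_eq,
    hf.rep_proj]
  exact mem_chart_source _ _

omit [FiniteDimensional ℝ F] in
include hY in
/-- In any charts, the quotient map is `(t, q, p_t, p_q) ↦ (t, q, p_q)`. -/
lemma chartDeriv_comp_coordDeriv {y₀ : Y} {a : CotangentBundle 𝓘(ℝ, ℝ × F) N}
    (ha : f a ∈ (chartAt (EtaModel F) y₀).source) :
    chartDeriv 𝓘(ℝ, EtaModel F) y₀ (f a) ∘L coordDeriv (cotModel (ℝ × F)) 𝓘(ℝ, EtaModel F) f a =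
      covDropL F ∘L chartDeriv (cotModel (ℝ × F)) (hf.rep y₀) a := by
  have hm : a ∈ (chartAt (ModelProd (ℝ × F) ((ℝ × F) →L[ℝ] ℝ)) (hf.rep y₀)).source :=
    mem_covChart_source.2 ((hf.mem_chartAt_source_iff hY).1 ha)
  have hI : IsManifold (cotModel (ℝ × F)) 1 (CotangentBundle 𝓘(ℝ, ℝ × F) N) :=
    IsManifold.of_le (n := ∞) (by simp)
  rw [chartDeriv, ← coordDeriv_comp (mdifferentiableAt_extChartAt' ha)
    ((hf.contMDiff hY).mdifferentiableAt (by simp))]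
  refine ((hf.extChartAt_comp_eventuallyEq hY ha).mfderiv_eq).trans ?_
  have h := coordDeriv_comp (I := cotModel (ℝ × F)) (I' := 𝓘(ℝ, (ℝ × F) × ((ℝ × F) →L[ℝ] ℝ)))
    (I'' := 𝓘(ℝ, EtaModel F)) (covDropL F).differentiableAt.mdifferentiableAt
    (mdifferentiableAt_extChartAt (I := cotModel (ℝ × F)) hm)
  refine h.trans ?_
  rw [coordDeriv, mfderiv_eq_fderiv, ContinuousLinearMap.fderiv]
  rfl

omit [FiniteDimensional ℝ F] in
include hY in
/-- In the preferred charts, the derivative of the quotient map is `(t, q, p_t, p_q) ↦ (t, q, p_q)`.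
The preferred charts at `a` and at the representative of `f a` agree as the base points are equal.
-/
lemma coordDeriv_eq (a : CotangentBundle 𝓘(ℝ, ℝ × F) N) :
    coordDeriv (cotModel (ℝ × F)) 𝓘(ℝ, EtaModel F) f a = covDropL F := by
  have hI : IsManifold 𝓘(ℝ, EtaModel F) 1 Y := IsManifold.of_le (n := ∞) (by simp)
  have h := hf.chartDeriv_comp_coordDeriv hY (mem_chart_source (EtaModel F) (f a))
  rwa [chartDeriv_self, chartDeriv_of_proj_eq (hf.rep_proj a), ContinuousLinearMap.id_comp,
    ContinuousLinearMap.comp_id] at h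

include hf hY in
/-- Invariance descends from `T*N`, since the quotient map is the linear map `covDropL` in all
charts. -/
lemma isChartInvariant_etaSharp : IsChartInvariant 𝓘(ℝ, EtaModel F) Y (etaSharp F) := by
  intro y₀ y hy
  obtain ⟨a, rfl⟩ := hf.isQuotientMap.surjective y
  refine SharpRel.of_comp (T := coordDeriv (cotModel (ℝ × F)) 𝓘(ℝ, EtaModel F) f a)
    (P := canonicalSharp (ℝ × F)) ?_ ?_
  · rw [hf.chartDeriv_comp_coordDeriv hY hy]
    exact (sharpRel_pushSharp (covDropL F) _).comp (isChartInvariant_canonicalSharp N _ _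
      (mem_covChart_source.2 ((hf.mem_chartAt_source_iff hY).1 hy)))
  · rw [hf.coordDeriv_eq hY]
    exact sharpRel_pushSharp (covDropL F) _

/-- The Poisson structure `{q, p} = 1` of the quotient. -/
def poisson : BivectorField 𝓘(ℝ, EtaModel F) Y :=
  constBivector _ _ (etaSharp F) (isAltSharp_etaSharp F) (hf.isChartInvariant_etaSharp hY)

lemma poisson_hasCorank_one : (hf.poisson hY).HasCorank 1 := by
  refine constBivector_hasCorank_one (ContinuousLinearMap.fst ℝ ℝ (F × (F →L[ℝ] ℝ))) ?_
    etaSharp_eq_zero_iff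
  intro h
  simpa using DFunLike.congr_fun h ((1 : ℝ), 0)

lemma isPoissonMap : IsPoissonMap f (canonicalPoisson N) (hf.poisson hY) := by
  refine constBivector_isPoissonMap (hf.contMDiff hY) fun a => ?_
  rw [hf.coordDeriv_eq hY]
  exact sharpRel_pushSharp (covDropL F) _

/-- As the quotient map is surjective, a 2-vector on the quotient is determined by that of `T*N`. -/
lemma isPoissonMap_iff (Λ : BivectorField 𝓘(ℝ, EtaModel F) Y) :
    IsPoissonMap f (canonicalPoisson N) Λ ↔ Λ = hf.poisson hY := by
  refine ⟨fun h => ?_, fun h => h ▸ hf.isPoissonMap hY⟩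
  refine BivectorField.ext (funext fun y => ?_)
  obtain ⟨a, rfl⟩ := hf.isQuotientMap.surjective y
  refine LinearMap.ext fun α => LinearMap.ext fun β => ?_
  rw [h.2, (hf.isPoissonMap hY).2]

omit [FiniteDimensional ℝ F] [IsManifold 𝓘(ℝ, ℝ × (F × (F →L[ℝ] ℝ))) ∞ Y] in
include hY in
/-- The quotient map has local smooth sections `(t, q, p) ↦ (t, q, p_t = 0, p)`. -/
lemma exists_local_section (y : Y) :
    ∃ s : Y → CotangentBundle 𝓘(ℝ, ℝ × F) N,
      ContMDiffAt 𝓘(ℝ, EtaModel F) (cotModel (ℝ × F)) ∞ s y ∧ ∀ᶠ z in 𝓝 y, f (s z) = z := by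
  refine ⟨fun z => (extChartAt (cotModel (ℝ × F)) (hf.rep y)).symm
    (covLift F (extChartAt 𝓘(ℝ, EtaModel F) y z)), ?_, ?_⟩
  · have h1 : covLift F (extChartAt 𝓘(ℝ, EtaModel F) y y) ∈
        (extChartAt (cotModel (ℝ × F)) (hf.rep y)).target := by
      have h := (chartAt (EtaModel F) y).map_source (mem_chart_source (EtaModel F) y)
      rw [hY] at h
      rw [extChartAt_target]
      refine ⟨?_, by simp⟩
      rw [extChartAt, hY]
      exact h
    exact ((contMDiffOn_extChartAt_symm (hf.rep y)).contMDiffAt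
      ((isOpen_extChartAt_target _).mem_nhds h1)).comp y
      ((contDiff_covLift F).contMDiff.contMDiffAt.comp y contMDiffAt_extChartAt)
  · filter_upwards [(chartAt (EtaModel F) y).open_source.mem_nhds (mem_chart_source _ y)] with z hz
    have h := (chartAt (EtaModel F) y).left_inv hz
    have hc : extChartAt 𝓘(ℝ, EtaModel F) y z = hf.chart (hf.rep y) z := by rw [← hY]; rfl
    rw [hY] at h
    rw [hc]
    exact h

omit [FiniteDimensional ℝ F] [IsManifold 𝓘(ℝ, ℝ × (F × (F →L[ℝ] ℝ))) ∞ Y] in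
include hY in
/-- A function on the quotient is differentiable if its pull-back is. -/
lemma mdifferentiableAt_of_comp {G : Y → ℝ} {y : Y}
    (hG : ∀ a, f a = y → MDifferentiableAt (cotModel (ℝ × F)) 𝓘(ℝ, ℝ) (G ∘ f) a) :
    MDifferentiableAt 𝓘(ℝ, EtaModel F) 𝓘(ℝ, ℝ) G y := by
  obtain ⟨s, hs, hfs⟩ := hf.exists_local_section hY y
  have h := (hG (s y) hfs.self_of_nhds).comp y (hs.mdifferentiableAt (by simp))
  refine h.congr_of_eventuallyEq ?_
  filter_upwards [hfs] with z hz
  simp only [Function.comp_apply, hz]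

end IsEtaQuotient

end EtaQuotient

/-! ### Brackets of basic and fibrewise linear functions -/

section FiberLinear

variable {E : Type*} [NormedAddCommGroup E] [NormedSpace ℝ E]
  {X : Type*} [TopologicalSpace X] [ChartedSpace E X] [IsManifold 𝓘(ℝ, E) ∞ X]

/-- The expression of a vector field in the preferred chart at `x`. -/
def localField (x : X) (V : ∀ y : X, TangentSpace 𝓘(ℝ, E) y) (u : E) : E :=
  chartDeriv 𝓘(ℝ, E) x ((extChartAt 𝓘(ℝ, E) x).symm u) (V ((extChartAt 𝓘(ℝ, E) x).symm u))

lemma localField_self (x : X) (V : ∀ y : X, TangentSpace 𝓘(ℝ, E) y) :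
    localField x V (extChartAt 𝓘(ℝ, E) x x) = V x := by
  have : IsManifold 𝓘(ℝ, E) 1 X := IsManifold.of_le (n := ∞) (by simp)
  rw [localField, extChartAt_to_inv, chartDeriv_self]
  rfl

lemma differentiableAt_localField {x : X} {V : ∀ y : X, TangentSpace 𝓘(ℝ, E) y}
    (hV : ContMDiffAt 𝓘(ℝ, E) 𝓘(ℝ, E).tangent ∞
      (fun y => (⟨y, V y⟩ : TangentBundle 𝓘(ℝ, E) X)) x) :
    DifferentiableAt ℝ (localField x V) (extChartAt 𝓘(ℝ, E) x x) := by
  have h1 : ContMDiffAt 𝓘(ℝ, E) 𝓘(ℝ, E × E) ∞ (fun y =>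
      extChartAt 𝓘(ℝ, E).tangent (⟨x, V x⟩ : TangentBundle 𝓘(ℝ, E) X) ⟨y, V y⟩) x :=
    (contMDiffAt_extChartAt (I := 𝓘(ℝ, E).tangent)
      (x := (⟨x, V x⟩ : TangentBundle 𝓘(ℝ, E) X))).comp x hV
  have h2 : ContMDiffAt 𝓘(ℝ, E) 𝓘(ℝ, E) ∞ (extChartAt 𝓘(ℝ, E) x).symm (extChartAt 𝓘(ℝ, E) x x) :=
    (contMDiffOn_extChartAt_symm x).contMDiffAt (extChartAt_target_mem_nhds x)
  have h3 := (contDiff_snd (𝕜 := ℝ) (E := E) (F := E)).contMDiff.contMDiffAt.comp_of_eq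
    (ContMDiffAt.comp_of_eq h1 h2 (extChartAt_to_inv x)) rfl (n := ∞)
  refine (h3.contDiffAt.differentiableAt (by simp)).congr_of_eventuallyEq ?_
  filter_upwards [extChartAt_target_mem_nhds (I := 𝓘(ℝ, E)) x] with u hu
  have hb := (extChartAt 𝓘(ℝ, E) x).map_target hu
  rw [extChartAt_source] at hb
  have h4 := extChartAt_tangent_apply (⟨x, V x⟩ : TangentBundle 𝓘(ℝ, E) X)
    ⟨(extChartAt 𝓘(ℝ, E) x).symm u, V _⟩ hb
  exact (congrArg Prod.snd h4).symm

/-- The Lie bracket at `x` in the preferred chart at `x`. -/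
lemma mlieBracket_eq_lieBracket_localField (x : X) (V W : ∀ y : X, TangentSpace 𝓘(ℝ, E) y) :
    VectorField.mlieBracket 𝓘(ℝ, E) V W x =
      VectorField.lieBracket ℝ (localField x V) (localField x W) (extChartAt 𝓘(ℝ, E) x x) := by
  have hI : IsManifold 𝓘(ℝ, E) 1 X := IsManifold.of_le (n := ∞) (by simp)
  have key : ∀ V : ∀ y : X, TangentSpace 𝓘(ℝ, E) y,
      (VectorField.mpullbackWithin 𝓘(ℝ, E) 𝓘(ℝ, E) (extChartAt 𝓘(ℝ, E) x).symm V
        (range 𝓘(ℝ, E)) : E → E) =ᶠ[𝓝 (extChartAt 𝓘(ℝ, E) x x)] localField x V := by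
    intro V
    filter_upwards [extChartAt_target_mem_nhds (I := 𝓘(ℝ, E)) x] with u hu
    have h := ContinuousLinearMap.inverse_eq
      (mfderivWithin_extChartAt_symm_comp_mfderiv_extChartAt (I := 𝓘(ℝ, E)) hu)
      (mfderiv_extChartAt_comp_mfderivWithin_extChartAt_symm hu)
    exact congrArg (fun A : TangentSpace 𝓘(ℝ, E) ((extChartAt 𝓘(ℝ, E) x).symm u) →L[ℝ] E =>
      A (V ((extChartAt 𝓘(ℝ, E) x).symm u))) h
  rw [VectorField.mlieBracket, VectorField.mlieBracketWithin_apply, preimage_univ, univ_inter]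
  change (chartDeriv 𝓘(ℝ, E) x x).inverse _ = _
  rw [chartDeriv_self, ContinuousLinearMap.inverse_id]
  refine (Filter.EventuallyEq.lieBracketWithin_vectorField_eq_of_mem (s := range 𝓘(ℝ, E))
    ((key V).filter_mono nhdsWithin_le_nhds) ((key W).filter_mono nhdsWithin_le_nhds)
    (by simp)).trans ?_
  rw [ModelWithCorners.range_eq_univ, VectorField.lieBracketWithin_univ]

/-- The function `b ↦ b(V)` on the cotangent bundle. -/
def fiberLinear (V : ∀ y : X, TangentSpace 𝓘(ℝ, E) y) (b : CotangentBundle 𝓘(ℝ, E) X) : ℝ :=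
  b.snd (V b.proj)

/-- In the preferred charts at `a`, the function `b ↦ b(V)` is `(q, p) ↦ p(V(q))`. -/
lemma fiberLinear_comp_eventuallyEq (V : ∀ y : X, TangentSpace 𝓘(ℝ, E) y)
    (a : CotangentBundle 𝓘(ℝ, E) X) :
    fiberLinear V ∘ (extChartAt (cotModel E) a).symm =ᶠ[𝓝 (extChartAt (cotModel E) a a)]
      fun z : E × (E →L[ℝ] ℝ) => z.2 (localField a.proj V z.1) := by
  filter_upwards [extChartAt_target_mem_nhds (I := cotModel E) a] with z hz
  have hb := (extChartAt (cotModel E) a).map_target hz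
  have hz2 := (extChartAt (cotModel E) a).right_inv hz
  rw [Function.comp_apply]
  generalize (extChartAt (cotModel E) a).symm z = b at *
  rw [extChartAt_cotangent_source] at hb
  rw [← hz2, extChartAt_cotangent_apply]
  have h : (extChartAt 𝓘(ℝ, E) a.proj).symm (extChartAt 𝓘(ℝ, E) a.proj b.proj) = b.proj :=
    (extChartAt 𝓘(ℝ, E) a.proj).left_inv (by rw [extChartAt_source]; exact hb)
  change covCoord b (V b.proj) =
    covCoord b (chartDerivSymm a.proj b.proj (localField a.proj V _))
  rw [localField, h]
  exact congrArg (covCoord b) (chartDerivSymm_chartDeriv hb _).symm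

lemma hasFDerivAt_fiberLinear_coord {V : ∀ y : X, TangentSpace 𝓘(ℝ, E) y}
    {a : CotangentBundle 𝓘(ℝ, E) X}
    (hV : ContMDiffAt 𝓘(ℝ, E) 𝓘(ℝ, E).tangent ∞
      (fun y => (⟨y, V y⟩ : TangentBundle 𝓘(ℝ, E) X)) a.proj) :
    HasFDerivAt (fiberLinear V ∘ (extChartAt (cotModel E) a).symm)
      ((covCoord a ∘L fderiv ℝ (localField a.proj V) (extChartAt 𝓘(ℝ, E) a.proj a.proj)).coprod
        (ContinuousLinearMap.apply ℝ ℝ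
          (localField a.proj V (extChartAt 𝓘(ℝ, E) a.proj a.proj))))
      (extChartAt (cotModel E) a a) := by
  let z : E × (E →L[ℝ] ℝ) := (extChartAt 𝓘(ℝ, E) a.proj a.proj, covCoord a)
  have h1 : HasFDerivAt (localField a.proj V) _ z.1 :=
    (differentiableAt_localField hV).hasFDerivAt
  have h2 := (hasFDerivAt_snd (E := E) (F := E →L[ℝ] ℝ) (p := z)).clm_apply
    (h1.comp z hasFDerivAt_fst)
  rw [extChartAt_cotangent_self]
  have h3 := fiberLinear_comp_eventuallyEq V a
  rw [extChartAt_cotangent_self] at h3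
  refine HasFDerivAt.congr_of_eventuallyEq (h2.congr_fderiv ?_) h3
  refine ContinuousLinearMap.ext fun δ => ?_
  rfl

lemma mdifferentiableAt_fiberLinear {V : ∀ y : X, TangentSpace 𝓘(ℝ, E) y}
    {a : CotangentBundle 𝓘(ℝ, E) X}
    (hV : ContMDiffAt 𝓘(ℝ, E) 𝓘(ℝ, E).tangent ∞
      (fun y => (⟨y, V y⟩ : TangentBundle 𝓘(ℝ, E) X)) a.proj) :
    MDifferentiableAt (cotModel E) 𝓘(ℝ, ℝ) (fiberLinear V) a := by
  have hI : IsManifold (cotModel E) 1 (CotangentBundle 𝓘(ℝ, E) X) :=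
    IsManifold.of_le (n := ∞) (by simp)
  have h1 := (hasFDerivAt_fiberLinear_coord hV).differentiableAt.mdifferentiableAt.comp a
    (mdifferentiableAt_extChartAt (I := cotModel E) (mem_chart_source _ a))
  refine h1.congr_of_eventuallyEq ?_
  filter_upwards [extChartAt_source_mem_nhds (I := cotModel E) a] with b hb
  simp only [Function.comp_apply, (extChartAt (cotModel E) a).left_inv hb]

/-- In the preferred chart at `a`, `d(p V(q)) = p(DV dq) + dp(V)`. -/
lemma coordDeriv_fiberLinear {V : ∀ y : X, TangentSpace 𝓘(ℝ, E) y}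
    {a : CotangentBundle 𝓘(ℝ, E) X}
    (hV : ContMDiffAt 𝓘(ℝ, E) 𝓘(ℝ, E).tangent ∞
      (fun y => (⟨y, V y⟩ : TangentBundle 𝓘(ℝ, E) X)) a.proj) :
    coordDeriv (cotModel E) 𝓘(ℝ, ℝ) (fiberLinear V) a =
      (covCoord a ∘L fderiv ℝ (localField a.proj V) (extChartAt 𝓘(ℝ, E) a.proj a.proj)).coprod
        (ContinuousLinearMap.apply ℝ ℝ
          (localField a.proj V (extChartAt 𝓘(ℝ, E) a.proj a.proj))) := by
  have hI : IsManifold (cotModel E) 1 (CotangentBundle 𝓘(ℝ, E) X) :=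
    IsManifold.of_le (n := ∞) (by simp)
  rw [coordDeriv_eq_fderiv_comp (mem_chart_source _ a) (mdifferentiableAt_fiberLinear hV),
    chartDeriv_self, (hasFDerivAt_fiberLinear_coord hV).fderiv]
  rfl

lemma coordDeriv_cotangent_proj (a : CotangentBundle 𝓘(ℝ, E) X) :
    coordDeriv (cotModel E) 𝓘(ℝ, E) (Bundle.TotalSpace.proj : CotangentBundle 𝓘(ℝ, E) X → X) a =
      ContinuousLinearMap.fst ℝ E (E →L[ℝ] ℝ) := by
  have hI : IsManifold (cotModel E) 1 (CotangentBundle 𝓘(ℝ, E) X) :=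
    IsManifold.of_le (n := ∞) (by simp)
  have hI' : IsManifold 𝓘(ℝ, E) 1 X := IsManifold.of_le (n := ∞) (by simp)
  have h1 := coordDeriv_comp (mdifferentiableAt_extChartAt' (X := X) (mem_chart_source E a.proj))
    (mdifferentiableAt_cotangent_proj a)
  have h2 : extChartAt 𝓘(ℝ, E) a.proj ∘ (Bundle.TotalSpace.proj : CotangentBundle 𝓘(ℝ, E) X → X) =
      Prod.fst ∘ extChartAt (cotModel E) a := by
    funext b
    rw [Function.comp_apply, Function.comp_apply, extChartAt_cotangent_apply]
  have h3 := coordDeriv_comp (I := cotModel E) (I' := 𝓘(ℝ, E × (E →L[ℝ] ℝ))) (I'' := 𝓘(ℝ, E))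
    (x := a) (ψ := (Prod.fst : E × (E →L[ℝ] ℝ) → E)) differentiableAt_fst.mdifferentiableAt
    (mdifferentiableAt_extChartAt (mem_chart_source _ a))
  change _ = _ ∘L chartDeriv (cotModel E) a a at h3
  change _ = chartDeriv 𝓘(ℝ, E) a.proj a.proj ∘L _ at h1
  rw [chartDeriv_self] at h1 h3
  rw [h2] at h1
  refine h1.symm.trans (h3.trans ?_)
  rw [coordDeriv, mfderiv_eq_fderiv]
  exact fderiv_fst

lemma coordDeriv_comp_cotangent_proj {f : X → ℝ} {a : CotangentBundle 𝓘(ℝ, E) X}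
    (hf : MDifferentiableAt 𝓘(ℝ, E) 𝓘(ℝ, ℝ) f a.proj) :
    coordDeriv (cotModel E) 𝓘(ℝ, ℝ) (fun b : CotangentBundle 𝓘(ℝ, E) X => f b.proj) a =
      coordDeriv 𝓘(ℝ, E) 𝓘(ℝ, ℝ) f a.proj ∘L ContinuousLinearMap.fst ℝ E (E →L[ℝ] ℝ) := by
  rw [← coordDeriv_cotangent_proj a]
  exact coordDeriv_comp hf (mdifferentiableAt_cotangent_proj a)

end FiberLinear

/-! ### The canonical Poisson structure of the dual of the vertical bundle -/

section CanonicalVerticalDual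

lemma IsPoissonMap.bracket_comp {E : Type*} [NormedAddCommGroup E] [NormedSpace ℝ E]
    {H : Type*} [TopologicalSpace H] {I : ModelWithCorners ℝ E H}
    {X : Type*} [TopologicalSpace X] [ChartedSpace H X]
    {E' : Type*} [NormedAddCommGroup E'] [NormedSpace ℝ E']
    {H' : Type*} [TopologicalSpace H'] {I' : ModelWithCorners ℝ E' H'}
    {Y : Type*} [TopologicalSpace Y] [ChartedSpace H' Y]
    {φ : X → Y} {Λ : BivectorField I X} {Λ' : BivectorField I' Y} (h : IsPoissonMap φ Λ Λ')
    {f g : Y → ℝ} {x : X} (hf : MDifferentiableAt I' 𝓘(ℝ, ℝ) f (φ x))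
    (hg : MDifferentiableAt I' 𝓘(ℝ, ℝ) g (φ x)) :
    Λ'.bracket f g (φ x) = Λ.bracket (f ∘ φ) (g ∘ φ) x := by
  have hφ := (h.1 x).mdifferentiableAt (by simp)
  refine (h.2 x _ _).trans ?_
  rw [BivectorField.bracket, mvfderiv_comp x hf hφ, mvfderiv_comp x hg hφ]

lemma BivectorField.swap {E : Type*} [NormedAddCommGroup E] [NormedSpace ℝ E]
    {H : Type*} [TopologicalSpace H] {I : ModelWithCorners ℝ E H}
    {X : Type*} [TopologicalSpace X] [ChartedSpace H X] (Λ : BivectorField I X) (x : X)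
    (α β : CotangentSpace I x) : Λ.toFun x α β = -Λ.toFun x β α := by
  have h := Λ.self_eq_zero x (α + β)
  simp only [map_add, LinearMap.add_apply, Λ.self_eq_zero] at h
  linarith

section CotangentBrackets

variable {E : Type*} [NormedAddCommGroup E] [NormedSpace ℝ E] [FiniteDimensional ℝ E]
  {X : Type*} [TopologicalSpace X] [ChartedSpace E X] [IsManifold 𝓘(ℝ, E) ∞ X]
  {V W : ∀ y : X, TangentSpace 𝓘(ℝ, E) y} {a : CotangentBundle 𝓘(ℝ, E) X} {f g : X → ℝ}

lemma canonicalSharp_comp_fst (ℓ : E →L[ℝ] ℝ) :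
    canonicalSharp E (ℓ ∘L ContinuousLinearMap.fst ℝ E (E →L[ℝ] ℝ)) = (0, ℓ) := by
  rw [canonicalSharp_apply, bidualInv_eq (e := 0) (fun r => by simp)]
  exact Prod.ext (by simp) (ContinuousLinearMap.ext fun w => by simp)

lemma canonicalPoisson_bracket_fiberLinear
    (hV : ContMDiffAt 𝓘(ℝ, E) 𝓘(ℝ, E).tangent ∞
      (fun y => (⟨y, V y⟩ : TangentBundle 𝓘(ℝ, E) X)) a.proj)
    (hW : ContMDiffAt 𝓘(ℝ, E) 𝓘(ℝ, E).tangent ∞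
      (fun y => (⟨y, W y⟩ : TangentBundle 𝓘(ℝ, E) X)) a.proj) :
    (canonicalPoisson X).bracket (fiberLinear V) (fiberLinear W) a =
      -a.snd (VectorField.mlieBracket 𝓘(ℝ, E) V W a.proj) := by
  refine (constBivector_bracket _ _ _).trans ?_
  rw [coordDeriv_fiberLinear hV, coordDeriv_fiberLinear hW, canonicalSharp_apply,
    bidualInv_eq (e := localField a.proj V (extChartAt 𝓘(ℝ, E) a.proj a.proj)) (fun r => by simp),
    mlieBracket_eq_lieBracket_localField]
  change _ = -covCoord a (VectorField.lieBracket ℝ _ _ _)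
  rw [VectorField.lieBracket_eq]
  simp
  ring

lemma canonicalPoisson_bracket_basic_fiberLinear (hf : MDifferentiableAt 𝓘(ℝ, E) 𝓘(ℝ, ℝ) f a.proj)
    (hW : ContMDiffAt 𝓘(ℝ, E) 𝓘(ℝ, E).tangent ∞
      (fun y => (⟨y, W y⟩ : TangentBundle 𝓘(ℝ, E) X)) a.proj) :
    (canonicalPoisson X).bracket (fun b => f b.proj) (fiberLinear W) a =
      mvfderiv 𝓘(ℝ, E) f a.proj (W a.proj) := by
  refine (constBivector_bracket _ _ _).trans ?_
  rw [coordDeriv_comp_cotangent_proj hf, coordDeriv_fiberLinear hW, canonicalSharp_comp_fst]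
  have h := localField_self a.proj W
  change _ = coordDeriv 𝓘(ℝ, E) 𝓘(ℝ, ℝ) f a.proj _
  rw [← h]
  simp

lemma canonicalPoisson_bracket_basic (hf : MDifferentiableAt 𝓘(ℝ, E) 𝓘(ℝ, ℝ) f a.proj)
    (hg : MDifferentiableAt 𝓘(ℝ, E) 𝓘(ℝ, ℝ) g a.proj) :
    (canonicalPoisson X).bracket (fun b => f b.proj) (fun b => g b.proj) a = 0 := by
  refine (constBivector_bracket _ _ _).trans ?_
  rw [coordDeriv_comp_cotangent_proj hf, coordDeriv_comp_cotangent_proj hg, canonicalSharp_comp_fst]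
  simp

end CotangentBrackets

variable {F : Type*} [NormedAddCommGroup F] [NormedSpace ℝ F]
  {N : Type*} [TopologicalSpace N] [ChartedSpace (ℝ × F) N] {p : N → ℝ}
  [IsManifold 𝓘(ℝ, ℝ × F) ∞ N] [IsFibredAtlas F p]

variable (p) in
/-- The vertical vector field which in the preferred chart at `x` is constant with value `(0, e)`,
extended by zero outside this chart. -/
def coordField (x : N) (e : F) (y : N) : (mvfderiv 𝓘(ℝ, ℝ × F) p y).ker :=
  ⟨(trivializationAt (ℝ × F) (TangentSpace 𝓘(ℝ, ℝ × F)) x).symmL ℝ y (0, e), by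
    by_cases hy : y ∈ (chartAt (ℝ × F) x).source
    · exact DFunLike.congr_fun (mvfderiv_comp_symmL (p := p) hy) (0, e)
    · have h : (trivializationAt (ℝ × F) (TangentSpace 𝓘(ℝ, ℝ × F)) x).symmL ℝ y (0, e) = 0 :=
        (trivializationAt (ℝ × F) (TangentSpace 𝓘(ℝ, ℝ × F)) x).symmL_apply_of_notMem hy _
      rw [h]
      exact map_zero _⟩

lemma contMDiffOn_coordField (x : N) (e : F) :
    ContMDiffOn 𝓘(ℝ, ℝ × F) 𝓘(ℝ, ℝ × F).tangent ∞
      (fun y => (⟨y, (coordField p x e y : TangentSpace 𝓘(ℝ, ℝ × F) y)⟩ :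
        TangentBundle 𝓘(ℝ, ℝ × F) N)) (chartAt (ℝ × F) x).source := by
  let t := trivializationAt (ℝ × F) (TangentSpace 𝓘(ℝ, ℝ × F) : N → Type _) x
  have h1 := t.contMDiffOn_symm (IB := 𝓘(ℝ, ℝ × F)) (n := ∞)
  have h2 : ContMDiffOn 𝓘(ℝ, ℝ × F) (𝓘(ℝ, ℝ × F).prod 𝓘(ℝ, ℝ × F)) ∞
      (fun y : N => (y, ((0, e) : ℝ × F))) (chartAt (ℝ × F) x).source :=
    contMDiffOn_id.prodMk contMDiffOn_const
  refine (h1.comp h2 fun y hy => ?_).congr fun y hy => ?_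
  · rw [t.target_eq]
    exact ⟨hy, mem_univ _⟩
  · exact (congrArg (Bundle.TotalSpace.mk y) (t.symmL_apply hy _)).trans (t.mk_symm hy _)

/-- The coordinate field is constant in the chart that defines it. -/
lemma localField_coordField_eventuallyEq (x : N) (e : F) :
    localField x (fun y => (coordField p x e y : TangentSpace 𝓘(ℝ, ℝ × F) y)) =ᶠ[
      𝓝 (extChartAt 𝓘(ℝ, ℝ × F) x x)] fun _ => (0, e) := by
  filter_upwards [extChartAt_target_mem_nhds (I := 𝓘(ℝ, ℝ × F)) x] with u hu
  have hb := (extChartAt 𝓘(ℝ, ℝ × F) x).map_target hu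
  rw [extChartAt_source] at hb
  exact chartDeriv_chartDerivSymm hb _

/-- The canonical Poisson structure of the dual of the vertical bundle, obtained from that of `T*N`
by the restriction `μ` of covectors. -/
def verticalDualPoisson [FiniteDimensional ℝ F] :
    BivectorField 𝓘(ℝ, ℝ × (F × (F →L[ℝ] ℝ))) (VerticalDual F p) :=
  (VerticalDual.isEtaQuotient F p).poisson (fun _ => rfl)

variable {X : ∀ x : N, (mvfderiv 𝓘(ℝ, ℝ × F) p x).ker} {U : Set N}

lemma mdifferentiableAt_linearFun (hU : IsOpen U)
    (hX : ContMDiffOn 𝓘(ℝ, ℝ × F) 𝓘(ℝ, ℝ × F).tangent ∞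
      (fun x => (⟨x, (X x : TangentSpace 𝓘(ℝ, ℝ × F) x)⟩ : TangentBundle 𝓘(ℝ, ℝ × F) N)) U)
    {β : VerticalDual F p} (hβ : β.proj ∈ U) :
    MDifferentiableAt 𝓘(ℝ, ℝ × (F × (F →L[ℝ] ℝ))) 𝓘(ℝ, ℝ) (VerticalDual.linearFun X) β := by
  refine (VerticalDual.isEtaQuotient F p).mdifferentiableAt_of_comp (fun _ => rfl) ?_
  rintro a rfl
  exact mdifferentiableAt_fiberLinear (V := fun x => (X x : TangentSpace 𝓘(ℝ, ℝ × F) x))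
    (hX.contMDiffAt (hU.mem_nhds hβ))

lemma mdifferentiableAt_comp_proj (hU : IsOpen U) {f : N → ℝ}
    (hf : ContMDiffOn 𝓘(ℝ, ℝ × F) 𝓘(ℝ, ℝ) ∞ f U) {β : VerticalDual F p} (hβ : β.proj ∈ U) :
    MDifferentiableAt 𝓘(ℝ, ℝ × (F × (F →L[ℝ] ℝ))) 𝓘(ℝ, ℝ)
      (fun β : VerticalDual F p => f β.proj) β := by
  refine (VerticalDual.isEtaQuotient F p).mdifferentiableAt_of_comp (fun _ => rfl) ?_
  rintro a rfl
  exact MDifferentiableAt.comp (g := f) (f := Bundle.TotalSpace.proj) a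
    ((hf.contMDiffAt (hU.mem_nhds hβ)).mdifferentiableAt (by simp))
    (mdifferentiableAt_cotangent_proj a)

variable [FiniteDimensional ℝ F]

/-- The characterizing brackets are those of the corresponding functions on `T*N`, since `μ` is a
Poisson map. -/
lemma isCanonicalVerticalDual_verticalDualPoisson :
    IsCanonicalVerticalDual F p verticalDualPoisson := by
  intro U f g X Y hU hf hg hX hY a ha
  have hP := (VerticalDual.isEtaQuotient F p).isPoissonMap (fun _ => rfl)
  have hXa := hX.contMDiffAt (hU.mem_nhds ha)
  have hYa := hY.contMDiffAt (hU.mem_nhds ha)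
  have hfa := (hf.contMDiffAt (hU.mem_nhds ha)).mdifferentiableAt (by simp)
  have hga := (hg.contMDiffAt (hU.mem_nhds ha)).mdifferentiableAt (by simp)
  have h1 := canonicalPoisson_bracket_fiberLinear
    (V := fun x => (X x : TangentSpace 𝓘(ℝ, ℝ × F) x))
    (W := fun x => (Y x : TangentSpace 𝓘(ℝ, ℝ × F) x)) hXa hYa
  have h2 := canonicalPoisson_bracket_basic_fiberLinear
    (W := fun x => (Y x : TangentSpace 𝓘(ℝ, ℝ × F) x)) hfa hYa
  have h3 := canonicalPoisson_bracket_basic hfa hga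
  have k1 := hP.bracket_comp (mdifferentiableAt_linearFun (β := VerticalDual.mu F p a) hU hX ha)
    (mdifferentiableAt_linearFun hU hY ha)
  have k2 := hP.bracket_comp (mdifferentiableAt_comp_proj (β := VerticalDual.mu F p a) hU hf ha)
    (mdifferentiableAt_linearFun hU hY ha)
  have k3 := hP.bracket_comp (mdifferentiableAt_comp_proj (β := VerticalDual.mu F p a) hU hf ha)
    (mdifferentiableAt_comp_proj hU hg ha)
  exact ⟨k1.trans h1, k2.trans h2, k3.trans h3⟩

/-- Every covector of the dual of the vertical bundle is the differential of the sum of a basic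
function and of the linear function of a vertical vector field. -/
lemma exists_eq_mvfderiv_add (a : CotangentBundle 𝓘(ℝ, ℝ × F) N)
    (α : CotangentSpace 𝓘(ℝ, ℝ × (F × (F →L[ℝ] ℝ))) (VerticalDual.mu F p a)) :
    ∃ (f : N → ℝ) (e : F), ContMDiffOn 𝓘(ℝ, ℝ × F) 𝓘(ℝ, ℝ) ∞ f (chartAt (ℝ × F) a.proj).source ∧
      α = mvfderiv 𝓘(ℝ, ℝ × (F × (F →L[ℝ] ℝ))) (fun β : VerticalDual F p => f β.proj)
          (VerticalDual.mu F p a) +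
        mvfderiv 𝓘(ℝ, ℝ × (F × (F →L[ℝ] ℝ))) (VerticalDual.linearFun (coordField p a.proj e))
          (VerticalDual.mu F p a) := by
  have hf := VerticalDual.isEtaQuotient F p
  let γ : ℝ × (F × (F →L[ℝ] ℝ)) →L[ℝ] ℝ := α
  let e : F := bidualInv F (γ ∘L (ContinuousLinearMap.inr ℝ ℝ (F × (F →L[ℝ] ℝ)) ∘L
    ContinuousLinearMap.inr ℝ F (F →L[ℝ] ℝ)))
  let ℓ : ℝ × F →L[ℝ] ℝ := γ ∘L (ContinuousLinearMap.fst ℝ ℝ F).prod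
    ((ContinuousLinearMap.snd ℝ ℝ F).prod 0)
  let f : N → ℝ := ℓ ∘ extChartAt 𝓘(ℝ, ℝ × F) a.proj
  have hfs : ContMDiffOn 𝓘(ℝ, ℝ × F) 𝓘(ℝ, ℝ) ∞ f (chartAt (ℝ × F) a.proj).source :=
    ℓ.contDiff.contMDiff.comp_contMDiffOn contMDiffOn_extChartAt
  have hU := (chartAt (ℝ × F) a.proj).open_source
  have ha := mem_chart_source (ℝ × F) a.proj
  have hX := contMDiffOn_coordField (p := p) a.proj e
  refine ⟨f, e, hfs, ?_⟩
  have hmu : MDifferentiableAt (cotModel (ℝ × F)) 𝓘(ℝ, ℝ × (F × (F →L[ℝ] ℝ)))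
      (VerticalDual.mu F p) a :=
    ((hf.contMDiff (fun _ => rfl)) a).mdifferentiableAt (by simp)
  have h1 := coordDeriv_comp (mdifferentiableAt_comp_proj (p := p) (β := VerticalDual.mu F p a)
    hU hfs ha) hmu
  have h2 := coordDeriv_comp (mdifferentiableAt_linearFun (p := p) (β := VerticalDual.mu F p a)
    hU hX ha) hmu
  have h3 : coordDeriv (cotModel (ℝ × F)) 𝓘(ℝ, ℝ)
      ((fun β : VerticalDual F p => f β.proj) ∘ VerticalDual.mu F p) a = _ :=
    coordDeriv_comp_cotangent_proj ((hfs.contMDiffAt (hU.mem_nhds ha)).mdifferentiableAt (by simp))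
  have h4 : coordDeriv (cotModel (ℝ × F)) 𝓘(ℝ, ℝ)
      (VerticalDual.linearFun (coordField p a.proj e) ∘ VerticalDual.mu F p) a = _ :=
    coordDeriv_fiberLinear (V := fun x => (coordField p a.proj e x : TangentSpace 𝓘(ℝ, ℝ × F) x))
      (hX.contMDiffAt (hU.mem_nhds ha))
  have h5 : coordDeriv 𝓘(ℝ, ℝ × F) 𝓘(ℝ, ℝ) f a.proj = ℓ := by
    have hI : IsManifold 𝓘(ℝ, ℝ × F) 1 N := IsManifold.of_le (n := ∞) (by simp)
    refine (coordDeriv_comp (I := 𝓘(ℝ, ℝ × F)) (I' := 𝓘(ℝ, ℝ × F)) (I'' := 𝓘(ℝ, ℝ))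
      ℓ.differentiableAt.mdifferentiableAt (mdifferentiableAt_extChartAt' ha)).trans ?_
    change _ ∘L chartDeriv 𝓘(ℝ, ℝ × F) a.proj a.proj = _
    rw [chartDeriv_self, coordDeriv, mfderiv_eq_fderiv, ContinuousLinearMap.fderiv]
    rfl
  have h6 := localField_coordField_eventuallyEq (p := p) a.proj e
  rw [hf.coordDeriv_eq (fun _ => rfl)] at h1 h2
  rw [h3, h5] at h1
  rw [h4, h6.fderiv_eq, h6.self_of_nhds, fderiv_const_apply, ContinuousLinearMap.comp_zero] at h2
  refine ContinuousLinearMap.ext fun w => ?_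
  -- The vector `w = (t, q, r)` is the image of `(t, q, 0, r)` under `T mu`.
  obtain ⟨t, q, r⟩ : ℝ × (F × (F →L[ℝ] ℝ)) := w
  have h1' := DFunLike.congr_fun h1 ((t, q), r ∘L ContinuousLinearMap.snd ℝ ℝ F)
  have h2' := DFunLike.congr_fun h2 ((t, q), r ∘L ContinuousLinearMap.snd ℝ ℝ F)
  have hd : covDropL F ((t, q), r ∘L ContinuousLinearMap.snd ℝ ℝ F) = (t, q, r) :=
    covDrop_covLift F (t, q, r)
  have hc : ∀ A : ℝ × (F × (F →L[ℝ] ℝ)) →L[ℝ] ℝ,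
      (A ∘L covDropL F) ((t, q), r ∘L ContinuousLinearMap.snd ℝ ℝ F) = A (t, q, r) :=
    fun A => congrArg A hd
  rw [hc] at h1' h2'
  have hr : r e = γ (0, 0, r) := apply_bidualInv _ r
  change γ (t, q, r) = coordDeriv _ 𝓘(ℝ, ℝ) _ _ (t, q, r) + coordDeriv _ 𝓘(ℝ, ℝ) _ _ (t, q, r)
  rw [← h1', ← h2']
  have h7 : ((t, q, r) : ℝ × (F × (F →L[ℝ] ℝ))) = (t, q, 0) + (0, 0, r) := by simp
  rw [h7, map_add, ← hr]
  simp [ℓ]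

/-- The canonical Poisson structure is the only 2-vector with the characterizing brackets. -/
lemma isCanonicalVerticalDual_iff
    (Λ : BivectorField 𝓘(ℝ, ℝ × (F × (F →L[ℝ] ℝ))) (VerticalDual F p)) :
    IsCanonicalVerticalDual F p Λ ↔ Λ = verticalDualPoisson := by
  refine ⟨fun h => ?_, fun h => h ▸ isCanonicalVerticalDual_verticalDualPoisson⟩
  refine BivectorField.ext (funext fun β => ?_)
  obtain ⟨a, rfl⟩ := (VerticalDual.isEtaQuotient F p).isQuotientMap.surjective β
  refine LinearMap.ext fun α => LinearMap.ext fun α' => ?_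
  obtain ⟨f, e, hf, rfl⟩ := exists_eq_mvfderiv_add a α
  obtain ⟨f', e', hf', rfl⟩ := exists_eq_mvfderiv_add a α'
  have key : ∀ {Λ : BivectorField 𝓘(ℝ, ℝ × (F × (F →L[ℝ] ℝ))) (VerticalDual F p)},
      IsCanonicalVerticalDual F p Λ → ∀ {f f' : N → ℝ} (e e' : F),
      ContMDiffOn 𝓘(ℝ, ℝ × F) 𝓘(ℝ, ℝ) ∞ f (chartAt (ℝ × F) a.proj).source →
      ContMDiffOn 𝓘(ℝ, ℝ × F) 𝓘(ℝ, ℝ) ∞ f' (chartAt (ℝ × F) a.proj).source → _ :=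
    fun h f f' e e' hf hf' => h _ f f' _ _ (chartAt (ℝ × F) a.proj).open_source hf hf'
      (contMDiffOn_coordField (p := p) a.proj e) (contMDiffOn_coordField (p := p) a.proj e') a
      (mem_chart_source _ _)
  have h0 := isCanonicalVerticalDual_verticalDualPoisson (F := F) (p := p)
  simp only [map_add, LinearMap.add_apply]
  rw [Λ.swap _ (mvfderiv _ (VerticalDual.linearFun _) _) (mvfderiv _ (fun β => f' β.proj) _),
    BivectorField.swap verticalDualPoisson _ (mvfderiv _ (VerticalDual.linearFun _) _)
      (mvfderiv _ (fun β => f' β.proj) _)]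
  have e1 := ((key h e e' hf hf').1).trans ((key h0 e e' hf hf').1).symm
  have e2 := ((key h e e' hf hf').2.1).trans ((key h0 e e' hf hf').2.1).symm
  have e3 := ((key h e e hf' hf).2.1).trans ((key h0 e e hf' hf).2.1).symm
  have e4 := ((key h e e' hf hf').2.2).trans ((key h0 e e' hf hf').2.2).symm
  simp only [BivectorField.bracket] at e1 e2 e3 e4
  rw [e1, e2, e3, e4]

end CanonicalVerticalDual

/-! ### Complete lifts of constant two-vectors -/

section CompleteLift

variable {E : Type*} [NormedAddCommGroup E] [NormedSpace ℝ E]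

/-- The sharp map of the complete lift of a constant 2-vector: if `α` has the components `α_q` and
`α_u` in the coordinates `(q, u)` of the tangent bundle, then its image is `(P α_u, P α_q)`. -/
def completeSharp (P : (E →L[ℝ] ℝ) →L[ℝ] E) : (E × E →L[ℝ] ℝ) →L[ℝ] E × E :=
  (P ∘L (ContinuousLinearMap.compL ℝ E (E × E) ℝ).flip (ContinuousLinearMap.inr ℝ E E)).prod
    (P ∘L (ContinuousLinearMap.compL ℝ E (E × E) ℝ).flip (ContinuousLinearMap.inl ℝ E E))

variable {P : (E →L[ℝ] ℝ) →L[ℝ] E}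

lemma completeSharp_apply (α : E × E →L[ℝ] ℝ) :
    completeSharp P α =
      (P (α ∘L ContinuousLinearMap.inr ℝ E E), P (α ∘L ContinuousLinearMap.inl ℝ E E)) := rfl

lemma IsAltSharp.completeSharp (hP : IsAltSharp P) : IsAltSharp (completeSharp P) := by
  intro α
  rw [clm_apply_prod, completeSharp_apply]
  dsimp only
  rw [hP.swap]
  ring

variable {X : Type*} [TopologicalSpace X] [ChartedSpace E X] [IsManifold 𝓘(ℝ, E) ∞ X]

/-- The derivatives of all changes of charts preserve `P`. -/
lemma IsChartInvariant.sharpRel_fderiv_transition (hP : IsChartInvariant 𝓘(ℝ, E) X P) {x₀ x y : X}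
    (hy : y ∈ (chartAt E x).source) (hy₀ : y ∈ (chartAt E x₀).source) :
    SharpRel (fderiv ℝ (transition x₀ x) (extChartAt 𝓘(ℝ, E) x y)) P P := by
  refine SharpRel.of_comp (T := chartDeriv 𝓘(ℝ, E) x y) (P := P) ?_ (hP x y hy)
  rw [← chartDeriv_eq_comp hy hy₀]
  exact hP x₀ y hy₀

/-- The derivative of the identity `Dτ P Dτ* = P`. -/
lemma IsChartInvariant.fderiv_fderiv_transition (hP : IsChartInvariant 𝓘(ℝ, E) X P) {x₀ x : X}
    (hx : x ∈ (chartAt E x₀).source) (α : E →L[ℝ] ℝ) (u : E) :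
    fderiv ℝ (fderiv ℝ (transition x₀ x)) (extChartAt 𝓘(ℝ, E) x x) u
        (P (α ∘L chartDeriv 𝓘(ℝ, E) x₀ x)) +
      chartDeriv 𝓘(ℝ, E) x₀ x
        (P (α ∘L fderiv ℝ (fderiv ℝ (transition x₀ x)) (extChartAt 𝓘(ℝ, E) x x) u)) = 0 := by
  have hxx := mem_chart_source E x
  have h : HasFDerivAt (fderiv ℝ (transition x₀ x)) _ (extChartAt 𝓘(ℝ, E) x x) :=
    (((contDiffAt_transition hxx hx).fderiv_right (m := ∞) (by simp)).differentiableAt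
      (by simp)).hasFDerivAt
  let L : (E →L[ℝ] E) →L[ℝ] E := P ∘L ContinuousLinearMap.compL ℝ E E ℝ α
  have h1 := h.clm_apply (L.hasFDerivAt.comp _ h)
  have h2 : (fun q => fderiv ℝ (transition x₀ x) q (L (fderiv ℝ (transition x₀ x) q))) =ᶠ[
      𝓝 (extChartAt 𝓘(ℝ, E) x x)] fun _ => P α := by
    have h3 := continuousAt_extChartAt_symm (I := 𝓘(ℝ, E)) x
    rw [ContinuousAt, extChartAt_to_inv] at h3
    filter_upwards [h3 ((chartAt E x₀).open_source.mem_nhds hx),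
      extChartAt_target_mem_nhds (I := 𝓘(ℝ, E)) x] with q hq hq'
    have hb := (extChartAt 𝓘(ℝ, E) x).map_target hq'
    rw [extChartAt_source] at hb
    have h4 := hP.sharpRel_fderiv_transition hb hq
    rw [(extChartAt 𝓘(ℝ, E) x).right_inv hq'] at h4
    exact h4 α
  have h3 := h1.unique ((hasFDerivAt_const _ _).congr_of_eventuallyEq h2)
  have h4 := DFunLike.congr_fun h3 u
  rw [chartDeriv_eq_fderiv hx]
  refine Eq.trans ?_ h4
  exact add_comm _ _

/-- The complete lift of an invariant constant 2-vector is invariant. -/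
lemma IsChartInvariant.completeSharp (hP : IsChartInvariant 𝓘(ℝ, E) X P) :
    IsChartInvariant 𝓘(ℝ, E).tangent (TangentBundle 𝓘(ℝ, E) X) (completeSharp P) := by
  intro v₀ v hv α
  have hv' : v.proj ∈ (chartAt E v₀.proj).source := by
    rw [← extChartAt_source 𝓘(ℝ, E).tangent, extChartAt_tangent_source] at hv
    exact hv
  set A := chartDeriv 𝓘(ℝ, E) v₀.proj v.proj with hA
  set B := fderiv ℝ (fderiv ℝ (transition v₀.proj v.proj)) (extChartAt 𝓘(ℝ, E) v.proj v.proj)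
    with hB
  set a := α ∘L ContinuousLinearMap.inl ℝ E E with ha
  set b := α ∘L ContinuousLinearMap.inr ℝ E E with hb
  have hT : ∀ δ, chartDeriv 𝓘(ℝ, E).tangent v₀ v δ = (A δ.1, B δ.1 (vecCoord v) + A δ.2) :=
    chartDeriv_tangent_apply hv'
  have h1 : (α ∘L chartDeriv 𝓘(ℝ, E).tangent v₀ v) ∘L ContinuousLinearMap.inr ℝ E E = b ∘L A := by
    refine ContinuousLinearMap.ext fun w => ?_
    change α (chartDeriv 𝓘(ℝ, E).tangent v₀ v (0, w)) = α (0, A w)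
    rw [hT]
    simp
  have h2 : (α ∘L chartDeriv 𝓘(ℝ, E).tangent v₀ v) ∘L ContinuousLinearMap.inl ℝ E E =
      a ∘L A + b ∘L B (vecCoord v) := by
    refine ContinuousLinearMap.ext fun w => ?_
    change α (chartDeriv 𝓘(ℝ, E).tangent v₀ v (w, 0)) = a (A w) + b (B (vecCoord v) w)
    rw [hT, clm_apply_prod, hB, fderiv_fderiv_transition_symm (mem_chart_source E v.proj) hv' w]
    simp [ha, hb]
  have h3 : A (P (a ∘L A)) = P a := hP _ _ hv' a
  have h4 : A (P (b ∘L A)) = P b := hP _ _ hv' b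
  have h5 := hP.fderiv_fderiv_transition hv' b (vecCoord v)
  rw [completeSharp_apply, completeSharp_apply, hT, h1, h2]
  refine Prod.ext h4 ?_
  change B (P (b ∘L A)) (vecCoord v) + A (P (a ∘L A + b ∘L B (vecCoord v))) = P a
  rw [map_add, map_add, h3, hB,
    fderiv_fderiv_transition_symm (mem_chart_source E v.proj) hv', add_left_comm]
  exact (congrArg (P a + ·) h5).trans (add_zero _)

variable {f g : X → ℝ} {U : Set X} {v : TangentBundle 𝓘(ℝ, E) X}

/-- In the preferred charts at `v`, the complete lift of `f` is `(q, u) ↦ Df(q) u`. -/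
lemma completeLift_comp_eventuallyEq (hU : IsOpen U) (hf : ContMDiffOn 𝓘(ℝ, E) 𝓘(ℝ, ℝ) ∞ f U)
    (hv : v.proj ∈ U) :
    completeLift 𝓘(ℝ, E) f ∘ (extChartAt 𝓘(ℝ, E).tangent v).symm =ᶠ[
      𝓝 (extChartAt 𝓘(ℝ, E).tangent v v)]
      fun z : E × E => fderiv ℝ (f ∘ (extChartAt 𝓘(ℝ, E) v.proj).symm) z.1 z.2 := by
  have h1 := continuousAt_extChartAt_symm (I := 𝓘(ℝ, E).tangent) v
  rw [ContinuousAt, extChartAt_to_inv] at h1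
  have h0 : (Bundle.TotalSpace.proj : TangentBundle 𝓘(ℝ, E) X → X) ⁻¹' U ∈ 𝓝 v :=
    (FiberBundle.continuous_proj E (TangentSpace 𝓘(ℝ, E))).continuousAt.preimage_mem_nhds
      (hU.mem_nhds hv)
  filter_upwards [h1 h0, extChartAt_target_mem_nhds (I := 𝓘(ℝ, E).tangent) v] with z hz hz'
  have hb := (extChartAt 𝓘(ℝ, E).tangent v).map_target hz'
  have hz2 := (extChartAt 𝓘(ℝ, E).tangent v).right_inv hz'
  rw [Function.comp_apply]
  rw [mem_preimage, mem_preimage] at hz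
  generalize (extChartAt 𝓘(ℝ, E).tangent v).symm z = b at *
  rw [extChartAt_tangent_source] at hb
  rw [← hz2, extChartAt_tangent_apply v b hb]
  exact DFunLike.congr_fun (coordDeriv_eq_fderiv_comp (I := 𝓘(ℝ, E)) hb
    ((hf.contMDiffAt (hU.mem_nhds hz)).mdifferentiableAt (by simp))) (vecCoord b)

lemma completeLift_eq (hU : IsOpen U) (hf : ContMDiffOn 𝓘(ℝ, E) 𝓘(ℝ, ℝ) ∞ f U)
    (hv : v.proj ∈ U) :
    completeLift 𝓘(ℝ, E) f v = fderiv ℝ (f ∘ (extChartAt 𝓘(ℝ, E) v.proj).symm)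
      (extChartAt 𝓘(ℝ, E) v.proj v.proj) (vecCoord v) := by
  have h := (completeLift_comp_eventuallyEq hU hf hv).self_of_nhds
  rwa [Function.comp_apply, extChartAt_to_inv, extChartAt_tangent_self] at h

/-- The derivative of a function on `TX` can be computed in the preferred chart. -/
lemma coordDeriv_tangent_of_hasFDerivAt {G : TangentBundle 𝓘(ℝ, E) X → ℝ} {G' : E × E →L[ℝ] ℝ}
    (hG : HasFDerivAt (G ∘ (extChartAt 𝓘(ℝ, E).tangent v).symm) G'
      (extChartAt 𝓘(ℝ, E).tangent v v)) :
    coordDeriv 𝓘(ℝ, E).tangent 𝓘(ℝ, ℝ) G v = G' := by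
  have hI : IsManifold 𝓘(ℝ, E).tangent 1 (TangentBundle 𝓘(ℝ, E) X) :=
    IsManifold.of_le (n := ∞) (by simp)
  have h1 := hG.differentiableAt.mdifferentiableAt.comp v
    (mdifferentiableAt_extChartAt (I := 𝓘(ℝ, E).tangent) (mem_chart_source _ v))
  have h2 : MDifferentiableAt 𝓘(ℝ, E).tangent 𝓘(ℝ, ℝ) G v := by
    refine h1.congr_of_eventuallyEq ?_
    filter_upwards [extChartAt_source_mem_nhds (I := 𝓘(ℝ, E).tangent) v] with b hb
    simp only [Function.comp_apply, (extChartAt 𝓘(ℝ, E).tangent v).left_inv hb]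
  rw [coordDeriv_eq_fderiv_comp (mem_chart_source _ v) h2, chartDeriv_self, hG.fderiv]
  rfl

/-- In the preferred charts at `v`, `d(f^c) = D²f(u) dq + Df du`. -/
lemma coordDeriv_completeLift (hU : IsOpen U) (hf : ContMDiffOn 𝓘(ℝ, E) 𝓘(ℝ, ℝ) ∞ f U)
    (hv : v.proj ∈ U) :
    coordDeriv 𝓘(ℝ, E).tangent 𝓘(ℝ, ℝ) (completeLift 𝓘(ℝ, E) f) v =
      (fderiv ℝ (fderiv ℝ (f ∘ (extChartAt 𝓘(ℝ, E) v.proj).symm))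
        (extChartAt 𝓘(ℝ, E) v.proj v.proj) (vecCoord v)).coprod
      (fderiv ℝ (f ∘ (extChartAt 𝓘(ℝ, E) v.proj).symm) (extChartAt 𝓘(ℝ, E) v.proj v.proj)) := by
  have hc := contDiffAt_comp_extChartAt_symm hU hv (mem_chart_source E v.proj) hf
  let z : E × E := (extChartAt 𝓘(ℝ, E) v.proj v.proj, vecCoord v)
  have h3 : HasFDerivAt (fderiv ℝ (f ∘ (extChartAt 𝓘(ℝ, E) v.proj).symm)) _ z.1 :=
    ((hc.fderiv_right (m := ∞) (by simp)).differentiableAt (by simp)).hasFDerivAt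
  have h4 := (h3.comp z hasFDerivAt_fst).clm_apply (hasFDerivAt_snd (E := E) (F := E) (p := z))
  have h5 := completeLift_comp_eventuallyEq hU hf hv
  rw [extChartAt_tangent_self] at h5
  refine coordDeriv_tangent_of_hasFDerivAt ?_
  rw [extChartAt_tangent_self]
  refine HasFDerivAt.congr_of_eventuallyEq (h4.congr_fderiv ?_) h5
  refine ContinuousLinearMap.ext fun δ => (add_comm _ _).trans (congrArg (· + _) ?_)
  exact (hc.isSymmSndFDerivAt (by simpa using by norm_cast)).eq δ.1 (vecCoord v)

/-- In the preferred charts at `v`, `d(f^v) = Df dq`. -/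
lemma coordDeriv_verticalLift (hU : IsOpen U) (hf : ContMDiffOn 𝓘(ℝ, E) 𝓘(ℝ, ℝ) ∞ f U)
    (hv : v.proj ∈ U) :
    coordDeriv 𝓘(ℝ, E).tangent 𝓘(ℝ, ℝ) (verticalLift 𝓘(ℝ, E) f) v =
      fderiv ℝ (f ∘ (extChartAt 𝓘(ℝ, E) v.proj).symm) (extChartAt 𝓘(ℝ, E) v.proj v.proj) ∘L
        ContinuousLinearMap.fst ℝ E E := by
  have hc := contDiffAt_comp_extChartAt_symm hU hv (mem_chart_source E v.proj) hf
  let z : E × E := (extChartAt 𝓘(ℝ, E) v.proj v.proj, vecCoord v)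
  have h3 : HasFDerivAt (f ∘ (extChartAt 𝓘(ℝ, E) v.proj).symm) _ z.1 :=
    (hc.differentiableAt (by simp)).hasFDerivAt
  refine coordDeriv_tangent_of_hasFDerivAt ?_
  have h5 : verticalLift 𝓘(ℝ, E) f ∘ (extChartAt 𝓘(ℝ, E).tangent v).symm =ᶠ[
      𝓝 (extChartAt 𝓘(ℝ, E).tangent v v)]
      fun z : E × E => (f ∘ (extChartAt 𝓘(ℝ, E) v.proj).symm) z.1 := by
    filter_upwards [extChartAt_target_mem_nhds (I := 𝓘(ℝ, E).tangent) v] with z hz'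
    have hb := (extChartAt 𝓘(ℝ, E).tangent v).map_target hz'
    have hz2 := (extChartAt 𝓘(ℝ, E).tangent v).right_inv hz'
    rw [Function.comp_apply]
    generalize (extChartAt 𝓘(ℝ, E).tangent v).symm z = b at *
    rw [extChartAt_tangent_source] at hb
    rw [← hz2, extChartAt_tangent_apply v b hb]
    change f b.proj = f _
    rw [(extChartAt 𝓘(ℝ, E) v.proj).left_inv (by rw [extChartAt_source]; exact hb)]
  rw [extChartAt_tangent_self] at h5 ⊢
  exact HasFDerivAt.congr_of_eventuallyEq (h3.comp z hasFDerivAt_fst) h5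

variable {halt : IsAltSharp P} {hP : IsChartInvariant 𝓘(ℝ, E) X P}

variable (X P halt hP) in
/-- The complete lift of a constant 2-vector. -/
def completeBivector : BivectorField 𝓘(ℝ, E).tangent (TangentBundle 𝓘(ℝ, E) X) :=
  constBivector _ _ (completeSharp P) halt.completeSharp hP.completeSharp

lemma isCompleteLift_completeBivector [IsManifold 𝓘(ℝ, E) 1 X] :
    IsCompleteLift (constBivector 𝓘(ℝ, E) X P halt hP) (completeBivector P X halt hP) := by
  intro U f g hU hf hg v hv
  have hcf := coordDeriv_completeLift hU hf hv
  have hcg := coordDeriv_completeLift hU hg hv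
  have hvf := coordDeriv_verticalLift hU hf hv
  have hvg := coordDeriv_verticalLift hU hg hv
  have hbr := (constBivector 𝓘(ℝ, E) X P halt hP).smooth U f g hU hf hg
  have hsf := contDiffAt_comp_extChartAt_symm hU hv (mem_chart_source E v.proj) hf
  have hsg := contDiffAt_comp_extChartAt_symm hU hv (mem_chart_source E v.proj) hg
  have hb0 : (constBivector 𝓘(ℝ, E) X P halt hP).bracket f g v.proj =
      fderiv ℝ (g ∘ (extChartAt 𝓘(ℝ, E) v.proj).symm) (extChartAt 𝓘(ℝ, E) v.proj v.proj)
        (P (fderiv ℝ (f ∘ (extChartAt 𝓘(ℝ, E) v.proj).symm)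
          (extChartAt 𝓘(ℝ, E) v.proj v.proj))) :=
    (hP.bracket_eventuallyEq hU hv hf hg).self_of_nhds
  refine ⟨?_, ?_, ?_⟩
  · refine (constBivector_bracket _ _ _).trans ?_
    rw [hcf, hcg, completeSharp_apply]
    refine Eq.trans ?_ (completeLift_eq hU hbr hv).symm
    have h1 : (constBivector 𝓘(ℝ, E) X P halt hP).bracket f g ∘
        (extChartAt 𝓘(ℝ, E) v.proj).symm =ᶠ[𝓝 (extChartAt 𝓘(ℝ, E) v.proj v.proj)] fun u =>
        fderiv ℝ (g ∘ (extChartAt 𝓘(ℝ, E) v.proj).symm) u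
          (P (fderiv ℝ (f ∘ (extChartAt 𝓘(ℝ, E) v.proj).symm) u)) := by
      have h2 := continuousAt_extChartAt_symm (I := 𝓘(ℝ, E)) v.proj
      rw [ContinuousAt, extChartAt_to_inv] at h2
      filter_upwards [h2.eventually (hP.bracket_eventuallyEq hU hv hf hg),
        extChartAt_target_mem_nhds (I := 𝓘(ℝ, E)) v.proj] with u hu hu'
      refine hu.trans ?_
      simp only [Function.comp_apply, (extChartAt 𝓘(ℝ, E) v.proj).right_inv hu']
    have hf' : HasFDerivAt (fderiv ℝ (f ∘ (extChartAt 𝓘(ℝ, E) v.proj).symm)) _ _ :=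
      ((hsf.fderiv_right (m := ∞) (by simp)).differentiableAt (by simp)).hasFDerivAt
    have hg' : HasFDerivAt (fderiv ℝ (g ∘ (extChartAt 𝓘(ℝ, E) v.proj).symm)) _ _ :=
      ((hsg.fderiv_right (m := ∞) (by simp)).differentiableAt (by simp)).hasFDerivAt
    have h2 := (hg'.clm_apply (P.hasFDerivAt.comp _ hf')).congr_of_eventuallyEq h1
    refine Eq.trans ?_ (DFunLike.congr_fun h2.fderiv (vecCoord v)).symm
    simp
    ring
  · refine (constBivector_bracket _ _ _).trans ?_
    rw [hcf, hvg, completeSharp_apply]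
    refine Eq.trans ?_ hb0.symm
    simp
  · refine (constBivector_bracket _ _ _).trans ?_
    rw [hvf, hvg, completeSharp_apply]
    simp [ContinuousLinearMap.comp_assoc]

/-- Every covector of the tangent bundle is the sum of the differentials of a vertical lift and of a
complete lift. -/
lemma exists_eq_mvfderiv_lifts (v : TangentBundle 𝓘(ℝ, E) X)
    (α : CotangentSpace 𝓘(ℝ, E).tangent v) :
    ∃ f g : X → ℝ, ContMDiffOn 𝓘(ℝ, E) 𝓘(ℝ, ℝ) ∞ f (chartAt E v.proj).source ∧
      ContMDiffOn 𝓘(ℝ, E) 𝓘(ℝ, ℝ) ∞ g (chartAt E v.proj).source ∧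
      α = mvfderiv 𝓘(ℝ, E).tangent (verticalLift 𝓘(ℝ, E) f) v +
        mvfderiv 𝓘(ℝ, E).tangent (completeLift 𝓘(ℝ, E) g) v := by
  let γ : E × E →L[ℝ] ℝ := α
  have hs : ∀ ℓ : E →L[ℝ] ℝ, ContMDiffOn 𝓘(ℝ, E) 𝓘(ℝ, ℝ) ∞ (ℓ ∘ extChartAt 𝓘(ℝ, E) v.proj)
      (chartAt E v.proj).source := fun ℓ =>
    ℓ.contDiff.contMDiff.comp_contMDiffOn contMDiffOn_extChartAt
  have hU := (chartAt E v.proj).open_source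
  have hv := mem_chart_source E v.proj
  have hloc : ∀ ℓ : E →L[ℝ] ℝ, (ℓ ∘ extChartAt 𝓘(ℝ, E) v.proj) ∘
      (extChartAt 𝓘(ℝ, E) v.proj).symm =ᶠ[𝓝 (extChartAt 𝓘(ℝ, E) v.proj v.proj)] ℓ := by
    intro ℓ
    filter_upwards [extChartAt_target_mem_nhds (I := 𝓘(ℝ, E)) v.proj] with u hu
    simp only [Function.comp_apply, (extChartAt 𝓘(ℝ, E) v.proj).right_inv hu]
  have h1 : ∀ ℓ : E →L[ℝ] ℝ, fderiv ℝ ((ℓ ∘ extChartAt 𝓘(ℝ, E) v.proj) ∘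
      (extChartAt 𝓘(ℝ, E) v.proj).symm) =ᶠ[𝓝 (extChartAt 𝓘(ℝ, E) v.proj v.proj)]
      fun _ => ℓ := by
    intro ℓ
    refine (hloc ℓ).fderiv.trans (Filter.Eventually.of_forall fun u => ?_)
    exact ContinuousLinearMap.fderiv (E := E) (F := ℝ) ℓ
  refine ⟨_, _, hs (γ ∘L ContinuousLinearMap.inl ℝ E E),
    hs (γ ∘L ContinuousLinearMap.inr ℝ E E), ?_⟩
  have hf := coordDeriv_verticalLift (v := v) hU (hs (γ ∘L ContinuousLinearMap.inl ℝ E E)) hv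
  have hg := coordDeriv_completeLift (v := v) hU (hs (γ ∘L ContinuousLinearMap.inr ℝ E E)) hv
  rw [(h1 _).self_of_nhds] at hf
  rw [(h1 _).fderiv_eq, (h1 _).self_of_nhds, fderiv_const_apply] at hg
  refine Eq.trans ?_ (congrArg₂ (fun a b : E × E →L[ℝ] ℝ => a + b) hf hg).symm
  refine ContinuousLinearMap.ext fun (δ : E × E) => ?_
  refine (clm_apply_prod γ δ).trans (congrArg (_ + ·) ?_)
  exact (zero_add _).symm

/-- The complete lift is the only 2-vector with the characterizing brackets. -/
lemma isCompleteLift_iff [IsManifold 𝓘(ℝ, E) 1 X]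
    (Λ : BivectorField 𝓘(ℝ, E).tangent (TangentBundle 𝓘(ℝ, E) X)) :
    IsCompleteLift (constBivector 𝓘(ℝ, E) X P halt hP) Λ ↔ Λ = completeBivector P X halt hP := by
  refine ⟨fun h => ?_, fun h => h ▸ isCompleteLift_completeBivector⟩
  refine BivectorField.ext (funext fun v => ?_)
  refine LinearMap.ext fun α => LinearMap.ext fun β => ?_
  obtain ⟨f, g, hf, hg, rfl⟩ := exists_eq_mvfderiv_lifts v α
  obtain ⟨f', g', hf', hg', rfl⟩ := exists_eq_mvfderiv_lifts v β
  have h0 := isCompleteLift_completeBivector (halt := halt) (hP := hP)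
  have hU := (chartAt E v.proj).open_source
  have hv := mem_chart_source E v.proj
  simp only [map_add, LinearMap.add_apply]
  rw [Λ.swap _ (mvfderiv _ (verticalLift _ _) _) (mvfderiv _ (completeLift _ g') _),
    BivectorField.swap (completeBivector P X halt hP) _ (mvfderiv _ (verticalLift _ _) _)
      (mvfderiv _ (completeLift _ g') _)]
  have e1 := ((h _ g g' hU hg hg' v hv).1).trans ((h0 _ g g' hU hg hg' v hv).1).symm
  have e2 := ((h _ g f' hU hg hf' v hv).2.1).trans ((h0 _ g f' hU hg hf' v hv).2.1).symm
  have e3 := ((h _ g' f hU hg' hf v hv).2.1).trans ((h0 _ g' f hU hg' hf v hv).2.1).symm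
  have e4 := ((h _ f f' hU hf hf' v hv).2.2).trans ((h0 _ f f' hU hf hf' v hv).2.2).symm
  simp only [BivectorField.bracket] at e1 e2 e3 e4
  rw [e1, e2, e3, e4]

end CompleteLift

/-! ### Restriction of complete lifts to jet spaces -/

section Jet

variable (F : Type*) [NormedAddCommGroup F] [NormedSpace ℝ F]

/-- `(t, q, q̇) ↦ (t, q, 0, q̇)`, the linear part of `jetLift`. -/
def jetLiftL : ℝ × (F × F) →L[ℝ] (ℝ × F) × (ℝ × F) :=
  ((ContinuousLinearMap.fst ℝ ℝ (F × F)).prod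
    (ContinuousLinearMap.fst ℝ F F ∘L ContinuousLinearMap.snd ℝ ℝ (F × F))).prod
  ((0 : ℝ × (F × F) →L[ℝ] ℝ).prod
    (ContinuousLinearMap.snd ℝ F F ∘L ContinuousLinearMap.snd ℝ ℝ (F × F)))

/-- `(t, q, ṫ, q̇) ↦ (t, q, q̇)` as a linear map, see `jetDrop`. -/
def jetDropL : (ℝ × F) × (ℝ × F) →L[ℝ] ℝ × (F × F) :=
  (ContinuousLinearMap.fst ℝ ℝ F ∘L ContinuousLinearMap.fst ℝ (ℝ × F) (ℝ × F)).prod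
    ((ContinuousLinearMap.snd ℝ ℝ F ∘L ContinuousLinearMap.fst ℝ (ℝ × F) (ℝ × F)).prod
      (ContinuousLinearMap.snd ℝ ℝ F ∘L ContinuousLinearMap.snd ℝ (ℝ × F) (ℝ × F)))

variable {F}

lemma jetLiftL_apply (z : ℝ × (F × F)) : jetLiftL F z = ((z.1, z.2.1), ((0 : ℝ), z.2.2)) := rfl

lemma jetDropL_apply (z : (ℝ × F) × (ℝ × F)) : jetDropL F z = (z.1.1, (z.1.2, z.2.2)) := rfl

lemma jetDropL_comp_jetLiftL :
    jetDropL F ∘L jetLiftL F = ContinuousLinearMap.id ℝ (ℝ × (F × F)) := rfl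

lemma hasFDerivAt_jetLift (z : ℝ × (F × F)) : HasFDerivAt (jetLift F) (jetLiftL F) z := by
  have h : jetLift F = fun z => jetLiftL F z + (((0 : ℝ), (0 : F)), ((1 : ℝ), (0 : F))) := by
    funext z
    simp [jetLift, jetLiftL_apply]
  rw [h]
  exact (jetLiftL F).hasFDerivAt.add_const _

lemma contDiff_jetLift : ContDiff ℝ ∞ (jetLift F) := by unfold jetLift; fun_prop

section Linear

variable {P : (ℝ × F →L[ℝ] ℝ) →L[ℝ] ℝ × F}

variable (P) in
/-- The sharp map of the restriction of the complete lift to `ṫ = 1`. -/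
def jetSharp : (ℝ × (F × F) →L[ℝ] ℝ) →L[ℝ] ℝ × (F × F) := pushSharp (jetDropL F) (completeSharp P)

lemma jetSharp_apply (γ : ℝ × (F × F) →L[ℝ] ℝ) :
    jetSharp P γ = jetDropL F (completeSharp P (γ ∘L jetDropL F)) := rfl

lemma IsAltSharp.jetSharp (halt : IsAltSharp P) : IsAltSharp (jetSharp P) :=
  halt.completeSharp.push _

lemma fst_apply_of_sharp_fst_eq_zero (halt : IsAltSharp P)
    (hdt : P (ContinuousLinearMap.fst ℝ ℝ F) = 0) (α : ℝ × F →L[ℝ] ℝ) : (P α).1 = 0 := by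
  have h := halt.swap (ContinuousLinearMap.fst ℝ ℝ F) α
  rwa [hdt, map_zero, neg_zero] at h

/-- Since `P` annihilates `dt`, the complete lift is tangent to the level sets of `ṫ`. -/
lemma jetLiftL_jetDropL_completeSharp (halt : IsAltSharp P)
    (hdt : P (ContinuousLinearMap.fst ℝ ℝ F) = 0) (α : (ℝ × F) × (ℝ × F) →L[ℝ] ℝ) :
    jetLiftL F (jetDropL F (completeSharp P α)) = completeSharp P α := by
  rw [jetDropL_apply, jetLiftL_apply, completeSharp_apply]
  refine Prod.ext rfl (Prod.ext ?_ rfl)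
  exact (fst_apply_of_sharp_fst_eq_zero halt hdt _).symm

/-- The inclusion of `ṫ = 1` pushes the restriction forward to the complete lift. A covector `α` and
the pull-back of its restriction differ by a multiple of `dṫ`, which the complete lift annihilates.
-/
lemma sharpRel_jetLiftL (halt : IsAltSharp P) (hdt : P (ContinuousLinearMap.fst ℝ ℝ F) = 0) :
    SharpRel (jetLiftL F) (jetSharp P) (completeSharp P) := by
  intro α
  rw [jetSharp_apply, jetLiftL_jetDropL_completeSharp halt hdt, completeSharp_apply,
    completeSharp_apply]
  refine Prod.ext ?_ rfl
  have h : ((α ∘L jetLiftL F) ∘L jetDropL F) ∘L ContinuousLinearMap.inr ℝ (ℝ × F) (ℝ × F) =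
      α ∘L ContinuousLinearMap.inr ℝ (ℝ × F) (ℝ × F) -
        α (0, (1, 0)) • ContinuousLinearMap.fst ℝ ℝ F := by
    refine ContinuousLinearMap.ext fun w => ?_
    change α ((0, 0), (0, w.2)) = α (0, w) - α (0, (1, 0)) * w.1
    have hw : (((0, 0), (0, w.2)) : (ℝ × F) × (ℝ × F)) = (0, w) - w.1 • (0, (1, 0)) := by
      ext <;> simp
    rw [hw, map_sub, map_smul, smul_eq_mul, mul_comm]
  dsimp only
  rw [h, map_sub, map_smul, hdt, smul_zero, sub_zero]

/-- The kernel of the restriction is spanned by `dt` if the kernel of `P` is. -/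
lemma jetSharp_eq_zero_iff (halt : IsAltSharp P)
    (hker : ∀ α, P α = 0 ↔ ∃ c : ℝ, α = c • ContinuousLinearMap.fst ℝ ℝ F)
    (γ : ℝ × (F × F) →L[ℝ] ℝ) :
    jetSharp P γ = 0 ↔ ∃ c : ℝ, γ = c • ContinuousLinearMap.fst ℝ ℝ (F × F) := by
  have hdt : P (ContinuousLinearMap.fst ℝ ℝ F) = 0 := (hker _).2 ⟨1, (one_smul ℝ _).symm⟩
  constructor
  · intro h
    have h1 := jetLiftL_jetDropL_completeSharp halt hdt (γ ∘L jetDropL F)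
    rw [← jetSharp_apply, h, map_zero, completeSharp_apply] at h1
    obtain ⟨c, hc⟩ := (hker _).1 (congrArg Prod.fst h1.symm)
    obtain ⟨d, hd⟩ := (hker _).1 (congrArg Prod.snd h1.symm)
    have hc0 : c = 0 := by
      have h2 := DFunLike.congr_fun hc ((1 : ℝ), (0 : F))
      have h3 : γ 0 = c * 1 := h2
      rw [map_zero, mul_one] at h3
      exact h3.symm
    rw [hc0, zero_smul] at hc
    refine ⟨d, ContinuousLinearMap.ext fun z => ?_⟩
    have h2 : γ z = (γ ∘L jetDropL F) (jetLiftL F z) := rfl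
    rw [h2, clm_apply_prod, hc, hd, jetLiftL_apply]
    simp
  · rintro ⟨c, rfl⟩
    have h1 : ((c • ContinuousLinearMap.fst ℝ ℝ (F × F)) ∘L jetDropL F) ∘L
        ContinuousLinearMap.inr ℝ (ℝ × F) (ℝ × F) = 0 :=
      ContinuousLinearMap.ext fun w => mul_zero c
    have h2 : ((c • ContinuousLinearMap.fst ℝ ℝ (F × F)) ∘L jetDropL F) ∘L
        ContinuousLinearMap.inl ℝ (ℝ × F) (ℝ × F) = c • ContinuousLinearMap.fst ℝ ℝ F := rfl
    rw [jetSharp_apply, completeSharp_apply, h1, h2, map_smul, hdt, map_zero, smul_zero]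
    exact map_zero _

end Linear

variable {N : Type*} [TopologicalSpace N] [ChartedSpace (ℝ × F) N] {p : N → ℝ}
  [IsManifold 𝓘(ℝ, ℝ × F) ∞ N] [IsFibredAtlas F p]

namespace JetSpace

omit [IsFibredAtlas F p] in
lemma continuous_incl : Continuous (JetSpace.incl : JetSpace F p → _) := continuous_induced_dom

lemma extChartAt_incl {v₀ v : JetSpace F p} (hv : v ∈ (chartAt (ℝ × (F × F)) v₀).source) :
    extChartAt 𝓘(ℝ, ℝ × F).tangent v₀.incl v.incl =
      jetLift F (extChartAt 𝓘(ℝ, ℝ × (F × F)) v₀ v) :=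
  (JetSpace.lift_drop v₀.incl v hv).symm

lemma extChartAt_incl_eventuallyEq {v₀ v : JetSpace F p}
    (hv : v ∈ (chartAt (ℝ × (F × F)) v₀).source) :
    extChartAt 𝓘(ℝ, ℝ × F).tangent v₀.incl ∘ JetSpace.incl =ᶠ[𝓝 v]
      jetLift F ∘ extChartAt 𝓘(ℝ, ℝ × (F × F)) v₀ := by
  filter_upwards [(chartAt (ℝ × (F × F)) v₀).open_source.mem_nhds hv] with w hw
  exact extChartAt_incl hw

lemma contMDiff_incl : ContMDiff 𝓘(ℝ, ℝ × (F × F)) 𝓘(ℝ, ℝ × F).tangent ∞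
    (JetSpace.incl : JetSpace F p → _) := by
  intro v
  rw [contMDiffAt_iff_target]
  refine ⟨continuous_incl.continuousAt, ?_⟩
  refine ContMDiffAt.congr_of_eventuallyEq ?_
    (extChartAt_incl_eventuallyEq (mem_chart_source _ v))
  exact contDiff_jetLift.contMDiff.contMDiffAt.comp v contMDiffAt_extChartAt

/-- In any charts, the derivative of the inclusion is `(t, q, q̇) ↦ (t, q, 0, q̇)`. -/
lemma chartDeriv_comp_coordDeriv_incl {v₀ v : JetSpace F p}
    (hv : v ∈ (chartAt (ℝ × (F × F)) v₀).source) :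
    chartDeriv 𝓘(ℝ, ℝ × F).tangent v₀.incl v.incl ∘L
        coordDeriv 𝓘(ℝ, ℝ × (F × F)) 𝓘(ℝ, ℝ × F).tangent JetSpace.incl v =
      jetLiftL F ∘L chartDeriv 𝓘(ℝ, ℝ × (F × F)) v₀ v := by
  have hI : IsManifold 𝓘(ℝ, ℝ × F).tangent 1 (TangentBundle 𝓘(ℝ, ℝ × F) N) :=
    IsManifold.of_le (n := ∞) (by simp)
  have hm : v.incl ∈ (chartAt (ModelProd (ℝ × F) (ℝ × F)) v₀.incl).source := hv
  rw [chartDeriv, ← coordDeriv_comp (mdifferentiableAt_extChartAt hm)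
    (contMDiff_incl.mdifferentiableAt (by simp))]
  refine ((extChartAt_incl_eventuallyEq hv).mfderiv_eq).trans ?_
  have h := coordDeriv_comp (I := 𝓘(ℝ, ℝ × (F × F))) (I' := 𝓘(ℝ, ℝ × (F × F)))
    (I'' := 𝓘(ℝ, (ℝ × F) × (ℝ × F)))
    (hasFDerivAt_jetLift (extChartAt 𝓘(ℝ, ℝ × (F × F)) v₀ v)).differentiableAt.mdifferentiableAt
    (mdifferentiableAt_extChartAt' hv)
  refine h.trans ?_
  rw [coordDeriv, mfderiv_eq_fderiv, (hasFDerivAt_jetLift (F := F) _).fderiv]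
  rfl

lemma coordDeriv_incl (v : JetSpace F p) :
    coordDeriv 𝓘(ℝ, ℝ × (F × F)) 𝓘(ℝ, ℝ × F).tangent JetSpace.incl v = jetLiftL F := by
  have hI : IsManifold 𝓘(ℝ, ℝ × F).tangent 1 (TangentBundle 𝓘(ℝ, ℝ × F) N) :=
    IsManifold.of_le (n := ∞) (by simp)
  have hI' : IsManifold 𝓘(ℝ, ℝ × (F × F)) 1 (JetSpace F p) := IsManifold.of_le (n := ∞) (by simp)
  have h := chartDeriv_comp_coordDeriv_incl (mem_chart_source (ℝ × (F × F)) v)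
  rwa [chartDeriv_self, chartDeriv_self, ContinuousLinearMap.id_comp,
    ContinuousLinearMap.comp_id] at h

/-- The change of charts of `J¹p` is the restriction of that of `TN`. -/
lemma chartDeriv_eq {v₀ v : JetSpace F p} (hv : v ∈ (chartAt (ℝ × (F × F)) v₀).source) :
    chartDeriv 𝓘(ℝ, ℝ × (F × F)) v₀ v =
      jetDropL F ∘L chartDeriv 𝓘(ℝ, ℝ × F).tangent v₀.incl v.incl ∘L jetLiftL F := by
  have h := chartDeriv_comp_coordDeriv_incl hv
  rw [coordDeriv_incl] at h
  rw [h, ← ContinuousLinearMap.comp_assoc, jetDropL_comp_jetLiftL, ContinuousLinearMap.id_comp]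

variable {P : (ℝ × F →L[ℝ] ℝ) →L[ℝ] ℝ × F} {halt : IsAltSharp P}
  {hP : IsChartInvariant 𝓘(ℝ, ℝ × F) N P}

lemma isChartInvariant_jetSharp (halt : IsAltSharp P) (hP : IsChartInvariant 𝓘(ℝ, ℝ × F) N P)
    (hdt : P (ContinuousLinearMap.fst ℝ ℝ F) = 0) :
    IsChartInvariant 𝓘(ℝ, ℝ × (F × F)) (JetSpace F p) (jetSharp P) := by
  intro v₀ v hv
  rw [chartDeriv_eq hv]
  exact (sharpRel_pushSharp (jetDropL F) (completeSharp P)).comp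
    ((hP.completeSharp _ _ hv).comp (sharpRel_jetLiftL halt hdt))

variable (p P halt hP) in
/-- The restriction of the complete lift of a constant 2-vector annihilating `dp` to `J¹p`. -/
def bivector (hdt : P (ContinuousLinearMap.fst ℝ ℝ F) = 0) :
    BivectorField 𝓘(ℝ, ℝ × (F × F)) (JetSpace F p) :=
  constBivector _ _ (jetSharp P) halt.jetSharp (isChartInvariant_jetSharp halt hP hdt)

variable {hdt : P (ContinuousLinearMap.fst ℝ ℝ F) = 0}

lemma isPoissonMap_incl :
    IsPoissonMap JetSpace.incl (bivector p P halt hP hdt) (completeBivector P N halt hP) := by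
  refine constBivector_isPoissonMap contMDiff_incl fun v => ?_
  rw [coordDeriv_incl]
  exact sharpRel_jetLiftL halt hdt

lemma isPoissonMap_incl_iff (Λ : BivectorField 𝓘(ℝ, ℝ × (F × F)) (JetSpace F p)) :
    IsPoissonMap JetSpace.incl Λ (completeBivector P N halt hP) ↔
      Λ = bivector p P halt hP hdt := by
  refine ⟨fun h => ?_, fun h => h ▸ isPoissonMap_incl⟩
  refine BivectorField.ext (funext fun v => ?_)
  refine LinearMap.ext fun α => LinearMap.ext fun β => ?_
  have h0 := isPoissonMap_incl (p := p) (halt := halt) (hP := hP) (hdt := hdt)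
  -- The inclusion is an immersion, so that every covector of `J¹p` extends to `TN`.
  have hs : ∀ α : CotangentSpace 𝓘(ℝ, ℝ × (F × F)) v,
      ∃ α' : CotangentSpace 𝓘(ℝ, ℝ × F).tangent v.incl,
        α = α' ∘L mfderiv 𝓘(ℝ, ℝ × (F × F)) 𝓘(ℝ, ℝ × F).tangent JetSpace.incl v := by
    intro α
    let γ : ℝ × (F × F) →L[ℝ] ℝ := α
    refine ⟨(γ ∘L jetDropL F : (ℝ × F) × (ℝ × F) →L[ℝ] ℝ), ?_⟩
    exact (congrArg (fun T => (γ ∘L jetDropL F) ∘L T) (coordDeriv_incl v)).symm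
  obtain ⟨α', rfl⟩ := hs α
  obtain ⟨β', rfl⟩ := hs β
  rw [← h.2, ← h0.2]

end JetSpace

end Jet

/-! ### The Tulczyjew diffeomorphism in coordinates -/

section TulczyjewCoord

variable {E : Type*} [NormedAddCommGroup E] [NormedSpace ℝ E]

/-- The covector `(δq, δq̇) ↦ ṗ(δq) + p(δq̇)` on `E × E`. -/
def pairCov (r s : E →L[ℝ] ℝ) : E × E →L[ℝ] ℝ :=
  r ∘L ContinuousLinearMap.fst ℝ E E + s ∘L ContinuousLinearMap.snd ℝ E E

lemma pairCov_apply (r s : E →L[ℝ] ℝ) (z : E × E) : pairCov r s z = r z.1 + s z.2 := rfl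

lemma pairCov_comp_inl_inr (γ : E × E →L[ℝ] ℝ) :
    pairCov (γ ∘L ContinuousLinearMap.inl ℝ E E) (γ ∘L ContinuousLinearMap.inr ℝ E E) = γ :=
  ContinuousLinearMap.ext fun z => (clm_apply_prod γ z).symm

variable {X : Type*} [TopologicalSpace X] [ChartedSpace E X] [IsManifold 𝓘(ℝ, E) ∞ X]

/-- The derivative of the identity `Dσ(τ q) Dτ(q) = 1` for a change of charts `τ` with inverse `σ`.
-/
lemma fderiv_fderiv_transition_inverse {x₀ x : X} (hx : x ∈ (chartAt E x₀).source) (z w : E) :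
    fderiv ℝ (fderiv ℝ (transition x x₀)) (extChartAt 𝓘(ℝ, E) x₀ x) (chartDeriv 𝓘(ℝ, E) x₀ x z)
        (chartDeriv 𝓘(ℝ, E) x₀ x w) +
      chartDerivSymm x₀ x
        (fderiv ℝ (fderiv ℝ (transition x₀ x)) (extChartAt 𝓘(ℝ, E) x x) z w) = 0 := by
  have hxx := mem_chart_source E x
  have hτ := contDiffAt_transition hxx hx
  have hσ := contDiffAt_transition hx hxx
  have h2 : HasFDerivAt (transition x₀ x) _ (extChartAt 𝓘(ℝ, E) x x) :=
    (hτ.differentiableAt (by simp)).hasFDerivAt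
  have h3 : HasFDerivAt (fderiv ℝ (transition x₀ x)) _ (extChartAt 𝓘(ℝ, E) x x) :=
    ((hτ.fderiv_right (m := ∞) (by simp)).differentiableAt (by simp)).hasFDerivAt
  have h4 : HasFDerivAt (fderiv ℝ (transition x x₀)) _ (extChartAt 𝓘(ℝ, E) x₀ x) :=
    ((hσ.fderiv_right (m := ∞) (by simp)).differentiableAt (by simp)).hasFDerivAt
  rw [← transition_apply (x₀ := x₀) hxx] at h4
  have h5 := (h4.comp _ h2).clm_apply (h3.clm_apply (hasFDerivAt_const w _))
  have h6 : (fun q => (fderiv ℝ (transition x x₀) ∘ transition x₀ x) q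
      (fderiv ℝ (transition x₀ x) q w)) =ᶠ[𝓝 (extChartAt 𝓘(ℝ, E) x x)] fun _ => w := by
    have h7 := continuousAt_extChartAt_symm (I := 𝓘(ℝ, E)) x
    rw [ContinuousAt, extChartAt_to_inv] at h7
    filter_upwards [h7 ((chartAt E x₀).open_source.mem_nhds hx),
      extChartAt_target_mem_nhds (I := 𝓘(ℝ, E)) x] with q hq hq'
    have hb := (extChartAt 𝓘(ℝ, E) x).map_target hq'
    have hq2 := (extChartAt 𝓘(ℝ, E) x).right_inv hq'
    rw [mem_preimage] at hq
    generalize (extChartAt 𝓘(ℝ, E) x).symm q = y at *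
    rw [extChartAt_source] at hb
    rw [← hq2, Function.comp_apply, transition_apply hb]
    have h8 := chartDeriv_eq_comp hb hq
    have h9 := chartDeriv_eq_comp hq hb
    have h10 := DFunLike.congr_fun h9 (chartDerivSymm x y w)
    have h11 := DFunLike.congr_fun h8 (chartDerivSymm x y w)
    rw [ContinuousLinearMap.comp_apply, chartDeriv_chartDerivSymm hb] at h10 h11
    rw [h11] at h10
    exact h10.symm
  have h8 := DFunLike.congr_fun
    (h5.unique ((hasFDerivAt_const _ _).congr_of_eventuallyEq h6)) z
  rw [chartDeriv_eq_fderiv hx, chartDerivSymm_eq_fderiv hx]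
  refine Eq.trans ?_ h8
  rw [← transition_apply (x₀ := x₀) hxx]
  simp [add_comm]

/-- The Tulczyjew diffeomorphism of `X` has the same expression `(q, p; q̇, ṗ) ↦ (q, q̇; ṗ, p)` in
all charts induced by charts of `X`. -/
lemma pairCov_chartDeriv {a₀ a : CotangentBundle 𝓘(ℝ, E) X} {u₀ : TangentBundle 𝓘(ℝ, E) X}
    (h₀ : u₀.proj = a₀.proj) (ha : a.proj ∈ (chartAt E a₀.proj).source)
    (δ : E × (E →L[ℝ] ℝ)) (z : E × E) :
    pairCov (chartDeriv (cotModel E) a₀ a δ).2 (extChartAt (cotModel E) a₀ a).2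
        (chartDeriv 𝓘(ℝ, E).tangent u₀ (⟨a.proj, δ.1⟩ : TangentBundle 𝓘(ℝ, E) X) z) =
      pairCov δ.2 (covCoord a) z := by
  have hv := chartDeriv_tangent_apply (v₀ := u₀) (v := (⟨a.proj, δ.1⟩ : TangentBundle 𝓘(ℝ, E) X))
    (by rw [h₀]; exact ha) z
  refine (congrArg (pairCov _ _) hv).trans ?_
  rw [pairCov_apply, pairCov_apply, chartDeriv_cotangent_apply ha, extChartAt_cotangent_apply, h₀]
  simp only [add_apply, ContinuousLinearMap.comp_apply, map_add, chartDerivSymm_chartDeriv ha]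
  have h := congrArg (covCoord a) (fderiv_fderiv_transition_inverse ha z.1 δ.1)
  rw [map_add, map_zero, fderiv_fderiv_transition_symm ha (mem_chart_source E a.proj)] at h
  change _ + _ + (covCoord a (chartDerivSymm a₀.proj a.proj (fderiv ℝ (fderiv ℝ
    (transition a₀.proj a.proj)) (extChartAt 𝓘(ℝ, E) a.proj a.proj) z.1 δ.1)) + _) = _
  linarith

end TulczyjewCoord

section JetCoord

variable {F : Type*} [NormedAddCommGroup F] [NormedSpace ℝ F]
  {N : Type*} [TopologicalSpace N] [ChartedSpace (ℝ × F) N] {p : N → ℝ}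
  [IsManifold 𝓘(ℝ, ℝ × F) ∞ N] [IsFibredAtlas F p]

lemma mvfderiv_eq_fst (x : N) (u : ℝ × F) : mvfderiv 𝓘(ℝ, ℝ × F) p x u = u.1 := by
  have h := DFunLike.congr_fun (mvfderiv_comp_symmL (p := p) (mem_chart_source (ℝ × F) x)) u
  have h2 : chartDerivSymm x x u = u := by rw [chartDerivSymm_self]; rfl
  refine Eq.trans ?_ h
  exact (congrArg (mvfderiv 𝓘(ℝ, ℝ × F) p x) h2).symm

/-- The element of `J¹p` which in the preferred chart at `x` has the component `u = (1, q̇)`. -/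
def JetSpace.ofVec (x : N) (u : ℝ × F) (hu : u.1 = 1) : JetSpace F p :=
  ⟨⟨x, u⟩, (mvfderiv_eq_fst x u).trans hu⟩

lemma JetSpace.fst_vecCoord (v : JetSpace F p) : (vecCoord v.incl).1 = 1 :=
  (mvfderiv_eq_fst v.incl.proj (vecCoord v.incl)).symm.trans v.eta_incl

lemma JetSpace.mem_chart_source_iff {v₀ v : JetSpace F p} :
    v ∈ (chartAt (ℝ × (F × F)) v₀).source ↔
      v.incl.proj ∈ (chartAt (ℝ × F) v₀.incl.proj).source :=
  TangentBundle.mem_chart_source_iff v.incl v₀.incl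

end JetCoord

section TulczyjewLinear

variable (F : Type*) [NormedAddCommGroup F] [NormedSpace ℝ F]

/-- The coordinate expression `(t, q, p, q̇, ṗ) ↦ (t, q, q̇, ṗ, p)` of the Tulczyjew diffeomorphism.
-/
def tulczyjewCoord : (ℝ × JetDualModel F) ≃L[ℝ] (ℝ × JetCotangentQuotientModel F) :=
  ContinuousLinearEquiv.equivOfInverse
    ((ContinuousLinearMap.fst ℝ ℝ (JetDualModel F)).prod
      (((ContinuousLinearMap.fst ℝ F (F →L[ℝ] ℝ) ∘L ContinuousLinearMap.fst ℝ _ _ ∘L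
          ContinuousLinearMap.snd ℝ ℝ (JetDualModel F)).prod
        (ContinuousLinearMap.fst ℝ F (F →L[ℝ] ℝ) ∘L ContinuousLinearMap.snd ℝ _ _ ∘L
          ContinuousLinearMap.snd ℝ ℝ (JetDualModel F))).prod
      ((ContinuousLinearMap.compL ℝ (F × F) F ℝ).flip (ContinuousLinearMap.fst ℝ F F) ∘L
          ContinuousLinearMap.snd ℝ F (F →L[ℝ] ℝ) ∘L ContinuousLinearMap.snd ℝ _ _ ∘L
          ContinuousLinearMap.snd ℝ ℝ (JetDualModel F) +
        (ContinuousLinearMap.compL ℝ (F × F) F ℝ).flip (ContinuousLinearMap.snd ℝ F F) ∘L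
          ContinuousLinearMap.snd ℝ F (F →L[ℝ] ℝ) ∘L ContinuousLinearMap.fst ℝ _ _ ∘L
          ContinuousLinearMap.snd ℝ ℝ (JetDualModel F))))
    ((ContinuousLinearMap.fst ℝ ℝ (JetCotangentQuotientModel F)).prod
      (((ContinuousLinearMap.fst ℝ F F ∘L ContinuousLinearMap.fst ℝ _ _ ∘L
          ContinuousLinearMap.snd ℝ ℝ (JetCotangentQuotientModel F)).prod
        ((ContinuousLinearMap.compL ℝ F (F × F) ℝ).flip (ContinuousLinearMap.inr ℝ F F) ∘L
          ContinuousLinearMap.snd ℝ (F × F) ((F × F) →L[ℝ] ℝ) ∘L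
          ContinuousLinearMap.snd ℝ ℝ (JetCotangentQuotientModel F))).prod
      ((ContinuousLinearMap.snd ℝ F F ∘L ContinuousLinearMap.fst ℝ _ _ ∘L
          ContinuousLinearMap.snd ℝ ℝ (JetCotangentQuotientModel F)).prod
        ((ContinuousLinearMap.compL ℝ F (F × F) ℝ).flip (ContinuousLinearMap.inl ℝ F F) ∘L
          ContinuousLinearMap.snd ℝ (F × F) ((F × F) →L[ℝ] ℝ) ∘L
          ContinuousLinearMap.snd ℝ ℝ (JetCotangentQuotientModel F)))))
    (fun z => by
      refine Prod.ext rfl (Prod.ext (Prod.ext rfl ?_) (Prod.ext rfl ?_)) <;>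
      · refine ContinuousLinearMap.ext fun w => ?_
        simp)
    (fun z => by
      refine Prod.ext rfl (Prod.ext rfl ?_)
      exact pairCov_comp_inl_inr z.2.2)

variable {F}

lemma tulczyjewCoord_apply (z : ℝ × JetDualModel F) :
    tulczyjewCoord F z = (z.1, ((z.2.1.1, z.2.2.1), pairCov z.2.2.2 z.2.1.2)) := rfl

/-- The map `(t, q, p, q̇, ṗ) ↦ (t, q, q̇, ṗ, p)` sends the restriction of the complete lift of
`{q, p} = 1` to `{q, ṗ} = {q̇, p} = 1`. -/
lemma sharpRel_tulczyjewCoord [FiniteDimensional ℝ F] :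
    SharpRel (tulczyjewCoord F : (ℝ × JetDualModel F) →L[ℝ] (ℝ × JetCotangentQuotientModel F))
      (jetSharp (etaSharp F)) (etaSharp (F × F)) := by
  intro α
  set T : (ℝ × JetDualModel F) →L[ℝ] (ℝ × JetCotangentQuotientModel F) :=
    (tulczyjewCoord F).toContinuousLinearMap with hT
  have hTa : ∀ z, T z = (z.1, ((z.2.1.1, z.2.2.1), pairCov z.2.2.2 z.2.1.2)) := fun z => rfl
  let ζ := (α ∘L ContinuousLinearMap.inr ℝ ℝ ((F × F) × ((F × F) →L[ℝ] ℝ))) ∘L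
    ContinuousLinearMap.inr ℝ (F × F) ((F × F) →L[ℝ] ℝ)
  let b := bidualInv (F × F) ζ
  have hb : ∀ φ : (F × F) →L[ℝ] ℝ, α (0, (0, φ)) = φ b := fun φ => (apply_bidualInv ζ φ).symm
  rw [jetSharp_apply, completeSharp_apply, etaSharp_apply, etaSharp_apply, etaSharp_apply,
    canonicalSharp_apply, canonicalSharp_apply, canonicalSharp_apply, jetDropL_apply, hTa]
  -- The components of `α ∘ T` along `p` and `ṗ` are the evaluations at `b.2` and at `b.1`.
  have h1 : ∀ β : ((F →L[ℝ] ℝ) →L[ℝ] ℝ), (∀ r, β r = r b.1) → bidualInv F β = b.1 :=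
    fun β h => bidualInv_eq h
  have h2 : ∀ β : ((F →L[ℝ] ℝ) →L[ℝ] ℝ), (∀ r, β r = r b.2) → bidualInv F β = b.2 :=
    fun β h => bidualInv_eq h
  refine Prod.ext rfl (Prod.ext ?_ ?_)
  · refine congrArg₂ (fun e e' : F => ((-e, -e') : F × F)) (h1 _ fun r => ?_)
      (h2 _ fun r => ?_)
    · have h3 := hb (pairCov r 0)
      rw [pairCov_apply, zero_apply, add_zero] at h3
      exact h3
    · have h3 := hb (pairCov 0 r)
      rw [pairCov_apply, zero_apply, zero_add] at h3
      exact h3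
  · refine ContinuousLinearMap.ext fun w => ?_
    change α (T (0, ((w.1, 0), (0, 0)))) + α (T (0, ((0, 0), (w.2, 0)))) = α (0, (w, 0))
    rw [← map_add, hTa, hTa]
    congr 1
    refine Prod.ext (by simp) (Prod.ext (by simp) ?_)
    refine ContinuousLinearMap.ext fun z => ?_
    simp [pairCov_apply]

end TulczyjewLinear

/-! ### The Tulczyjew diffeomorphism of a fibration -/

section TulczyjewDiffeo

variable {F : Type*} [NormedAddCommGroup F] [NormedSpace ℝ F]
  {N : Type*} [TopologicalSpace N] [ChartedSpace (ℝ × F) N] {p : N → ℝ}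
  [IsManifold 𝓘(ℝ, ℝ × F) ∞ N] [IsFibredAtlas F p]

lemma VerticalDual.rep_proj (β : VerticalDual F p) :
    ((VerticalDual.isEtaQuotient F p).rep β).proj = β.proj :=
  congrArg VerticalDual.proj ((VerticalDual.isEtaQuotient F p).apply_rep β)

omit [IsFibredAtlas F p] in
lemma CotangentQuotient.rep_proj (y : CotangentQuotient F p) :
    ((CotangentQuotient.isEtaQuotient F p).rep y).proj = y.proj :=
  congrArg CotangentQuotient.proj ((CotangentQuotient.isEtaQuotient F p).apply_rep y)

lemma VerticalDual.mem_chart_source_iff {β₀ β : VerticalDual F p} :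
    β ∈ (chartAt (ℝ × (F × (F →L[ℝ] ℝ))) β₀).source ↔
      β.proj ∈ (chartAt (ℝ × F) β₀.proj).source := by
  obtain ⟨a, rfl⟩ := (VerticalDual.isEtaQuotient F p).isQuotientMap.surjective β
  refine ((VerticalDual.isEtaQuotient F p).mem_chartAt_source_iff (fun _ => rfl)).trans ?_
  rw [VerticalDual.rep_proj]
  rfl

lemma CotangentQuotient.mem_chart_source_iff {y₀ y : CotangentQuotient F p} :
    y ∈ (chartAt (ℝ × (F × (F →L[ℝ] ℝ))) y₀).source ↔
      y.proj ∈ (chartAt (ℝ × F) y₀.proj).source := by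
  obtain ⟨a, rfl⟩ := (CotangentQuotient.isEtaQuotient F p).isQuotientMap.surjective y
  refine ((CotangentQuotient.isEtaQuotient F p).mem_chartAt_source_iff (fun _ => rfl)).trans ?_
  rw [CotangentQuotient.rep_proj]
  rfl

lemma JetDual.mem_chart_source_iff {w₀ w : JetDual F p} :
    w ∈ (chartAt (ℝ × JetDualModel F) w₀).source ↔
      w.incl.proj.proj ∈ (chartAt (ℝ × F) w₀.incl.proj.proj).source :=
  JetSpace.mem_chart_source_iff.trans VerticalDual.mem_chart_source_iff

lemma JetCotangentQuotient.mem_chart_source_iff {y₀ y : JetCotangentQuotient F p} :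
    y ∈ (chartAt (ℝ × JetCotangentQuotientModel F) y₀).source ↔
      y.proj.incl.proj ∈ (chartAt (ℝ × F) y₀.proj.incl.proj).source :=
  CotangentQuotient.mem_chart_source_iff.trans JetSpace.mem_chart_source_iff

variable (p) in
/-- The image under `Tμ` of the tangent vector of `T*N` at `a` with components `δ = (q̇, ṗ)` in the
preferred chart, where `dt(q̇) = 1`. -/
def liftJetDual (a : CotangentBundle 𝓘(ℝ, ℝ × F) N) (δ : (ℝ × F) × ((ℝ × F) →L[ℝ] ℝ))
    (hδ : δ.1.1 = 1) : JetDual F p :=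
  JetSpace.ofVec (p := VerticalDual.time F p) (VerticalDual.mu F p a) (covDropL F δ) hδ

variable (p) in
/-- The class of the restriction to `J¹p` of the image under the Tulczyjew diffeomorphism of `N` of
the tangent vector of `T*N` at `a` with components `δ = (q̇, ṗ)` in the preferred chart, where
`dt(q̇) = 1`. -/
def liftJetCotangentQuotient (a : CotangentBundle 𝓘(ℝ, ℝ × F) N)
    (δ : (ℝ × F) × ((ℝ × F) →L[ℝ] ℝ)) (hδ : δ.1.1 = 1) : JetCotangentQuotient F p :=
  CotangentQuotient.quot (F × F) (JetSpace.time F p)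
    ⟨JetSpace.ofVec a.proj δ.1 hδ,
      (pairCov δ.2 (covCoord a) ∘L jetLiftL F : ℝ × (F × F) →L[ℝ] ℝ)⟩

lemma exists_eq_liftJetDual (w : JetDual F p) : ∃ a δ hδ, w = liftJetDual p a δ hδ := by
  have hw := w.fst_vecCoord
  obtain ⟨⟨β, u⟩, hu⟩ := w
  obtain ⟨a, rfl⟩ := (VerticalDual.isEtaQuotient F p).isQuotientMap.surjective β
  refine ⟨a, covLift F u, hw, JetSpace.incl_injective ?_⟩
  exact congrArg (Bundle.TotalSpace.mk (VerticalDual.mu F p a)) (covDrop_covLift F u).symm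

lemma quot_eq_liftJetCotangentQuotient (v : JetSpace F p) (γ : (ℝ × F) × (ℝ × F) →L[ℝ] ℝ) :
    CotangentQuotient.quot (F × F) (JetSpace.time F p)
      ⟨v, (γ ∘L jetLiftL F : ℝ × (F × F) →L[ℝ] ℝ)⟩ =
    liftJetCotangentQuotient p ⟨v.incl.proj, γ ∘L ContinuousLinearMap.inr ℝ (ℝ × F) (ℝ × F)⟩
      (vecCoord v.incl, γ ∘L ContinuousLinearMap.inl ℝ (ℝ × F) (ℝ × F)) v.fst_vecCoord := by
  exact congrArg (fun γ' : (ℝ × F) × (ℝ × F) →L[ℝ] ℝ =>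
    CotangentQuotient.quot (F × F) (JetSpace.time F p)
      ⟨v, (γ' ∘L jetLiftL F : ℝ × (F × F) →L[ℝ] ℝ)⟩) (pairCov_comp_inl_inr γ).symm

lemma exists_eq_liftJetCotangentQuotient (y : JetCotangentQuotient F p) :
    ∃ a δ hδ, y = liftJetCotangentQuotient p a δ hδ := by
  obtain ⟨⟨v, α⟩, rfl⟩ :=
    (CotangentQuotient.isEtaQuotient (F × F) (JetSpace.time F p)).isQuotientMap.surjective y
  let γ : ℝ × (F × F) →L[ℝ] ℝ := α
  exact ⟨_, _, _, quot_eq_liftJetCotangentQuotient v (γ ∘L jetDropL F)⟩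

variable {a : CotangentBundle 𝓘(ℝ, ℝ × F) N} {δ : (ℝ × F) × ((ℝ × F) →L[ℝ] ℝ)} {hδ : δ.1.1 = 1}

/-- The chart expression of `liftJetDual` in terms of charts of `T*N`. Only the base point of `a₀`
matters, so that it need not be the representative used by the chart at `w₀`. -/
lemma extChartAt_liftJetDual {w₀ : JetDual F p} {a₀ : CotangentBundle 𝓘(ℝ, ℝ × F) N}
    (h₀ : a₀.proj = w₀.incl.proj.proj) (ha : a.proj ∈ (chartAt (ℝ × F) a₀.proj).source) :
    extChartAt 𝓘(ℝ, ℝ × JetDualModel F) w₀ (liftJetDual p a δ hδ) =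
      jetDropL (F × (F →L[ℝ] ℝ)) (covDropL F (extChartAt (cotModel (ℝ × F)) a₀ a),
        covDropL F (chartDeriv (cotModel (ℝ × F)) a₀ a δ)) := by
  have hV := VerticalDual.isEtaQuotient F p
  have hr : (hV.rep w₀.incl.proj).proj = a₀.proj := (VerticalDual.rep_proj _).trans h₀.symm
  have ha' : a.proj ∈ (chartAt (ℝ × F) (hV.rep w₀.incl.proj).proj).source := by rwa [hr]
  have hm : VerticalDual.mu F p a ∈ (chartAt (EtaModel F) w₀.incl.proj).source :=
    (hV.mem_chartAt_source_iff (fun _ => rfl)).2 ha'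
  have h1 := extChartAt_tangent_apply w₀.incl (liftJetDual p a δ hδ).incl hm
  have h2 : extChartAt 𝓘(ℝ, EtaModel F) w₀.incl.proj (VerticalDual.mu F p a) = _ :=
    hV.extChartAt_apply (fun _ => rfl) ha'
  have h3 := hV.chartDeriv_comp_coordDeriv (fun _ => rfl) hm
  rw [hV.coordDeriv_eq (fun _ => rfl)] at h3
  have h4 := DFunLike.congr_fun h3 δ
  refine (congrArg (jetDropL (F × (F →L[ℝ] ℝ))) h1).trans
    (congrArg (jetDropL (F × (F →L[ℝ] ℝ))) ?_)
  have h5 : chartDeriv (cotModel (ℝ × F)) (hV.rep w₀.incl.proj) =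
      chartDeriv (cotModel (ℝ × F)) a₀ :=
    funext fun b => congrArg (fun φ => coordDeriv (cotModel (ℝ × F))
      𝓘(ℝ, (ℝ × F) × ((ℝ × F) →L[ℝ] ℝ)) φ b) (IsEtaQuotient.extChartAt_congr hr)
  rw [← IsEtaQuotient.extChartAt_congr hr, ← h5]
  exact Prod.ext h2 h4

/-- The chart expression of `liftJetCotangentQuotient` in terms of charts of `N` and `T*N`. -/
lemma extChartAt_liftJetCotangentQuotient {y₀ : JetCotangentQuotient F p}
    {a₀ : CotangentBundle 𝓘(ℝ, ℝ × F) N}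
    (h₀ : a₀.proj = y₀.proj.incl.proj) (ha : a.proj ∈ (chartAt (ℝ × F) a₀.proj).source) :
    extChartAt 𝓘(ℝ, ℝ × JetCotangentQuotientModel F) y₀ (liftJetCotangentQuotient p a δ hδ) =
      ((extChartAt 𝓘(ℝ, ℝ × F) a₀.proj a.proj).1,
        (((extChartAt 𝓘(ℝ, ℝ × F) a₀.proj a.proj).2,
          (chartDeriv 𝓘(ℝ, ℝ × F) a₀.proj a.proj δ.1).2),
        pairCov ((chartDeriv (cotModel (ℝ × F)) a₀ a δ).2 ∘L ContinuousLinearMap.inr ℝ ℝ F)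
          ((extChartAt (cotModel (ℝ × F)) a₀ a).2 ∘L ContinuousLinearMap.inr ℝ ℝ F))) := by
  have hQ := CotangentQuotient.isEtaQuotient (F × F) (JetSpace.time F p)
  let v : JetSpace F p := JetSpace.ofVec a.proj δ.1 hδ
  let γ : ℝ × (F × F) →L[ℝ] ℝ := pairCov δ.2 (covCoord a) ∘L jetLiftL F
  let b : CotangentBundle 𝓘(ℝ, ℝ × (F × F)) (JetSpace F p) := ⟨v, γ⟩
  have hr : (hQ.rep y₀).proj = y₀.proj := CotangentQuotient.rep_proj _
  have hv : v ∈ (chartAt (ℝ × (F × F)) (hQ.rep y₀).proj).source := by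
    rw [JetSpace.mem_chart_source_iff, hr, ← h₀]
    exact ha
  have h1 : extChartAt 𝓘(ℝ, ℝ × JetCotangentQuotientModel F) y₀
      (CotangentQuotient.quot (F × F) (JetSpace.time F p) b) = _ :=
    hQ.extChartAt_apply (fun _ => rfl) hv
  rw [extChartAt_cotangent_apply] at h1
  refine h1.trans ?_
  generalize (hQ.rep y₀).proj = v₀ at hr hv
  rw [← hr] at h₀
  have h2 : extChartAt 𝓘(ℝ, ℝ × (F × F)) v₀ v = ((extChartAt 𝓘(ℝ, ℝ × F) a₀.proj a.proj).1,
      ((extChartAt 𝓘(ℝ, ℝ × F) a₀.proj a.proj).2,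
        (chartDeriv 𝓘(ℝ, ℝ × F) a₀.proj a.proj δ.1).2)) := by
    have h3 := extChartAt_tangent_apply v₀.incl v.incl (JetSpace.mem_chart_source_iff.1 hv)
    rw [h₀]
    exact congrArg (jetDropL F) h3
  have h5 : (γ ∘L chartDerivSymm v₀ v) ∘L ContinuousLinearMap.inr ℝ ℝ (F × F) =
      pairCov ((chartDeriv (cotModel (ℝ × F)) a₀ a δ).2 ∘L ContinuousLinearMap.inr ℝ ℝ F)
          ((extChartAt (cotModel (ℝ × F)) a₀ a).2 ∘L ContinuousLinearMap.inr ℝ ℝ F) := by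
    refine ContinuousLinearMap.ext fun z => ?_
    have h6 := JetSpace.chartDeriv_comp_coordDeriv_incl hv
    rw [JetSpace.coordDeriv_incl] at h6
    have h7 := DFunLike.congr_fun h6 (chartDerivSymm v₀ v (0, z))
    rw [ContinuousLinearMap.comp_apply, ContinuousLinearMap.comp_apply,
      chartDeriv_chartDerivSymm hv] at h7
    have h8 := pairCov_chartDeriv h₀.symm ha δ (jetLiftL F (chartDerivSymm v₀ v (0, z)))
    refine h8.symm.trans ?_
    exact congrArg (pairCov (chartDeriv (cotModel (ℝ × F)) a₀ a δ).2
      (extChartAt (cotModel (ℝ × F)) a₀ a).2) h7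
  change ((extChartAt 𝓘(ℝ, ℝ × (F × F)) v₀ v).1, ((extChartAt 𝓘(ℝ, ℝ × (F × F)) v₀ v).2,
    (γ ∘L chartDerivSymm v₀ v) ∘L ContinuousLinearMap.inr ℝ ℝ (F × F))) = _
  rw [h2, h5]

/-- In corresponding charts, the two images of `(a, δ)` are related by `tulczyjewCoord`. -/
lemma extChartAt_liftJetCotangentQuotient_eq {w₀ : JetDual F p} {y₀ : JetCotangentQuotient F p}
    (h₀ : w₀.incl.proj.proj = y₀.proj.incl.proj)
    (ha : a.proj ∈ (chartAt (ℝ × F) w₀.incl.proj.proj).source) :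
    extChartAt 𝓘(ℝ, ℝ × JetCotangentQuotientModel F) y₀ (liftJetCotangentQuotient p a δ hδ) =
      tulczyjewCoord F (extChartAt 𝓘(ℝ, ℝ × JetDualModel F) w₀ (liftJetDual p a δ hδ)) := by
  let a₀ : CotangentBundle 𝓘(ℝ, ℝ × F) N := ⟨w₀.incl.proj.proj, 0⟩
  rw [extChartAt_liftJetDual (a₀ := a₀) rfl ha,
    extChartAt_liftJetCotangentQuotient (a₀ := a₀) h₀ ha, tulczyjewCoord_apply, jetDropL_apply,
    chartDeriv_cotangent_apply (a₀ := a₀) ha, extChartAt_cotangent_apply]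
  rfl

/-- The two images of `(a, δ)` determine each other: both are determined by the base point and by
chart expressions that correspond under `tulczyjewCoord`. -/
lemma liftJetDual_eq_iff {a' : CotangentBundle 𝓘(ℝ, ℝ × F) N}
    {δ' : (ℝ × F) × ((ℝ × F) →L[ℝ] ℝ)} {hδ' : δ'.1.1 = 1} :
    liftJetDual p a δ hδ = liftJetDual p a' δ' hδ' ↔
      liftJetCotangentQuotient p a δ hδ = liftJetCotangentQuotient p a' δ' hδ' := by
  have key : ∀ b (ε : (ℝ × F) × ((ℝ × F) →L[ℝ] ℝ)) (hε : ε.1.1 = 1), b.proj = a.proj →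
      extChartAt 𝓘(ℝ, ℝ × JetCotangentQuotientModel F) (liftJetCotangentQuotient p a δ hδ)
        (liftJetCotangentQuotient p b ε hε) =
      tulczyjewCoord F (extChartAt 𝓘(ℝ, ℝ × JetDualModel F) (liftJetDual p a δ hδ)
        (liftJetDual p b ε hε)) := fun b ε hε hb =>
    extChartAt_liftJetCotangentQuotient_eq rfl (by rw [hb]; exact mem_chart_source _ _)
  constructor
  · intro h
    have hp : a.proj = a'.proj := congrArg (fun w : JetDual F p => w.incl.proj.proj) h
    refine (extChartAt 𝓘(ℝ, ℝ × JetCotangentQuotientModel F)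
      (liftJetCotangentQuotient p a δ hδ)).injOn (mem_extChartAt_source _) ?_ ?_
    · rw [extChartAt_source, JetCotangentQuotient.mem_chart_source_iff]
      change a'.proj ∈ _
      rw [← hp]
      exact mem_chart_source _ _
    · rw [key _ _ _ rfl, key _ _ _ hp.symm, h]
  · intro h
    have hp : a.proj = a'.proj :=
      congrArg (fun y : JetCotangentQuotient F p => y.proj.incl.proj) h
    refine (extChartAt 𝓘(ℝ, ℝ × JetDualModel F)
      (liftJetDual p a δ hδ)).injOn (mem_extChartAt_source _) ?_ ?_
    · rw [extChartAt_source, JetDual.mem_chart_source_iff]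
      change a'.proj ∈ _
      rw [← hp]
      exact mem_chart_source _ _
    · refine (tulczyjewCoord F).injective ?_
      rw [← key _ _ _ rfl, ← key _ _ _ hp.symm, h]

lemma exists_tulczyjewEquiv : ∃ A : JetDual F p ≃ JetCotangentQuotient F p,
    ∀ a δ hδ, A (liftJetDual p a δ hδ) = liftJetCotangentQuotient p a δ hδ := by
  choose a δ hδ h using exists_eq_liftJetDual (F := F) (p := p)
  have hA : ∀ a' δ' hδ', liftJetCotangentQuotient p (a (liftJetDual p a' δ' hδ')) _ (hδ _) =
      liftJetCotangentQuotient p a' δ' hδ' := fun a' δ' hδ' =>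
    liftJetDual_eq_iff.1 (h (liftJetDual p a' δ' hδ')).symm
  refine ⟨Equiv.ofBijective (fun w => liftJetCotangentQuotient p (a w) (δ w) (hδ w)) ⟨?_, ?_⟩, hA⟩
  · intro w w' hw
    rw [h w, h w']
    exact liftJetDual_eq_iff.2 hw
  · intro y
    obtain ⟨a', δ', hδ', rfl⟩ := exists_eq_liftJetCotangentQuotient y
    exact ⟨liftJetDual p a' δ' hδ', hA a' δ' hδ'⟩

variable (F p) in
/-- The map `Tμ(w) ↦ [A_N(w)|J¹p]`, for tangent vectors `w` of `T*N` over `J¹p`. -/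
def tulczyjewEquiv : JetDual F p ≃ JetCotangentQuotient F p := exists_tulczyjewEquiv.choose

lemma tulczyjewEquiv_liftJetDual (a : CotangentBundle 𝓘(ℝ, ℝ × F) N)
    (δ : (ℝ × F) × ((ℝ × F) →L[ℝ] ℝ)) (hδ : δ.1.1 = 1) :
    tulczyjewEquiv F p (liftJetDual p a δ hδ) = liftJetCotangentQuotient p a δ hδ :=
  exists_tulczyjewEquiv.choose_spec a δ hδ

lemma tulczyjewEquiv_proj (w : JetDual F p) :
    (tulczyjewEquiv F p w).proj.incl.proj = w.incl.proj.proj := by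
  obtain ⟨a, δ, hδ, rfl⟩ := exists_eq_liftJetDual w
  rw [tulczyjewEquiv_liftJetDual]
  rfl

/-- In corresponding charts, the Tulczyjew diffeomorphism is `tulczyjewCoord`. -/
lemma extChartAt_tulczyjewEquiv {w₀ w : JetDual F p} {y₀ : JetCotangentQuotient F p}
    (h₀ : w₀.incl.proj.proj = y₀.proj.incl.proj)
    (hw : w ∈ (chartAt (ℝ × JetDualModel F) w₀).source) :
    extChartAt 𝓘(ℝ, ℝ × JetCotangentQuotientModel F) y₀ (tulczyjewEquiv F p w) =
      tulczyjewCoord F (extChartAt 𝓘(ℝ, ℝ × JetDualModel F) w₀ w) := by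
  rw [JetDual.mem_chart_source_iff] at hw
  obtain ⟨a, δ, hδ, rfl⟩ := exists_eq_liftJetDual w
  rw [tulczyjewEquiv_liftJetDual]
  exact extChartAt_liftJetCotangentQuotient_eq h₀ hw

variable (F p) in
/-- The canonical Tulczyjew diffeomorphism of `p`. -/
def tulczyjewDiffeo : JetDual F p ≃ₘ^∞⟮𝓘(ℝ, ℝ × JetDualModel F),
    𝓘(ℝ, ℝ × JetCotangentQuotientModel F)⟯ JetCotangentQuotient F p where
  toEquiv := tulczyjewEquiv F p
  contMDiff_toFun := by
    intro w₀
    let y₀ := tulczyjewEquiv F p w₀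
    have h₀ : w₀.incl.proj.proj = y₀.proj.incl.proj := (tulczyjewEquiv_proj w₀).symm
    have h1 : tulczyjewCoord F (extChartAt 𝓘(ℝ, ℝ × JetDualModel F) w₀ w₀) ∈
        (extChartAt 𝓘(ℝ, ℝ × JetCotangentQuotientModel F) y₀).target := by
      rw [← extChartAt_tulczyjewEquiv h₀ (mem_chart_source _ w₀)]
      exact mem_extChartAt_target y₀
    have h2 := ((contMDiffOn_extChartAt_symm (I := 𝓘(ℝ, ℝ × JetCotangentQuotientModel F)) (n := ∞)
      y₀).contMDiffAt ((isOpen_extChartAt_target y₀).mem_nhds h1)).comp w₀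
      ((tulczyjewCoord F).contDiff.contMDiff.contMDiffAt.comp w₀
        (contMDiffAt_extChartAt (I := 𝓘(ℝ, ℝ × JetDualModel F))))
    refine h2.congr_of_eventuallyEq ?_
    filter_upwards [(chartAt (ℝ × JetDualModel F) w₀).open_source.mem_nhds
      (mem_chart_source _ w₀)] with w hw
    rw [Function.comp_apply, Function.comp_apply, ← extChartAt_tulczyjewEquiv h₀ hw]
    refine ((extChartAt 𝓘(ℝ, ℝ × JetCotangentQuotientModel F) y₀).left_inv ?_).symm
    rw [extChartAt_source, JetCotangentQuotient.mem_chart_source_iff, tulczyjewEquiv_proj,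
      tulczyjewEquiv_proj]
    exact JetDual.mem_chart_source_iff.1 hw
  contMDiff_invFun := by
    intro y₀
    let w₀ := (tulczyjewEquiv F p).symm y₀
    have hy : tulczyjewEquiv F p w₀ = y₀ := (tulczyjewEquiv F p).apply_symm_apply y₀
    have h₀ : w₀.incl.proj.proj = y₀.proj.incl.proj := by rw [← tulczyjewEquiv_proj, hy]
    have hc : ∀ y ∈ (chartAt (ℝ × JetCotangentQuotientModel F) y₀).source,
        (tulczyjewEquiv F p).symm y ∈ (chartAt (ℝ × JetDualModel F) w₀).source ∧
        extChartAt 𝓘(ℝ, ℝ × JetDualModel F) w₀ ((tulczyjewEquiv F p).symm y) =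
          (tulczyjewCoord F).symm (extChartAt 𝓘(ℝ, ℝ × JetCotangentQuotientModel F) y₀ y) := by
      intro y hy
      have h1 : (tulczyjewEquiv F p).symm y ∈ (chartAt (ℝ × JetDualModel F) w₀).source := by
        rw [JetDual.mem_chart_source_iff, ← tulczyjewEquiv_proj ((tulczyjewEquiv F p).symm y),
          Equiv.apply_symm_apply, h₀]
        exact JetCotangentQuotient.mem_chart_source_iff.1 hy
      have h2 := extChartAt_tulczyjewEquiv h₀ h1
      rw [Equiv.apply_symm_apply] at h2
      exact ⟨h1, by rw [h2, ContinuousLinearEquiv.symm_apply_apply]⟩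
    have h1 : (tulczyjewCoord F).symm (extChartAt 𝓘(ℝ, ℝ × JetCotangentQuotientModel F) y₀ y₀) ∈
        (extChartAt 𝓘(ℝ, ℝ × JetDualModel F) w₀).target := by
      rw [← (hc y₀ (mem_chart_source _ y₀)).2]
      exact mem_extChartAt_target w₀
    have h2 := ((contMDiffOn_extChartAt_symm (I := 𝓘(ℝ, ℝ × JetDualModel F)) (n := ∞)
      w₀).contMDiffAt ((isOpen_extChartAt_target w₀).mem_nhds h1)).comp y₀
      ((tulczyjewCoord F).symm.contDiff.contMDiff.contMDiffAt.comp y₀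
        (contMDiffAt_extChartAt (I := 𝓘(ℝ, ℝ × JetCotangentQuotientModel F))))
    refine h2.congr_of_eventuallyEq ?_
    filter_upwards [(chartAt (ℝ × JetCotangentQuotientModel F) y₀).open_source.mem_nhds
      (mem_chart_source _ y₀)] with y hy
    rw [Function.comp_apply, Function.comp_apply, ← (hc y hy).2]
    refine ((extChartAt 𝓘(ℝ, ℝ × JetDualModel F) w₀).left_inv ?_).symm
    rw [extChartAt_source]
    exact (hc y hy).1

lemma coordDeriv_mu (a : CotangentBundle 𝓘(ℝ, ℝ × F) N) :
    coordDeriv (cotModel (ℝ × F)) 𝓘(ℝ, ℝ × (F × (F →L[ℝ] ℝ))) (VerticalDual.mu F p) a =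
      covDropL F :=
  (VerticalDual.isEtaQuotient F p).coordDeriv_eq (fun _ => rfl) a

/-- The tangent map of `μ` at `A_N⁻¹(γ)`, in terms of `liftJetDual`. -/
lemma tangentMap_mu (v : JetSpace F p) (γ : (ℝ × F) × (ℝ × F) →L[ℝ] ℝ) :
    tangentMap (cotModel (ℝ × F)) 𝓘(ℝ, ℝ × (F × (F →L[ℝ] ℝ))) (VerticalDual.mu F p)
        ((tulczyjew 𝓘(ℝ, ℝ × F) N).symm ⟨v.incl, γ⟩) =
      (liftJetDual p ⟨v.incl.proj, γ ∘L ContinuousLinearMap.inr ℝ (ℝ × F) (ℝ × F)⟩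
        (vecCoord v.incl, γ ∘L ContinuousLinearMap.inl ℝ (ℝ × F) (ℝ × F)) v.fst_vecCoord).incl :=
  congrArg (fun T : (ℝ × F) × ((ℝ × F) →L[ℝ] ℝ) →L[ℝ] ℝ × (F × (F →L[ℝ] ℝ)) =>
    (⟨VerticalDual.mu F p ⟨v.incl.proj, γ ∘L ContinuousLinearMap.inr ℝ (ℝ × F) (ℝ × F)⟩,
      T (vecCoord v.incl, γ ∘L ContinuousLinearMap.inl ℝ (ℝ × F) (ℝ × F))⟩ :
      TangentBundle 𝓘(ℝ, ℝ × (F × (F →L[ℝ] ℝ))) (VerticalDual F p))) (coordDeriv_mu _)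

lemma isTulczyjewDiffeo_tulczyjewDiffeo : IsTulczyjewDiffeo F p (tulczyjewDiffeo F p) := by
  intro v α
  let γ : ℝ × (F × F) →L[ℝ] ℝ := α
  refine ⟨⟨(γ ∘L jetDropL F : (ℝ × F) × (ℝ × F) →L[ℝ] ℝ), ?_⟩, ?_⟩
  · exact congrArg (fun T => (γ ∘L jetDropL F) ∘L T) (JetSpace.coordDeriv_incl v)
  · intro (α' : (ℝ × F) × (ℝ × F) →L[ℝ] ℝ) h
    have h1 : α' ∘L jetLiftL F = γ :=
      (congrArg (fun T => α' ∘L T) (JetSpace.coordDeriv_incl v)).symm.trans h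
    refine Eq.trans ?_ (tangentMap_mu v α').symm
    refine congrArg JetSpace.incl ((tulczyjewEquiv F p).symm_apply_eq.2 ?_)
    rw [tulczyjewEquiv_liftJetDual, ← quot_eq_liftJetCotangentQuotient v α', h1]

/-- The characterizing property determines the inverse on all classes of covectors. -/
lemma isTulczyjewDiffeo_iff (B : JetDual F p ≃ₘ^∞⟮𝓘(ℝ, ℝ × JetDualModel F),
    𝓘(ℝ, ℝ × JetCotangentQuotientModel F)⟯ JetCotangentQuotient F p) :
    IsTulczyjewDiffeo F p B ↔ B = tulczyjewDiffeo F p := by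
  refine ⟨fun h => ?_, fun h => h ▸ isTulczyjewDiffeo_tulczyjewDiffeo⟩
  have h1 : ∀ y, B.symm y = (tulczyjewDiffeo F p).symm y := by
    intro y
    obtain ⟨⟨v, α⟩, rfl⟩ :=
      (CotangentQuotient.isEtaQuotient (F × F) (JetSpace.time F p)).isQuotientMap.surjective y
    obtain ⟨⟨α', hα'⟩, h2⟩ := h v α
    exact JetSpace.incl_injective ((h2 α' hα').trans
      ((isTulczyjewDiffeo_tulczyjewDiffeo v α).2 α' hα').symm)
  refine Diffeomorph.ext fun w => ?_
  have h2 := h1 (B w)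
  rw [B.symm_apply_apply] at h2
  conv_rhs => rw [h2]
  exact ((tulczyjewDiffeo F p).apply_symm_apply (B w)).symm

lemma coordDeriv_tulczyjewDiffeo (w : JetDual F p) :
    coordDeriv 𝓘(ℝ, ℝ × JetDualModel F) 𝓘(ℝ, ℝ × JetCotangentQuotientModel F)
      (tulczyjewDiffeo F p) w = (tulczyjewCoord F).toContinuousLinearMap := by
  have hI : IsManifold 𝓘(ℝ, ℝ × JetDualModel F) 1 (JetDual F p) :=
    IsManifold.of_le (n := ∞) (by simp)
  have hI' : IsManifold 𝓘(ℝ, ℝ × JetCotangentQuotientModel F) 1 (JetCotangentQuotient F p) :=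
    IsManifold.of_le (n := ∞) (by simp)
  let y := tulczyjewDiffeo F p w
  have h1 := coordDeriv_comp (mdifferentiableAt_extChartAt' (mem_chart_source _ y))
    ((tulczyjewDiffeo F p).contMDiff.mdifferentiableAt (by simp) (x := w))
  have h2 : extChartAt 𝓘(ℝ, ℝ × JetCotangentQuotientModel F) y ∘ tulczyjewDiffeo F p =ᶠ[𝓝 w]
      tulczyjewCoord F ∘ extChartAt 𝓘(ℝ, ℝ × JetDualModel F) w := by
    filter_upwards [(chartAt (ℝ × JetDualModel F) w).open_source.mem_nhds
      (mem_chart_source _ w)] with w' hw'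
    exact extChartAt_tulczyjewEquiv (tulczyjewEquiv_proj w).symm hw'
  have h3 := coordDeriv_comp (I := 𝓘(ℝ, ℝ × JetDualModel F)) (I' := 𝓘(ℝ, ℝ × JetDualModel F))
    (I'' := 𝓘(ℝ, ℝ × JetCotangentQuotientModel F))
    (tulczyjewCoord F).differentiableAt.mdifferentiableAt
    (mdifferentiableAt_extChartAt' (mem_chart_source _ w))
  change _ = chartDeriv _ y y ∘L _ at h1
  change _ = _ ∘L chartDeriv _ w w at h3
  rw [chartDeriv_self] at h1 h3
  refine h1.symm.trans (h2.mfderiv_eq.trans (h3.trans ?_))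
  rw [coordDeriv, mfderiv_eq_fderiv]
  exact (tulczyjewCoord F).fderiv

variable [FiniteDimensional ℝ F]

lemma etaSharp_fst : etaSharp F (ContinuousLinearMap.fst ℝ ℝ (F × (F →L[ℝ] ℝ))) = 0 :=
  (etaSharp_eq_zero_iff _).2 ⟨1, (one_smul ℝ _).symm⟩

variable (F p) in
/-- The complete lift of the canonical Poisson structure of the dual of the vertical bundle. -/
def verticalDualComplete : BivectorField 𝓘(ℝ, ℝ × (F × (F →L[ℝ] ℝ))).tangent
    (TangentBundle 𝓘(ℝ, ℝ × (F × (F →L[ℝ] ℝ))) (VerticalDual F p)) :=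
  completeBivector (etaSharp F) (VerticalDual F p) (isAltSharp_etaSharp F)
    ((VerticalDual.isEtaQuotient F p).isChartInvariant_etaSharp fun _ => rfl)

variable (F p) in
/-- The Poisson structure of `J¹p₁*`. -/
def jetDualPoisson : BivectorField 𝓘(ℝ, ℝ × JetDualModel F) (JetDual F p) :=
  JetSpace.bivector (VerticalDual.time F p) (etaSharp F) (isAltSharp_etaSharp F)
    ((VerticalDual.isEtaQuotient F p).isChartInvariant_etaSharp fun _ => rfl) etaSharp_fst

variable (F p) in
/-- The Poisson structure of `T*(J¹p)/⟨η₁⟩`. -/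
def jetCotangentQuotientPoisson :
    BivectorField 𝓘(ℝ, ℝ × JetCotangentQuotientModel F) (JetCotangentQuotient F p) :=
  (CotangentQuotient.isEtaQuotient (F × F) (JetSpace.time F p)).poisson fun _ => rfl

lemma jetDualPoisson_hasCorank_one : (jetDualPoisson F p).HasCorank 1 := by
  unfold jetDualPoisson JetSpace.bivector
  refine constBivector_hasCorank_one (ContinuousLinearMap.fst ℝ ℝ (JetDualModel F)) ?_
    (jetSharp_eq_zero_iff (isAltSharp_etaSharp F) etaSharp_eq_zero_iff)
  intro h
  simpa using DFunLike.congr_fun h ((1 : ℝ), 0)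

lemma isPoissonMap_tulczyjewDiffeo :
    IsPoissonMap (tulczyjewDiffeo F p) (jetDualPoisson F p) (jetCotangentQuotientPoisson F p) := by
  unfold jetDualPoisson JetSpace.bivector jetCotangentQuotientPoisson IsEtaQuotient.poisson
  refine constBivector_isPoissonMap (tulczyjewDiffeo F p).contMDiff fun w => ?_
  rw [coordDeriv_tulczyjewDiffeo]
  exact sharpRel_tulczyjewCoord

end TulczyjewDiffeo

/-! ### The two-vectors of a fibred manifold -/

section Assembly

variable {F : Type*} [NormedAddCommGroup F] [NormedSpace ℝ F] [FiniteDimensional ℝ F]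
  {N : Type*} [TopologicalSpace N] [ChartedSpace (ℝ × F) N] {p : N → ℝ}
  [IsManifold 𝓘(ℝ, ℝ × F) ∞ N] [IsFibredAtlas F p]

lemma isCompleteLift_verticalDualPoisson_iff
    (Λ : BivectorField 𝓘(ℝ, ℝ × (F × (F →L[ℝ] ℝ))).tangent
      (TangentBundle 𝓘(ℝ, ℝ × (F × (F →L[ℝ] ℝ))) (VerticalDual F p))) :
    IsCompleteLift verticalDualPoisson Λ ↔ Λ = verticalDualComplete F p :=
  isCompleteLift_iff Λ

lemma isRestriction_verticalDualComplete_iff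
    (Λ : BivectorField 𝓘(ℝ, ℝ × JetDualModel F) (JetDual F p)) :
    IsRestriction (verticalDualComplete F p) Λ ↔ Λ = jetDualPoisson F p :=
  JetSpace.isPoissonMap_incl_iff Λ

lemma isProjection_canonicalPoisson_iff
    (Λ : BivectorField 𝓘(ℝ, ℝ × JetCotangentQuotientModel F) (JetCotangentQuotient F p)) :
    IsProjection (canonicalPoisson (JetSpace F p)) Λ ↔ Λ = jetCotangentQuotientPoisson F p :=
  (CotangentQuotient.isEtaQuotient (F × F) (JetSpace.time F p)).isPoissonMap_iff (fun _ => rfl) Λ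

variable (F p) in
lemma verticalDualPoisson_isPoisson :
    (verticalDualPoisson : BivectorField _ (VerticalDual F p)).IsPoisson := by
  unfold verticalDualPoisson IsEtaQuotient.poisson
  exact constBivector_isPoisson

variable (F p) in
lemma verticalDualComplete_isPoisson : (verticalDualComplete F p).IsPoisson := by
  unfold verticalDualComplete completeBivector
  exact constBivector_isPoisson

variable (F p) in
lemma jetDualPoisson_isPoisson : (jetDualPoisson F p).IsPoisson := by
  unfold jetDualPoisson JetSpace.bivector
  exact constBivector_isPoisson

variable (F p) in
lemma jetCotangentQuotientPoisson_isPoisson : (jetCotangentQuotientPoisson F p).IsPoisson := by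
  unfold jetCotangentQuotientPoisson IsEtaQuotient.poisson
  exact constBivector_isPoisson

variable (F p) in
lemma jetCotangentQuotientPoisson_hasCorank_one : (jetCotangentQuotientPoisson F p).HasCorank 1 :=
  (CotangentQuotient.isEtaQuotient (F × F) (JetSpace.time F p)).poisson_hasCorank_one fun _ => rfl

end Assembly

end TulczyjewTriple

end

theorem mainTheorem1 {n : ℕ} {M : Type*} [TopologicalSpace M]
    [ChartedSpace (EuclideanSpace ℝ (Fin (n + 1))) M] [IsManifold (𝓡 (n + 1)) ∞ M]
    (π : M → ℝ) (hπ : IsFibration n π) :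
    let F := EuclideanSpace ℝ (Fin n)
    let p : Adapted hπ → ℝ := Adapted.time hπ
    ∃ (ΛV : BivectorField 𝓘(ℝ, ℝ × (F × (F →L[ℝ] ℝ))) (VerticalDual F p))
      (ΛVc : BivectorField 𝓘(ℝ, ℝ × (F × (F →L[ℝ] ℝ))).tangent
        (TangentBundle 𝓘(ℝ, ℝ × (F × (F →L[ℝ] ℝ))) (VerticalDual F p)))
      (ΛJV : BivectorField 𝓘(ℝ, ℝ × JetDualModel F) (JetDual F p))
      (ΛTJ : BivectorField (𝓘(ℝ, ℝ × (F × F)).prod 𝓘(ℝ, (ℝ × (F × F)) →L[ℝ] ℝ))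
        (CotangentBundle 𝓘(ℝ, ℝ × (F × F)) (JetSpace F p)))
      (ΛQ : BivectorField 𝓘(ℝ, ℝ × JetCotangentQuotientModel F) (JetCotangentQuotient F p))
      (A : JetDual F p ≃ₘ^∞⟮𝓘(ℝ, ℝ × JetDualModel F),
        𝓘(ℝ, ℝ × JetCotangentQuotientModel F)⟯ JetCotangentQuotient F p),
      -- `ΛV` is the canonical Poisson structure of `V*π`
      (∀ Λ, IsCanonicalVerticalDual F p Λ ↔ Λ = ΛV) ∧ ΛV.IsPoisson ∧
      -- `ΛVc` is its complete lift to `T(V*π)`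
      (∀ Λ, IsCompleteLift ΛV Λ ↔ Λ = ΛVc) ∧ ΛVc.IsPoisson ∧
      -- `ΛJV` is the restriction of `ΛVc` to `J¹π₁*`
      (∀ Λ, IsRestriction ΛVc Λ ↔ Λ = ΛJV) ∧ ΛJV.IsPoisson ∧ ΛJV.HasCorank 1 ∧
      -- `ΛTJ` is the Poisson structure of the canonical symplectic form of `T*(J¹π)`
      (∀ Λ, IsInverseOfTwoForm (canonicalTwoForm 𝓘(ℝ, ℝ × (F × F)) (JetSpace F p)) Λ ↔ Λ = ΛTJ) ∧
      ΛTJ.IsPoisson ∧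
      -- `ΛQ` is its projection to `T*(J¹π)/⟨η₁⟩`
      (∀ Λ, IsProjection ΛTJ Λ ↔ Λ = ΛQ) ∧ ΛQ.IsPoisson ∧ ΛQ.HasCorank 1 ∧
      -- `A` is the canonical Tulczyjew diffeomorphism, and it is a Poisson isomorphism
      (∀ B, IsTulczyjewDiffeo F p B ↔ B = A) ∧ IsPoissonMap A ΛJV ΛQ := by
  intro F p
  exact ⟨verticalDualPoisson, verticalDualComplete F p, jetDualPoisson F p,
    canonicalPoisson (JetSpace F p), jetCotangentQuotientPoisson F p, tulczyjewDiffeo F p,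
    isCanonicalVerticalDual_iff, verticalDualPoisson_isPoisson F p,
    isCompleteLift_verticalDualPoisson_iff, verticalDualComplete_isPoisson F p,
    isRestriction_verticalDualComplete_iff, jetDualPoisson_isPoisson F p, jetDualPoisson_hasCorank_one,
    isInverseOfTwoForm_canonicalTwoForm_iff, canonicalPoisson_isPoisson _,
    isProjection_canonicalPoisson_iff, jetCotangentQuotientPoisson_isPoisson F p,
    jetCotangentQuotientPoisson_hasCorank_one F p, isTulczyjewDiffeo_iff, isPoissonMap_tulczyjewDiffeo⟩
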